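/- **Setting.** Let $\mathbb N=\{1,2,\dots\}$, $\mathbb N_0=\mathbb N\cup\{0\}$, and let $\mathcal F$ be the set of finitely supported sequences $\boldsymbol\nu=(\nu_j)_{j\in\mathbb N}$ in $\mathbb N_0$, ordered componentwise. Let $\gamma_1$ be the standard Gaussian measure on $\mathbb R$, $\gamma_N=\bigotimes_{j=1}^N\gamma_1$, and $\gamma=\bigotimes_{j\in\mathbb N}\gamma_1$ on $U=\mathbb R^{\infty}$. Let $X$ be a complex separable Hilbert space, $\boldsymbol b=(b_j)_{j\in\mathbb N}\in(0,\infty)^\infty$, $\xi>0$, $\delta>0$. *Holomorphy.* $\boldsymbol\rho\in(0,\infty)^N$ is called admissible if $\sum_{j=1}^N b_j\rho_j\le\xi$. A function $u\in L^2(U,X;\gamma)$ is $(\boldsymbol b,\xi,\delta,X)$-holomorphic if there are functions $u_N:\mathbb R^N\to X$ ($N\in\mathbb N$) such that: 1. for every admissible $\boldsymbol\rho\in(0,\infty)^N$, $u_N$ extends holomorphically to $\{\boldsymbol z\in\mathbb C^N:|\operatorname{Im}z_j|<\rho_j\ \forall j\}$, and $u_N(y_1,\dots,y_N)=u_M(y_1,\dots,y_N,0,\dots,0)$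 on $\mathbb R^N$ for all $N<M$; 2. for every $N$ there is $\varphi_N:\mathbb R^N\to[0,\infty)$ with $\|\varphi_N\|_{L^2(\mathbb R^N;\gamma_N)}\le\delta$ and $\|u_N(\boldsymbol y+\boldsymbol z)\|_X\le\varphi_N(\boldsymbol y)$ for all $\boldsymbol y\in\mathbb R^N$, all admissible $\boldsymbol\rho$, and all $\boldsymbol z\in\mathbb C^N$ with $|z_j|<\rho_j$ for all $j$; 3. $\tilde u_N(\boldsymbol y):=u_N(y_1,\dots,y_N)$ satisfies $\|u-\tilde u_N\|_{L^2(U,X;\gamma)}\to0$ as $N\to\infty$. Point values of $u$ are understood as $u(y_1,\dots,y_N,0,0,\dots):=u_N(y_1,\dots,y_N)$, for any fixed such family $(u_N)_{N\in\mathbb N}$. *Quadrature.* For $n\in\mathbb N_0$ let $\chi_{n,0},\dots,\chi_{n,n}$ be the $n+1$ roots of the probabilists' Hermite polynomial of degree $n+1$ (so $\chi_{0,0}=0$), and $\omega_{n,j}=\int_{\mathbb R}\prod_{i\ne j}\frac{y-\chi_{n,i}}{\chi_{n,j}-\chi_{n,i}}\,d\gamma_1(y)$. For $\boldsymbol\nu\in\mathcal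 F$ put $$\mathbf Q_{\boldsymbol\nu}u=\sum_{\boldsymbol\mu\in\mathcal F,\ \boldsymbol\mu\le\boldsymbol\nu}\Big(\prod_{j\in\mathbb N}\omega_{\nu_j,\mu_j}\Big)\,u\big((\chi_{\nu_j,\mu_j})_{j\in\mathbb N}\big),$$ and for a finite set $\Lambda\subseteq\mathcal F$ $$\mathbf Q_\Lambda u=\sum_{\boldsymbol\nu\in\Lambda}\Big(\sum_{\boldsymbol e\in\{0,1\}^{\infty},\ \boldsymbol\nu+\boldsymbol e\in\Lambda}(-1)^{|\boldsymbol e|}\Big)\mathbf Q_{\boldsymbol\nu}u,\qquad \mathrm{pts}(\Lambda)=\{(\chi_{\nu_j,\mu_j})_{j\in\mathbb N}:\boldsymbol\nu\in\Lambda,\ \boldsymbol\mu\le\boldsymbol\nu\}.$$ *Index sets.* For $p\in(0,1)$ with $\boldsymbol b\in\ell^p(\mathbb N)$, $r\in\mathbb N$, $\tau>0$, $K>0$ and $\varepsilon>0$ let $$\varrho_j=b_j^{p-1}\frac{\xi}{4\sqrt{r!}\,\|\boldsymbol b\|_{\ell^p}},\qquad c_{2,\boldsymbol\nu}=\prod_{j:\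 \nu_j\ne0}\max\{1,K\varrho_j\}^{4}\,\nu_j^{\,r-\tau},\qquad \Lambda_{2,\varepsilon}=\{\boldsymbol\nu\in\mathcal F:c_{2,\boldsymbol\nu}^{-1}\ge\varepsilon\}.$$ **Theorem 6.15.** Let $u$ be $(\boldsymbol b,\xi,\delta,X)$-holomorphic with $\boldsymbol b\in\ell^p(\mathbb N)$ for some $p\in(0,4/5)$. Let $\tau>0$, $K>0$, and let $r\in\mathbb N$ be so large that $$\frac{(r-\tau)\,p}{4(1-p)}>\max\{2,\,5-\tau\}$$ (for instance $\tau=3$ and $r>8/p-5$). Then there exists $C>0$ and, for every $n\in\mathbb N$, there exists $\varepsilon_n>0$ such that $\Lambda_{2,\varepsilon_n}$ is finite, $|\mathrm{pts}(\Lambda_{2,\varepsilon_n})|\le n$, and $$\Big\|\int_U u(\boldsymbol y)\,d\gamma(\boldsymbol y)-\mathbf Q_{\Lambda_{2,\varepsilon_n}}u\Big\|_X\le C\,n^{-\frac2p+\frac52}.$$ -/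

import Mathlib

open MeasureTheory ProbabilityTheory Filter Topology

namespace SparseGrid

noncomputable section

/-! ### Gaussian measures -/

/-- The `N`-fold product of the standard Gaussian measure on `ℝ`. -/
def gaussFin (N : ℕ) : Measure (Fin N → ℝ) :=
  Measure.pi fun _ => gaussianReal 0 1

/-- The countable product of the standard Gaussian measure, on `U = ℝ^∞`. -/
def gaussInf : Measure (ℕ → ℝ) :=
  Measure.infinitePi fun _ => gaussianReal 0 1

/-! ### `(b, ξ, δ, X)`-holomorphy -/

/-- The product of strips `{z : |Im z_j| < ρ_j for all j}`. -/
def strip {N : ℕ} (ρ : Fin N → ℝ) : Set (Fin N → ℂ) :=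
  {z | ∀ j, |(z j).im| < ρ j}

/-- The polydisc `{z : |z_j| < ρ_j for all j}`. -/
def polydisc {N : ℕ} (ρ : Fin N → ℝ) : Set (Fin N → ℂ) :=
  {z | ∀ j, ‖z j‖ < ρ j}

/-- `ρ ∈ (0,∞)^N` is `(b, ξ)`-admissible. -/
def Admissible (b : ℕ → ℝ) (ξ : ℝ) {N : ℕ} (ρ : Fin N → ℝ) : Prop :=
  (∀ j, 0 < ρ j) ∧ ∑ j : Fin N, b j * ρ j ≤ ξ

/-- `u ∈ L²(U, X; γ)` is `(b, ξ, δ, X)`-holomorphic, and `v N : ℝ^N → X` (for `N ≥ 1`) are the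
functions of finitely many variables that the definition of this notion asks for. The value
`v 0` is irrelevant. -/
structure HolomorphicWith {X : Type*} [NormedAddCommGroup X] [InnerProductSpace ℂ X]
    (b : ℕ → ℝ) (ξ δ : ℝ) (u : (ℕ → ℝ) → X) (v : (N : ℕ) → (Fin N → ℝ) → X) : Prop where
  memLp : MemLp u 2 gaussInf
  /-- For every admissible `ρ` the function `v N` has a holomorphic extension `V` to the strip,
  and these extensions are all bounded on real translates of the polydiscs by one function `φ`
  with `‖φ‖_{L²} ≤ δ`. -/
  extension : ∀ N : ℕ, 1 ≤ N → ∃ φ : (Fin N → ℝ) → ℝ,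
    (∀ y, 0 ≤ φ y) ∧ MemLp φ 2 (gaussFin N) ∧
    eLpNorm φ 2 (gaussFin N) ≤ ENNReal.ofReal δ ∧
    ∀ ρ : Fin N → ℝ, Admissible b ξ ρ → ∃ V : (Fin N → ℂ) → X,
      DifferentiableOn ℂ V (strip ρ) ∧
      (∀ y : Fin N → ℝ, V (fun j => (y j : ℂ)) = v N y) ∧
      ∀ y : Fin N → ℝ, ∀ z ∈ polydisc ρ, ‖V (fun j => (y j : ℂ) + z j)‖ ≤ φ y
  compatible : ∀ N M : ℕ, 1 ≤ N → N < M → ∀ y : Fin N → ℝ,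
    v N y = v M (fun i => if h : (i : ℕ) < N then y ⟨i, h⟩ else 0)
  tendsto : Tendsto
    (fun N : ℕ => eLpNorm (fun y : ℕ → ℝ => u y - v N (fun i => y i)) 2 gaussInf) atTop (𝓝 0)

/-- The smallest `N ≥ 1` such that all coordinates of `y` with index at least `N` vanish. -/
def activeDim (y : ℕ → ℝ) : ℕ :=
  sInf {N : ℕ | 1 ≤ N ∧ ∀ j, N ≤ j → y j = 0}

/-- Point evaluation at a finitely supported sequence:
`u(y_1, …, y_N, 0, 0, …) := u_N(y_1, …, y_N)`. -/
def pointEval {X : Type*} (v : (N : ℕ) → (Fin N → ℝ) → X) (y : ℕ → ℝ) : X :=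
  v (activeDim y) (fun i => y i)

/-- The point evaluation does not depend on the number of variables that is used for it. -/
theorem HolomorphicWith.pointEval_eq {X : Type*} [NormedAddCommGroup X] [InnerProductSpace ℂ X]
    {b : ℕ → ℝ} {ξ δ : ℝ} {u : (ℕ → ℝ) → X} {v : (N : ℕ) → (Fin N → ℝ) → X}
    (h : HolomorphicWith b ξ δ u v) {y : ℕ → ℝ} {N : ℕ} (hN : 1 ≤ N)
    (hy : ∀ j, N ≤ j → y j = 0) : pointEval v y = v N (fun i => y i) := by
  have hmem : activeDim y ∈ {N : ℕ | 1 ≤ N ∧ ∀ j, N ≤ j → y j = 0} := Nat.sInf_mem ⟨N, hN, hy⟩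
  have hle : activeDim y ≤ N := Nat.sInf_le ⟨hN, hy⟩
  rcases hle.eq_or_lt with heq | hlt
  · unfold pointEval
    rw [heq]
  · unfold pointEval
    rw [h.compatible _ _ hmem.1 hlt]
    congr 1
    funext i
    by_cases hi : (i : ℕ) < activeDim y
    · simp [hi]
    · simp [hi, hmem.2 i (not_lt.mp hi)]

/-! ### Gauss–Hermite points and Smolyak quadrature -/

/-- The normalized probabilistic Hermite polynomial of degree `k`. -/
def hermiteH (k : ℕ) : Polynomial ℝ :=
  Polynomial.C (Real.sqrt (k.factorial : ℝ))⁻¹ *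
    (Polynomial.hermite k).map (Int.castRingHom ℝ)

/-- `node n j`, for `0 ≤ j ≤ n`, are the roots of the Hermite polynomial of degree `n + 1`, in
increasing order. -/
def node (n j : ℕ) : ℝ :=
  ((hermiteH (n + 1)).roots.sort (· ≤ ·)).getD j 0

theorem node_zero_zero : node 0 0 = 0 := by
  simp [node, hermiteH]

/-- The Gauss–Hermite weights `∫ ∏_{i ≠ j} (y - χ_{n,i}) / (χ_{n,j} - χ_{n,i}) dγ₁(y)`. -/
def weight (n j : ℕ) : ℝ :=
  ∫ y, ∏ i ∈ (Finset.range (n + 1)).erase j, (y - node n i) / (node n j - node n i)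
    ∂(gaussianReal 0 1)

/-- The sequence `(χ_{ν_j, μ_j})_j`. -/
def gridPoint (ν μ : ℕ →₀ ℕ) : ℕ → ℝ := fun j => node (ν j) (μ j)

/-- The tensorized quadrature `⨂_j Q_{ν_j}`. The factors with `ν_j = 0` have the weight `1`. -/
def tensorQuad {X : Type*} [AddCommMonoid X] [Module ℝ X]
    (v : (N : ℕ) → (Fin N → ℝ) → X) (ν : ℕ →₀ ℕ) : X :=
  ∑ μ ∈ Finset.Icc 0 ν, (∏ j ∈ ν.support, weight (ν j) (μ j)) • pointEval v (gridPoint ν μ)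

open Classical in
/-- The combination coefficient: the sum of `(-1)^|e|` over the sequences `e` of zeros and ones
with `ν + e ∈ Λ`. The summation variable is `l = ν + e`. -/
def combCoeff (Λ : Finset (ℕ →₀ ℕ)) (ν : ℕ →₀ ℕ) : ℝ :=
  ∑ l ∈ Λ with ν ≤ l ∧ ∀ j, l j ≤ ν j + 1, (-1) ^ (l - ν).degree

/-- The Smolyak quadrature with the index set `Λ`. -/
def smolyakQuad {X : Type*} [AddCommMonoid X] [Module ℝ X]
    (Λ : Finset (ℕ →₀ ℕ)) (v : (N : ℕ) → (Fin N → ℝ) → X) : X :=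
  ∑ ν ∈ Λ, combCoeff Λ ν • tensorQuad v ν

/-- The set of all quadrature points that belong to the index set `Λ`. -/
def pts (Λ : Set (ℕ →₀ ℕ)) : Set (ℕ → ℝ) :=
  {y | ∃ ν ∈ Λ, ∃ μ ≤ ν, y = gridPoint ν μ}

/-! ### The index sets -/

/-- `ϱ_j = b_j^{p-1} ξ / (4 √(r!) ‖b‖_{ℓ^p})`. -/
def rhoSeq (b : ℕ → ℝ) (p ξ : ℝ) (r : ℕ) (j : ℕ) : ℝ :=
  b j ^ (p - 1) * (ξ / (4 * Real.sqrt (r.factorial : ℝ) * (∑' i, b i ^ p) ^ (1 / p)))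

/-- `c_{k,ν} = ∏_{j ∈ supp ν} max{1, K ϱ_j}^{2k} ν_j^{r-τ}`. -/
def cWeight (k : ℕ) (K : ℝ) (ϱ : ℕ → ℝ) (r τ : ℝ) (ν : ℕ →₀ ℕ) : ℝ :=
  ∏ j ∈ ν.support, max 1 (K * ϱ j) ^ (2 * k) * (ν j : ℝ) ^ (r - τ)

/-- `Λ_ε = {ν : c_ν⁻¹ ≥ ε}`. -/
def indexSet (c : (ℕ →₀ ℕ) → ℝ) (ε : ℝ) : Set (ℕ →₀ ℕ) :=
  {ν | ε ≤ (c ν)⁻¹}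

end

end SparseGrid

/-!
Expand `u_N` in normalized Hermite polynomials, with coefficients `c_ν`. Integration by parts turns
derivatives of `u_N` into Hermite coefficients and Cauchy's formula turns them into averages over
circles of radius `ρ_j ~ b_j ^ (p - 1)`, so Bessel's inequality for the orthonormal functions
`∏ H_{m_j}(x_j) e^{i a_j θ_j}` gives `∑ w_ν ‖c_ν‖² ≤ δ²` with weights `w_ν` comparable to
`∏ max(1, K ϱ_j) ^ 4 ν_j ^ r`, uniformly in `N`; the product runs over `ν_j ≥ 2`.

The Smolyak quadrature is exact on the Hermite polynomials with index in `Λ`, as well as on those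
with some `ν_j = 1`, and its error on the other ones is at most `∏ C ν_j ^ 2`. By the Cauchy–Schwarz
inequality the squared quadrature error is at most `δ²` times the sum of `w_ν⁻¹ ∏ C² ν_j ^ 4` over
`ν ∉ Λ`, where `c_{2,ν}⁻¹ < ε`. Taking out the factor `c_{2,ν} ^ (s - 1) ≤ ε ^ (1 - s)` with
`s = p / (4 (1 - p))` leaves a convergent sum. In the same way the number of points is
`O(ε ^ (-s))`, and `ε ~ n ^ (-1 / s)` gives the rate
`n ^ (-(1 - s) / (2 s)) = n ^ (-2 / p + 5 / 2)`.
-/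

open scoped ComplexConjugate

local notation "γ₁" => gaussianReal 0 1

namespace SparseGrid

section HermitePolynomials

open Polynomial

theorem derivative_hermite_succ (n : ℕ) :
    derivative (hermite (n + 1)) = (n + 1 : ℤ[X]) * hermite n := by
  induction n with
  | zero => simp
  | succ n ih =>
    rw [hermite_succ (n + 1), derivative_sub, derivative_mul, ih, derivative_X, derivative_mul,
      hermite_succ n, derivative_add, derivative_natCast, derivative_one]
    push_cast
    ring

theorem sqrt_factorial_succ (k : ℕ) :
    √((k + 1).factorial : ℝ) = √(k + 1) * √(k.factorial : ℝ) := by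
  rw [Nat.factorial_succ, Nat.cast_mul, Nat.cast_succ, Real.sqrt_mul (by positivity)]

@[simp] theorem hermiteH_zero : hermiteH 0 = 1 := by simp [hermiteH]

theorem sqrt_mul_hermiteH_succ (k : ℕ) :
    C √(k + 1) * hermiteH (k + 1) = X * hermiteH k - derivative (hermiteH k) := by
  have hsqrt : √(k + 1 : ℝ) * (√((k + 1).factorial : ℝ))⁻¹ = (√(k.factorial : ℝ))⁻¹ := by
    rw [sqrt_factorial_succ]
    field_simp
  rw [hermiteH, hermiteH, ← mul_assoc, ← C_mul, hsqrt, hermite_succ, derivative_C_mul,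
    Polynomial.map_sub, Polynomial.map_mul, Polynomial.map_X, derivative_map]
  ring

theorem derivative_hermiteH_succ (k : ℕ) :
    derivative (hermiteH (k + 1)) = C √(k + 1) * hermiteH k := by
  have hsqrt : (√((k + 1).factorial : ℝ))⁻¹ * (k + 1 : ℕ) =
      √(k + 1) * (√(k.factorial : ℝ))⁻¹ := by
    rw [sqrt_factorial_succ, Nat.cast_succ]
    field_simp
    rw [Real.sq_sqrt (by positivity)]
  rw [hermiteH, hermiteH, derivative_C_mul, derivative_map, derivative_hermite_succ, ← mul_assoc,
    ← C_mul, ← hsqrt, Polynomial.map_mul, C_mul, mul_assoc, C_eq_natCast]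
  simp

@[simp] theorem hermiteH_one : hermiteH 1 = X := by
  simpa using sqrt_mul_hermiteH_succ 0

theorem hermiteH_add_two (k : ℕ) :
    C √(k + 2) * hermiteH (k + 2) = X * hermiteH (k + 1) - C √(k + 1) * hermiteH k := by
  rw [← derivative_hermiteH_succ, ← sqrt_mul_hermiteH_succ, Nat.cast_succ, add_assoc,
    one_add_one_eq_two]

theorem degree_hermiteH (k : ℕ) : (hermiteH k).degree = k := by
  rw [hermiteH, degree_C_mul (by positivity), (hermite_monic k).degree_map, degree_hermite]

theorem natDegree_hermiteH (k : ℕ) : (hermiteH k).natDegree = k :=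
  natDegree_eq_of_degree_eq_some (degree_hermiteH k)

theorem hermiteH_ne_zero (k : ℕ) : hermiteH k ≠ 0 := fun h => by
  simpa [h] using degree_hermiteH k

end HermitePolynomials

/-- The normalized Hermite polynomial, as a function. -/
noncomputable def hermiteFun (m : ℕ) (x : ℝ) : ℝ := (hermiteH m).eval x

@[simp] theorem hermiteFun_zero (x : ℝ) : hermiteFun 0 x = 1 := by simp [hermiteFun]

@[simp] theorem hermiteFun_one (x : ℝ) : hermiteFun 1 x = x := by simp [hermiteFun]

theorem hermiteFun_add_two (k : ℕ) (x : ℝ) :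
    √(k + 2) * hermiteFun (k + 2) x = x * hermiteFun (k + 1) x - √(k + 1) * hermiteFun k x := by
  simpa [hermiteFun] using congrArg (Polynomial.eval x) (hermiteH_add_two k)

@[fun_prop] theorem continuous_hermiteFun (m : ℕ) : Continuous (hermiteFun m) :=
  (hermiteH m).continuous

theorem hasDerivAt_hermiteFun_succ (m : ℕ) (x : ℝ) :
    HasDerivAt (hermiteFun (m + 1)) (√(m + 1) * hermiteFun m x) x :=
  ((hermiteH (m + 1)).hasDerivAt x).congr_deriv (by simp [derivative_hermiteH_succ, hermiteFun])

theorem hasDerivAt_hermiteFun (m : ℕ) (x : ℝ) :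
    HasDerivAt (hermiteFun m) (x * hermiteFun m x - √(m + 1) * hermiteFun (m + 1) x) x := by
  refine ((hermiteH m).hasDerivAt x).congr_deriv ?_
  have h := congrArg (Polynomial.eval x) (sqrt_mul_hermiteH_succ m)
  simp only [Polynomial.eval_mul, Polynomial.eval_C, Polynomial.eval_sub, Polynomial.eval_X] at h
  simp only [hermiteFun]
  linarith

theorem hermiteFun_neg (m : ℕ) (x : ℝ) : hermiteFun m (-x) = (-1) ^ m * hermiteFun m x := by
  induction m using Nat.twoStepInduction with
  | zero => simp
  | one => simp
  | more k ih ih' =>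
    have h := hermiteFun_add_two k (-x)
    rw [ih, ih'] at h
    have hk : √(k + 2 : ℝ) ≠ 0 := by positivity
    apply mul_left_cancel₀ hk
    linear_combination h - (-1) ^ k * hermiteFun_add_two k x

theorem abs_hermiteFun_zero_le (m : ℕ) : |hermiteFun m 0| ≤ 1 := by
  induction m using Nat.twoStepInduction with
  | zero => simp
  | one => simp
  | more k ih _ =>
    have h := congrArg abs (hermiteFun_add_two k 0)
    rw [zero_mul, zero_sub, abs_neg, abs_mul, abs_mul, abs_of_nonneg (Real.sqrt_nonneg _),
      abs_of_nonneg (Real.sqrt_nonneg _)] at h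
    have hk : 0 < √(k + 2 : ℝ) := by positivity
    refine le_of_mul_le_mul_left ?_ hk
    calc √(k + 2 : ℝ) * |hermiteFun (k + 2) 0| = √(k + 1) * |hermiteFun k 0| := h
      _ ≤ √(k + 2) * 1 := by gcongr; norm_num

section LocalBounds

/-- An energy of the solution `H_{m+1} e^{-x²/4}` of the oscillator equation
`f'' + (m + 3/2 - x²/4) f = 0`: the sum of `f'²` and `(m + 3/2 - x²/4) f²`. -/
noncomputable def hermiteEnergy (m : ℕ) (x : ℝ) : ℝ :=
  Real.exp (-x ^ 2 / 2) * ((√(m + 1) * hermiteFun m x - x / 2 * hermiteFun (m + 1) x) ^ 2 +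
    ((m : ℝ) + 3 / 2 - x ^ 2 / 4) * hermiteFun (m + 1) x ^ 2)

theorem hasDerivAt_exp_neg_sq_div_two (x : ℝ) :
    HasDerivAt (fun x : ℝ => Real.exp (-x ^ 2 / 2)) (Real.exp (-x ^ 2 / 2) * (-x)) x := by
  refine HasDerivAt.exp (((hasDerivAt_pow 2 x).neg.div_const 2).congr_deriv ?_)
  push_cast
  ring

theorem hasDerivAt_hermiteEnergy (m : ℕ) (x : ℝ) :
    HasDerivAt (hermiteEnergy m)
      (-(x / 2 * hermiteFun (m + 1) x ^ 2 * Real.exp (-x ^ 2 / 2))) x := by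
  have hH := hasDerivAt_hermiteFun m x
  have hH' := hasDerivAt_hermiteFun_succ m x
  refine ((hasDerivAt_exp_neg_sq_div_two x).mul
    ((((hH.const_mul √(m + 1 : ℝ)).sub (((hasDerivAt_id x).div_const 2).mul hH')).pow 2).add
    ((((hasDerivAt_pow 2 x).div_const 4).const_sub ((m : ℝ) + 3 / 2)).mul
      (hH'.pow 2)))).congr_deriv ?_
  have hm : (m : ℝ) = √(m + 1 : ℝ) ^ 2 - 1 := by rw [Real.sq_sqrt (by positivity)]; ring
  simp only [Pi.mul_apply, Pi.sub_apply, id, Pi.pow_apply, Pi.add_apply]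
  generalize √(m + 1 : ℝ) = s at hm ⊢
  rw [hm]
  push_cast
  ring

theorem hermiteEnergy_antitoneOn (m : ℕ) : AntitoneOn (hermiteEnergy m) (Set.Ici 0) := by
  refine antitoneOn_of_hasDerivWithinAt_nonpos (convex_Ici 0)
    (fun x _ => (hasDerivAt_hermiteEnergy m x).continuousAt.continuousWithinAt)
    (fun x _ => (hasDerivAt_hermiteEnergy m x).hasDerivWithinAt) fun x hx => ?_
  rw [interior_Ici, Set.mem_Ioi] at hx
  rw [neg_nonpos]
  positivity

theorem hermiteEnergy_zero_le (m : ℕ) : hermiteEnergy m 0 ≤ 2 * m + 5 / 2 := by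
  have h : ∀ k, hermiteFun k 0 ^ 2 ≤ 1 := fun k =>
    (sq_le_one_iff_abs_le_one _).2 (abs_hermiteFun_zero_le k)
  have hs : √(m + 1 : ℝ) ^ 2 = m + 1 := Real.sq_sqrt (by positivity)
  calc hermiteEnergy m 0
      = √(m + 1) ^ 2 * hermiteFun m 0 ^ 2 + (m + 3 / 2) * hermiteFun (m + 1) 0 ^ 2 := by
        simp [hermiteEnergy, mul_pow]
    _ ≤ √(m + 1) ^ 2 * 1 + (m + 3 / 2) * 1 := by gcongr <;> apply h
    _ = 2 * m + 5 / 2 := by rw [hs]; ring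

theorem hermiteFun_sq_mul_le (m : ℕ) {x : ℝ} (hx : 0 ≤ x) :
    ((m : ℝ) + 1 / 2 - x ^ 2 / 4) * hermiteFun m x ^ 2 * Real.exp (-x ^ 2 / 2) ≤
      2 * m + 1 / 2 := by
  rcases m with _ | m
  · have h1 : Real.exp (-x ^ 2 / 2) ≤ 1 := Real.exp_le_one_iff.2 (by nlinarith)
    have h2 := Real.exp_pos (-x ^ 2 / 2)
    simp only [Nat.cast_zero, hermiteFun_zero]
    nlinarith [sq_nonneg x]
  · have h := (hermiteEnergy_antitoneOn m Set.self_mem_Ici hx hx).trans (hermiteEnergy_zero_le m)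
    have hsq : 0 ≤ Real.exp (-x ^ 2 / 2) *
      (√(m + 1) * hermiteFun m x - x / 2 * hermiteFun (m + 1) x) ^ 2 := by positivity
    rw [hermiteEnergy] at h
    push_cast
    linarith

theorem abs_hermiteFun_le (m : ℕ) {x : ℝ} (hx : x ^ 2 ≤ 2 * m) :
    |hermiteFun m x| ≤ 2 * Real.exp (x ^ 2 / 4) := by
  wlog h0 : 0 ≤ x generalizing x
  · simpa [hermiteFun_neg, abs_mul] using this (x := -x) (by simpa using hx) (by linarith)
  refine abs_le_of_sq_le_sq ?_ (by positivity)
  have hexp : Real.exp (x ^ 2 / 4) ^ 2 * Real.exp (-x ^ 2 / 2) = 1 := by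
    rw [← Real.exp_nat_mul, ← Real.exp_add, ← Real.exp_zero]
    push_cast
    ring_nf
  have hle : hermiteFun m x ^ 2 * Real.exp (-x ^ 2 / 2) ≤ 4 := by
    have h := hermiteFun_sq_mul_le m h0
    have hy : 0 ≤ hermiteFun m x ^ 2 * Real.exp (-x ^ 2 / 2) := by positivity
    by_contra! hlt
    nlinarith [(Nat.cast_nonneg m : (0 : ℝ) ≤ m)]
  refine le_of_mul_le_mul_right ?_ (Real.exp_pos (-x ^ 2 / 2))
  rw [mul_pow, mul_assoc, hexp]
  linarith

theorem exists_forall_abs_hermiteFun_le (R : ℝ) :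
    ∃ C : ℝ, 1 ≤ C ∧ ∀ m x, |x| ≤ R → |hermiteFun m x| ≤ C := by
  obtain ⟨M, hM⟩ := exists_nat_ge (R ^ 2)
  have hcompact (m : ℕ) : ∃ C : ℝ, ∀ x ∈ Set.Icc (-R) R, ‖hermiteFun m x‖ ≤ C :=
    isCompact_Icc.exists_bound_of_continuousOn (continuous_hermiteFun m).continuousOn
  choose D hD using hcompact
  have hsum : 0 ≤ ∑ m ∈ Finset.range M, |D m| := Finset.sum_nonneg fun _ _ => abs_nonneg _
  have hexp := Real.one_le_exp (show 0 ≤ R ^ 2 / 4 by positivity)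
  refine ⟨2 * Real.exp (R ^ 2 / 4) + ∑ m ∈ Finset.range M, |D m|, by linarith, fun m x hx => ?_⟩
  rcases lt_or_ge m M with hm | hm
  · have hDm := Finset.single_le_sum (f := fun m => |D m|) (fun _ _ => abs_nonneg _)
      (Finset.mem_range.2 hm)
    have hx' : |hermiteFun m x| ≤ D m := hD m x (abs_le.1 hx)
    linarith [le_abs_self (D m)]
  · have hxR : x ^ 2 ≤ R ^ 2 := sq_le_sq' (abs_le.1 hx).1 (abs_le.1 hx).2
    have hmM : (M : ℝ) ≤ m := by exact_mod_cast hm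
    have hx' := abs_hermiteFun_le m (x := x) (by nlinarith [sq_nonneg R])
    have : Real.exp (x ^ 2 / 4) ≤ Real.exp (R ^ 2 / 4) := by gcongr
    linarith

end LocalBounds

section GaussianIntegrals

variable {E : Type*} [NormedAddCommGroup E] [NormedSpace ℝ E]

theorem hasDerivAt_gaussianPDFReal (x : ℝ) :
    HasDerivAt (gaussianPDFReal 0 1) (-x * gaussianPDFReal 0 1 x) x := by
  have h := (hasDerivAt_exp_neg_sq_div_two x).const_mul (√(2 * Real.pi))⁻¹
  have hpdf : gaussianPDFReal 0 1 = fun x => (√(2 * Real.pi))⁻¹ * Real.exp (-x ^ 2 / 2) := by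
    simp [gaussianPDFReal_def]
  rw [hpdf]
  exact h.congr_deriv (by ring)

theorem integrable_gaussianReal_iff_integrable_smul {f : ℝ → E} :
    Integrable f γ₁ ↔ Integrable fun x => gaussianPDFReal 0 1 x • f x := by
  rw [gaussianReal_of_var_ne_zero 0 one_ne_zero, integrable_withDensity_iff_integrable_smul'
    (measurable_gaussianPDF 0 1) (ae_of_all _ fun _ => gaussianPDF_lt_top)]
  simp only [toReal_gaussianPDF]

theorem hasDerivAt_gaussianPDFReal_mul_hermiteFun (m : ℕ) (x : ℝ) :
    HasDerivAt (fun x => gaussianPDFReal 0 1 x * hermiteFun m x)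
      (-√(m + 1) * (gaussianPDFReal 0 1 x * hermiteFun (m + 1) x)) x :=
  ((hasDerivAt_gaussianPDFReal x).mul (hasDerivAt_hermiteFun m x)).congr_deriv (by ring)

theorem integral_hermiteFun_smul_deriv {g g' : ℝ → E} (m : ℕ)
    (hg : ∀ x, HasDerivAt g (g' x) x)
    (hint : ∀ k, Integrable (fun x => hermiteFun k x • g x) γ₁)
    (hint' : Integrable (fun x => hermiteFun m x • g' x) γ₁) :
    ∫ x, hermiteFun m x • g' x ∂γ₁ = √(m + 1) • ∫ x, hermiteFun (m + 1) x • g x ∂γ₁ := by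
  have hi (k : ℕ) := integrable_gaussianReal_iff_integrable_smul.1 (hint k)
  have hi' := integrable_gaussianReal_iff_integrable_smul.1 hint'
  have his : Integrable fun x =>
      √(m + 1 : ℝ) • gaussianPDFReal 0 1 x • hermiteFun (m + 1) x • g x := (hi (m + 1)).smul _
  rw [integral_gaussianReal_eq_integral_smul one_ne_zero,
    integral_gaussianReal_eq_integral_smul one_ne_zero, ← integral_smul, ← sub_eq_zero,
    ← integral_sub hi' his]
  refine integral_eq_zero_of_hasDerivAt_of_integrable (f := fun x =>
    (gaussianPDFReal 0 1 x * hermiteFun m x) • g x) (fun x => ?_) (hi'.sub his) ?_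
  · refine ((hasDerivAt_gaussianPDFReal_mul_hermiteFun m x).smul (hg x)).congr_deriv ?_
    module
  · simpa only [mul_smul] using hi m

end GaussianIntegrals

section Orthogonality

open Polynomial

theorem integrable_eval_gaussianReal (P : ℝ[X]) : Integrable (fun x => P.eval x) γ₁ := by
  induction P using Polynomial.induction_on' with
  | add p q hp hq => simpa [Pi.add_def] using hp.add hq
  | monomial n a =>
    have hpow : Integrable (fun x : ℝ => ‖x‖ ^ n) γ₁ :=
      (memLp_id_gaussianReal (n : NNReal)).integrable_norm_pow'
    have hpow' : Integrable (fun x : ℝ => x ^ n) γ₁ := by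
      rw [← integrable_norm_iff (by fun_prop)]
      simpa using hpow
    simpa using hpow'.const_mul a

theorem integral_hermiteFun_mul_eval_derivative (m : ℕ) (P : ℝ[X]) :
    ∫ x, hermiteFun m x * (derivative P).eval x ∂γ₁ =
      √(m + 1) * ∫ x, hermiteFun (m + 1) x * P.eval x ∂γ₁ := by
  have hint (k : ℕ) (Q : ℝ[X]) : Integrable (fun x => hermiteFun k x * Q.eval x) γ₁ := by
    simpa [hermiteFun] using integrable_eval_gaussianReal (hermiteH k * Q)
  exact integral_hermiteFun_smul_deriv m P.hasDerivAt (fun k => hint k P) (hint m _)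

theorem integral_hermiteFun_mul_eval_eq_zero {m : ℕ} {P : ℝ[X]} (hP : P.degree < m) :
    ∫ x, hermiteFun m x * P.eval x ∂γ₁ = 0 := by
  induction m generalizing P with
  | zero => simp_all
  | succ m ih =>
    have hdeg : (derivative P).degree < m := by
      rw [degree_lt_iff_coeff_zero] at hP ⊢
      intro k hk
      rw [coeff_derivative, hP (k + 1) (by omega), zero_mul]
    have h := integral_hermiteFun_mul_eval_derivative m P
    rw [ih hdeg] at h
    exact (mul_eq_zero.1 h.symm).resolve_left (by positivity)

theorem integral_hermiteFun_mul (i j : ℕ) :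
    ∫ x, hermiteFun i x * hermiteFun j x ∂γ₁ = if i = j then 1 else 0 := by
  induction i generalizing j with
  | zero =>
    rcases j with _ | j
    · simp
    · have h := integral_hermiteFun_mul_eval_eq_zero (m := j + 1) (P := 1)
        (by rw [degree_one]; exact_mod_cast j.succ_pos)
      simpa using h
  | succ i ih =>
    have h := integral_hermiteFun_mul_eval_derivative i (hermiteH j)
    have hi : √(i + 1 : ℝ) ≠ 0 := by positivity
    rw [← mul_right_inj' hi]
    refine h.symm.trans ?_
    rcases j with _ | j
    · simp
    · have hderiv (x : ℝ) :
          (derivative (hermiteH (j + 1))).eval x = √(j + 1) * hermiteFun j x := by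
        simp [derivative_hermiteH_succ, hermiteFun]
      simp only [hderiv, mul_left_comm, integral_const_mul, ih]
      split_ifs <;> simp_all

theorem integral_hermiteFun (m : ℕ) : ∫ x, hermiteFun m x ∂γ₁ = if m = 0 then 1 else 0 := by
  simpa using integral_hermiteFun_mul m 0

end Orthogonality

section Roots

open Polynomial

theorem christoffel_darboux (n : ℕ) (z w : ℂ) :
    (z - w) * ∑ k ∈ Finset.range (n + 1), aeval z (hermiteH k) * aeval w (hermiteH k) =
      (√(n + 1) : ℂ) * (aeval z (hermiteH (n + 1)) * aeval w (hermiteH n) -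
        aeval z (hermiteH n) * aeval w (hermiteH (n + 1))) := by
  induction n with
  | zero => simp
  | succ n ih =>
    have hz := congrArg (aeval z) (hermiteH_add_two n)
    have hw := congrArg (aeval w) (hermiteH_add_two n)
    simp only [map_mul, map_sub, aeval_C, aeval_X, Complex.coe_algebraMap] at hz hw
    have hcast : ((n + 1 : ℕ) : ℝ) + 1 = n + 2 := by push_cast; ring
    rw [Finset.sum_range_succ, mul_add, ih, hcast]
    linear_combination (-aeval w (hermiteH (n + 1))) * hz + aeval z (hermiteH (n + 1)) * hw

theorem im_eq_zero_of_aeval_hermiteH_eq_zero {n : ℕ} {z : ℂ} (h : aeval z (hermiteH n) = 0) :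
    z.im = 0 := by
  rcases n with _ | n
  · simp at h
  have hcd := christoffel_darboux n z (starRingEnd ℂ z)
  simp only [aeval_conj, h, map_zero, zero_mul, mul_zero, sub_zero, Complex.mul_conj,
    ← Complex.ofReal_sum] at hcd
  refine Complex.conj_eq_iff_im.1 (sub_eq_zero.1 ((mul_eq_zero.1 hcd).resolve_right ?_)).symm
  rw [Complex.ofReal_eq_zero, Finset.sum_range_succ']
  have : 0 ≤ ∑ k ∈ Finset.range n, Complex.normSq (aeval z (hermiteH (k + 1))) :=
    Finset.sum_nonneg fun _ _ => Complex.normSq_nonneg _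
  simp only [hermiteH_zero, map_one]
  positivity

theorem hermiteFun_ne_zero_of_succ_eq_zero {n : ℕ} {x : ℝ} (h : hermiteFun (n + 1) x = 0) :
    hermiteFun n x ≠ 0 := by
  induction n with
  | zero => simp
  | succ n ih =>
    intro h'
    have hn : √(n + 1 : ℝ) ≠ 0 := by positivity
    simpa [h, h', hn, ih h'] using hermiteFun_add_two n x

theorem nodup_roots_hermiteH (n : ℕ) : (hermiteH n).roots.Nodup := by
  rcases n with _ | n
  · simp
  rw [Multiset.nodup_iff_count_le_one]
  intro x
  rw [count_roots]
  by_contra! hlt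
  obtain ⟨hderiv, hroot⟩ :=
    ((one_lt_rootMultiplicity_iff_isRoot (hermiteH_ne_zero (n + 1))).1 hlt).symm
  rw [IsRoot.def, derivative_hermiteH_succ, eval_mul, eval_C] at hderiv
  exact hermiteFun_ne_zero_of_succ_eq_zero hroot
    ((mul_eq_zero.1 hderiv).resolve_left (by positivity))

theorem card_roots_hermiteH (n : ℕ) : (hermiteH n).roots.card = n := by
  have h : (hermiteH n).Splits := by
    refine Splits.of_splits_map (algebraMap ℝ ℂ) (IsAlgClosed.splits _) fun z hz => ?_
    have hz0 : aeval z (hermiteH n) = 0 := by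
      rw [aeval_def, ← eval_map]
      exact (mem_roots'.1 hz).2
    exact ⟨z.re, Complex.ext rfl (im_eq_zero_of_aeval_hermiteH_eq_zero hz0).symm⟩
  rw [splits_iff_card_roots.1 h, natDegree_hermiteH]

theorem node_eq_getElem {n j : ℕ} (hj : j < n + 1) :
    node n j = ((hermiteH (n + 1)).roots.sort (· ≤ ·))[j]'(by
      rwa [Multiset.length_sort, card_roots_hermiteH]) := by
  rw [node, List.getD_eq_getElem]

theorem hermiteFun_succ_node {n j : ℕ} (hj : j ∈ Finset.range (n + 1)) :
    hermiteFun (n + 1) (node n j) = 0 := by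
  have hmem : node n j ∈ (hermiteH (n + 1)).roots.sort (· ≤ ·) := by
    rw [node_eq_getElem (Finset.mem_range.1 hj)]
    exact List.getElem_mem _
  rw [Multiset.mem_sort] at hmem
  exact (mem_roots'.1 hmem).2

theorem injOn_node (n : ℕ) : Set.InjOn (node n) (Finset.range (n + 1) : Set ℕ) := by
  intro i hi j hj hij
  rw [Finset.mem_coe, Finset.mem_range] at hi hj
  rw [node_eq_getElem hi, node_eq_getElem hj] at hij
  have hnodup : ((hermiteH (n + 1)).roots.sort (· ≤ ·)).Nodup := by
    rw [← Multiset.coe_nodup, Multiset.sort_eq]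
    exact nodup_roots_hermiteH _
  exact (List.Nodup.getElem_inj_iff hnodup).1 hij

theorem hermiteFun_succ_pos_of_mul_le {k : ℕ} {x : ℝ} (hx : 0 < x) (hpos : 0 < hermiteFun k x)
    (hle : x / 2 * hermiteFun k x ≤ √(k + 1) * hermiteFun (k + 1) x) :
    0 < hermiteFun (k + 1) x :=
  pos_of_mul_pos_right ((mul_pos (half_pos hx) hpos).trans_le hle) (Real.sqrt_nonneg _)

theorem hermiteFun_pos_and_mul_le {k : ℕ} {x : ℝ} (hx0 : 0 < x) (hx : 4 * k ≤ x ^ 2) :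
    0 < hermiteFun k x ∧ x / 2 * hermiteFun k x ≤ √(k + 1) * hermiteFun (k + 1) x := by
  induction k with
  | zero => simp; linarith
  | succ k ih =>
    push_cast at hx
    obtain ⟨hpos, hle⟩ := ih (by linarith)
    refine ⟨hermiteFun_succ_pos_of_mul_le hx0 hpos hle, ?_⟩
    have hcast : ((k + 1 : ℕ) : ℝ) + 1 = k + 2 := by push_cast; ring
    have hs2 : √(k + 1 : ℝ) ^ 2 = k + 1 := Real.sq_sqrt (by positivity)
    rw [hcast, hermiteFun_add_two]
    have hpos' := hermiteFun_succ_pos_of_mul_le hx0 hpos hle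
    have h1 := mul_le_mul_of_nonneg_left hle (Real.sqrt_nonneg (k + 1 : ℝ))
    have h2 : x * (√(k + 1) * hermiteFun k x) ≤ x * (x / 2 * hermiteFun (k + 1) x) := by
      nlinarith
    linarith [le_of_mul_le_mul_left h2 hx0]

theorem node_sq_le {n j : ℕ} (hj : j ∈ Finset.range (n + 1)) : node n j ^ 2 ≤ 4 * n := by
  by_contra! h
  have hroot := hermiteFun_succ_node hj
  have hpos {x : ℝ} (hx0 : 0 < x) (hx : 4 * n ≤ x ^ 2) : 0 < hermiteFun (n + 1) x :=
    let ⟨h1, h2⟩ := hermiteFun_pos_and_mul_le hx0 hx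
    hermiteFun_succ_pos_of_mul_le hx0 h1 h2
  rcases lt_trichotomy (node n j) 0 with hneg | hzero | hpos'
  · have := hpos (x := -node n j) (by linarith) (by linarith [neg_sq (node n j)])
    simp [hermiteFun_neg, hroot] at this
  · rw [hzero] at h
    norm_num at h
    exact absurd h (by simp)
  · exact (hpos hpos' h.le).ne' hroot

end Roots

section GaussQuadrature

open Polynomial

theorem weight_eq_integral_basis (n j : ℕ) :
    weight n j = ∫ y, (Lagrange.basis (Finset.range (n + 1)) (node n) j).eval y ∂γ₁ := by
  simp [weight, Lagrange.basis, Lagrange.basisDivisor, eval_prod, div_eq_inv_mul]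

theorem sum_weight_mul_eval_of_degree_lt {n : ℕ} {P : ℝ[X]} (hP : P.degree < (n + 1 : ℕ)) :
    ∑ j ∈ Finset.range (n + 1), weight n j * P.eval (node n j) = ∫ y, P.eval y ∂γ₁ := by
  have hinterp : ∀ y : ℝ, P.eval y = ∑ j ∈ Finset.range (n + 1), P.eval (node n j) *
      (Lagrange.basis (Finset.range (n + 1)) (node n) j).eval y := fun y => by
    conv_lhs => rw [Lagrange.eq_interpolate (injOn_node n) (f := P) (by simpa using hP),
      Lagrange.interpolate_apply]
    simp [eval_finsetSum]
  rw [integral_congr_ae (ae_of_all _ hinterp),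
    integral_finsetSum _ fun j _ => (integrable_eval_gaussianReal _).const_mul _]
  exact Finset.sum_congr rfl fun j _ => by
    rw [integral_const_mul, weight_eq_integral_basis, mul_comm]

theorem sum_weight_mul_eval {n : ℕ} {P : ℝ[X]} (hP : P.natDegree ≤ 2 * n + 1) :
    ∑ j ∈ Finset.range (n + 1), weight n j * P.eval (node n j) = ∫ y, P.eval y ∂γ₁ := by
  set H := hermiteH (n + 1)
  have heval (x : ℝ) : P.eval x = hermiteFun (n + 1) x * (P / H).eval x + (P % H).eval x := by
    rw [hermiteFun, ← eval_mul, ← eval_add, EuclideanDomain.div_add_mod]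
  have hmod : (P % H).degree < (n + 1 : ℕ) := by
    rw [← degree_hermiteH (n + 1)]
    exact EuclideanDomain.mod_lt P (hermiteH_ne_zero (n + 1))
  have hdiv : (P / H).degree < (n + 1 : ℕ) := by
    have hlead : H.leadingCoeff⁻¹ ≠ 0 := by simp [H, hermiteH_ne_zero]
    refine degree_le_natDegree.trans_lt ?_
    rw [Polynomial.div_def, natDegree_C_mul hlead, natDegree_divByMonic _
      (monic_mul_leadingCoeff_inv (hermiteH_ne_zero _)), natDegree_mul_C hlead, natDegree_hermiteH]
    exact_mod_cast (by omega : P.natDegree - (n + 1) < n + 1)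
  calc ∑ j ∈ Finset.range (n + 1), weight n j * P.eval (node n j)
      = ∑ j ∈ Finset.range (n + 1), weight n j * (P % H).eval (node n j) :=
        Finset.sum_congr rfl fun j hj => by
          rw [heval, hermiteFun_succ_node hj, zero_mul, zero_add]
    _ = ∫ y, (P % H).eval y ∂γ₁ := sum_weight_mul_eval_of_degree_lt hmod
    _ = ∫ y, (hermiteFun (n + 1) y * (P / H).eval y + (P % H).eval y) ∂γ₁ := by
        rw [integral_add (by simpa [hermiteFun] using integrable_eval_gaussianReal (H * (P / H)))
          (integrable_eval_gaussianReal _), integral_hermiteFun_mul_eval_eq_zero hdiv, zero_add]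
    _ = ∫ y, P.eval y ∂γ₁ := by simp only [heval]

theorem weight_nonneg {n j : ℕ} (hj : j ∈ Finset.range (n + 1)) : 0 ≤ weight n j := by
  set L := Lagrange.basis (Finset.range (n + 1)) (node n) j
  have hdeg : L.natDegree = n := natDegree_eq_of_degree_eq_some <| by
    simpa using Lagrange.degree_basis (injOn_node n) hj
  have h := sum_weight_mul_eval (n := n) (P := L ^ 2) (by rw [natDegree_pow, hdeg]; omega)
  rw [Finset.sum_eq_single_of_mem j hj fun i hi hij => by
    rw [eval_pow, Lagrange.eval_basis_of_ne hij.symm hi]; simp, eval_pow,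
    Lagrange.eval_basis_self (injOn_node n) hj, one_pow, mul_one] at h
  rw [h]
  exact integral_nonneg fun y => by simp only [eval_pow]; positivity

theorem sum_weight (n : ℕ) : ∑ j ∈ Finset.range (n + 1), weight n j = 1 := by
  simpa using sum_weight_mul_eval (n := n) (P := 1) (by simp)

theorem weight_zero_zero : weight 0 0 = 1 := by simpa using sum_weight 0

/-- The Gauss–Hermite quadrature with `n + 1` nodes of the Hermite polynomial of degree `m`. -/
noncomputable def quadHermite (n m : ℕ) : ℝ :=
  ∑ j ∈ Finset.range (n + 1), weight n j * hermiteFun m (node n j)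

theorem quadHermite_eq_ite {n m : ℕ} (hm : m ≤ 2 * n + 1) :
    quadHermite n m = if m = 0 then 1 else 0 :=
  (sum_weight_mul_eval (by rwa [natDegree_hermiteH])).trans (integral_hermiteFun m)

theorem quadHermite_zero_right (n : ℕ) : quadHermite n 0 = 1 := by
  simp [quadHermite_eq_ite]

/-- For `y ≤ n` the terms `y ^ k / k!` with `k ≥ n` decay geometrically with ratio
`n / (n + 1)`. -/
theorem exp_le_succ_mul_sum_range {n : ℕ} {y : ℝ} (hy0 : 0 ≤ y) (hy : y ≤ n) :
    Real.exp y ≤ (n + 1) * ∑ k ∈ Finset.range (n + 1), y ^ k / k.factorial := by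
  set q : ℝ := n / (n + 1)
  have hq0 : 0 ≤ q := by positivity
  have hq1 : q < 1 := (div_lt_one (by positivity)).2 (lt_add_one _)
  have hsum : Summable fun k : ℕ => y ^ k / k.factorial := Real.summable_pow_div_factorial y
  have hterm (j : ℕ) : y ^ (j + n) / (j + n).factorial ≤ y ^ n / n.factorial * q ^ j := by
    have hfact : (n.factorial * (n + 1) ^ j : ℝ) ≤ (j + n).factorial := by
      rw [add_comm j]
      exact_mod_cast Nat.factorial_mul_pow_le_factorial
    calc y ^ (j + n) / (j + n).factorial ≤ y ^ n * n ^ j / (n.factorial * (n + 1) ^ j) := by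
          rw [pow_add, mul_comm (y ^ j)]
          gcongr
      _ = y ^ n / n.factorial * q ^ j := by rw [div_pow, mul_div_mul_comm]
  have htail : ∑' j, y ^ (j + n) / (j + n).factorial ≤ (n + 1) * (y ^ n / n.factorial) := by
    refine (((summable_nat_add_iff n).2 hsum).tsum_le_tsum hterm
      ((summable_geometric_of_lt_one hq0 hq1).mul_left _)).trans_eq ?_
    rw [tsum_mul_left, tsum_geometric_of_lt_one hq0 hq1, mul_comm]
    congr 1
    simp only [q]
    field_simp
    ring
  have hhead : 0 ≤ ∑ k ∈ Finset.range n, y ^ k / (k.factorial : ℝ) :=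
    Finset.sum_nonneg fun k _ => by positivity
  rw [Real.exp_eq_exp_ℝ, ← (NormedSpace.expSeries_div_hasSum_exp y).tsum_eq,
    ← hsum.sum_add_tsum_nat_add n, Finset.sum_range_succ]
  nlinarith

theorem integrable_exp_sq_div_four_gaussianReal :
    Integrable (fun x : ℝ => Real.exp (x ^ 2 / 4)) γ₁ := by
  rw [integrable_gaussianReal_iff_integrable_smul]
  refine ((integrable_exp_neg_mul_sq (b := 1 / 4) (by norm_num)).const_mul
    (√(2 * Real.pi))⁻¹).congr (ae_of_all _ fun x => ?_)
  simp only [gaussianPDFReal, smul_eq_mul, mul_assoc _ (Real.exp _), ← Real.exp_add, sub_zero,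
    NNReal.coe_one, mul_one]
  ring_nf

theorem sum_weight_mul_exp_sq_div_four_le (n : ℕ) :
    ∑ j ∈ Finset.range (n + 1), weight n j * Real.exp (node n j ^ 2 / 4) ≤
      (n + 1) * ∫ x : ℝ, Real.exp (x ^ 2 / 4) ∂γ₁ := by
  set P : ℝ[X] := ∑ k ∈ Finset.range (n + 1), C ((k.factorial : ℝ)⁻¹ * (1 / 4) ^ k) * X ^ (2 * k)
  have heval (x : ℝ) : P.eval x = ∑ k ∈ Finset.range (n + 1), (x ^ 2 / 4) ^ k / k.factorial := by
    simp only [P, eval_finsetSum, eval_mul, eval_C, eval_pow, eval_X, pow_mul]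
    exact Finset.sum_congr rfl fun k _ => by rw [div_eq_mul_one_div (x ^ 2), mul_pow]; ring
  have hdeg : P.natDegree ≤ 2 * n + 1 := natDegree_sum_le_of_forall_le _ _ fun k hk =>
    (natDegree_C_mul_X_pow_le _ _).trans (by have := Finset.mem_range.1 hk; omega)
  calc ∑ j ∈ Finset.range (n + 1), weight n j * Real.exp (node n j ^ 2 / 4)
      ≤ ∑ j ∈ Finset.range (n + 1), weight n j * ((n + 1) * P.eval (node n j)) := by
        refine Finset.sum_le_sum fun j hj => mul_le_mul_of_nonneg_left ?_ (weight_nonneg hj)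
        rw [heval]
        exact exp_le_succ_mul_sum_range (by positivity) (by linarith [node_sq_le hj])
    _ = (n + 1) * ∫ x, P.eval x ∂γ₁ := by
        simp only [mul_left_comm, ← Finset.mul_sum, sum_weight_mul_eval hdeg]
    _ ≤ (n + 1) * ∫ x : ℝ, Real.exp (x ^ 2 / 4) ∂γ₁ := by
        refine mul_le_mul_of_nonneg_left (integral_mono (integrable_eval_gaussianReal P)
          integrable_exp_sq_div_four_gaussianReal fun x => ?_) (by positivity)
        simp only [heval]
        exact Real.sum_le_exp_of_nonneg (by positivity) _

theorem abs_quadHermite_le_sum (n m : ℕ) : |quadHermite n m| ≤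
    ∑ j ∈ Finset.range (n + 1), weight n j * |hermiteFun m (node n j)| :=
  (Finset.abs_sum_le_sum_abs _ _).trans_eq <| Finset.sum_congr rfl fun j hj => by
    rw [abs_mul, abs_of_nonneg (weight_nonneg hj)]

theorem exists_abs_quadHermite_le : ∃ C : ℝ, 1 ≤ C ∧ ∀ n m, |quadHermite n m| ≤ C * (m + 1) := by
  set I := ∫ x : ℝ, Real.exp (x ^ 2 / 4) ∂γ₁
  have hI : 0 ≤ I := integral_nonneg fun x => (Real.exp_pos _).le
  refine ⟨1 + 2 * I, by linarith, fun n m => ?_⟩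
  rcases le_or_gt m (2 * n + 1) with hm | hm
  · have hle : |quadHermite n m| ≤ 1 := by rw [quadHermite_eq_ite hm]; split_ifs <;> simp
    nlinarith [(Nat.cast_nonneg m : (0 : ℝ) ≤ m)]
  have hmn : 2 * (n : ℝ) + 2 ≤ m := by exact_mod_cast (by omega : 2 * n + 2 ≤ m)
  calc |quadHermite n m|
      ≤ ∑ j ∈ Finset.range (n + 1), weight n j * |hermiteFun m (node n j)| :=
        abs_quadHermite_le_sum n m
    _ ≤ ∑ j ∈ Finset.range (n + 1), weight n j * (2 * Real.exp (node n j ^ 2 / 4)) :=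
        Finset.sum_le_sum fun j hj => mul_le_mul_of_nonneg_left
          (abs_hermiteFun_le m (by linarith [node_sq_le hj])) (weight_nonneg hj)
    _ = 2 * ∑ j ∈ Finset.range (n + 1), weight n j * Real.exp (node n j ^ 2 / 4) := by
        simp only [mul_left_comm, Finset.mul_sum]
    _ ≤ 2 * ((n + 1) * I) := by gcongr; exact sum_weight_mul_exp_sq_div_four_le n
    _ ≤ (1 + 2 * I) * (m + 1) := by nlinarith

/-- The difference of consecutive Gauss–Hermite quadratures, applied to Hermite polynomials. -/
noncomputable def quadDiff : ℕ → ℕ → ℝ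
  | 0, m => quadHermite 0 m
  | k + 1, m => quadHermite (k + 1) m - quadHermite k m

theorem quadDiff_zero_zero : quadDiff 0 0 = 1 := quadHermite_zero_right 0

theorem quadDiff_eq_zero_of_lt {k m : ℕ} (h : m < k) : quadDiff k m = 0 := by
  obtain ⟨k, rfl⟩ := Nat.exists_eq_add_one_of_ne_zero (Nat.ne_zero_of_lt h)
  rw [quadDiff, quadHermite_eq_ite (by omega), quadHermite_eq_ite (by omega), sub_self]

theorem quadDiff_one_right (k : ℕ) : quadDiff k 1 = 0 := by
  cases k <;> simp [quadDiff, quadHermite_eq_ite]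

theorem sum_quadDiff (n m : ℕ) :
    ∑ k ∈ Finset.range (n + 1), quadDiff k m = quadHermite n m := by
  rw [Finset.sum_range_succ']
  simp only [quadDiff, Finset.sum_range_sub (quadHermite · m), sub_add_cancel]

theorem sum_quadDiff_self (m : ℕ) :
    ∑ k ∈ Finset.range (m + 1), quadDiff k m = if m = 0 then 1 else 0 := by
  rw [sum_quadDiff, quadHermite_eq_ite (by omega)]

theorem exists_sum_abs_quadDiff_le : ∃ C : ℝ, 1 ≤ C ∧ ∀ m, 1 ≤ m →
    ∑ k ∈ Finset.range (m + 1), |quadDiff k m| ≤ C * (m : ℝ) ^ 2 := by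
  obtain ⟨C, hC1, hC⟩ := exists_abs_quadHermite_le
  refine ⟨8 * C, by linarith, fun m hm => ?_⟩
  have hm' : (1 : ℝ) ≤ m := by exact_mod_cast hm
  have hdiff (k : ℕ) : |quadDiff k m| ≤ 4 * C * m := by
    cases k with
    | zero => exact (hC 0 m).trans (by nlinarith)
    | succ k => exact (abs_sub _ _).trans (by nlinarith [hC (k + 1) m, hC k m])
  calc ∑ k ∈ Finset.range (m + 1), |quadDiff k m|
      ≤ ∑ _k ∈ Finset.range (m + 1), 4 * C * m := Finset.sum_le_sum fun k _ => hdiff k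
    _ = (m + 1) * (4 * C * m) := by simp
    _ ≤ (m + m) * (4 * C * m) := by gcongr
    _ = 8 * C * (m : ℝ) ^ 2 := by ring

end GaussQuadrature

section Bessel

variable {Ω X ι : Type*} [MeasurableSpace Ω] {μ : Measure Ω} [NormedAddCommGroup X]

theorem integrable_conj_smul [NormedSpace ℂ X] {f : Ω → ℂ} {g : Ω → X} (hf : MemLp f 2 μ)
    (hg : MemLp g 2 μ) : Integrable (fun ω => conj (f ω) • g ω) μ :=
  memLp_one_iff_integrable.1 (hg.smul hf.star)

variable [InnerProductSpace ℂ X] {s : Finset ι} {e : ι → Ω → ℂ}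

theorem integrable_inner_sum_smul_left {g : Ω → X} (c : ι → X)
    (hint : ∀ i ∈ s, Integrable (fun ω => conj (e i ω) • g ω) μ) :
    Integrable (fun ω => inner ℂ (∑ i ∈ s, e i ω • c i) (g ω)) μ := by
  simp only [sum_inner, inner_smul_left, ← inner_smul_right]
  exact integrable_finsetSum _ fun i hi => (hint i hi).const_inner (𝕜 := ℂ) (c i)

variable [CompleteSpace X]

theorem integral_inner_sum_smul_left {g : Ω → X} (c : ι → X)
    (hint : ∀ i ∈ s, Integrable (fun ω => conj (e i ω) • g ω) μ) :
    ∫ ω, inner ℂ (∑ i ∈ s, e i ω • c i) (g ω) ∂μ =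
      ∑ i ∈ s, inner ℂ (c i) (∫ ω, conj (e i ω) • g ω ∂μ) := by
  simp only [sum_inner, inner_smul_left, ← inner_smul_right]
  rw [integral_finsetSum _ fun i hi => (hint i hi).const_inner (𝕜 := ℂ) (c i)]
  exact Finset.sum_congr rfl fun i hi => integral_inner (𝕜 := ℂ) (hint i hi) (c i)

theorem integral_conj_smul_sum_smul [DecidableEq ι] (c : ι → X) (he : ∀ i ∈ s, MemLp (e i) 2 μ)
    (horth : ∀ i ∈ s, ∀ j ∈ s, ∫ ω, conj (e i ω) * e j ω ∂μ = if i = j then 1 else 0)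
    {i : ι} (hi : i ∈ s) :
    ∫ ω, conj (e i ω) • ∑ j ∈ s, e j ω • c j ∂μ = c i := by
  simp only [Finset.smul_sum, smul_smul]
  rw [integral_finsetSum (f := fun j ω => (conj (e i ω) * e j ω) • c j) s fun j hj =>
    (integrable_conj_smul (he i hi) (he j hj)).smul_const (c j)]
  simp only [integral_smul_const]
  rw [Finset.sum_congr rfl fun j hj => by rw [horth i hi j hj]]
  simp [hi]

/-- Bessel's inequality: the integrals play the role of inner products, but have values in `X`. -/
theorem sum_norm_sq_integral_conj_smul_le [DecidableEq ι] (he : ∀ i ∈ s, MemLp (e i) 2 μ)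
    (horth : ∀ i ∈ s, ∀ j ∈ s, ∫ ω, conj (e i ω) * e j ω ∂μ = if i = j then 1 else 0)
    {g : Ω → X} (hg : MemLp g 2 μ) :
    ∑ i ∈ s, ‖∫ ω, conj (e i ω) • g ω ∂μ‖ ^ 2 ≤ ∫ ω, ‖g ω‖ ^ 2 ∂μ := by
  set c : ι → X := fun i => ∫ ω, conj (e i ω) • g ω ∂μ
  set W : Ω → X := fun ω => ∑ i ∈ s, e i ω • c i
  have hW : MemLp W 2 μ := memLp_finsetSum _ fun i hi =>
    (ContinuousLinearMap.toSpanSingleton ℂ (c i)).comp_memLp' (he i hi)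
  have h_inner {f : Ω → X} (hf : MemLp f 2 μ)
      (hfc : ∀ i ∈ s, ∫ ω, conj (e i ω) • f ω ∂μ = c i) :
      Integrable (fun ω => RCLike.re (inner ℂ (W ω) (f ω))) μ ∧
        ∫ ω, RCLike.re (inner ℂ (W ω) (f ω)) ∂μ = ∑ i ∈ s, ‖c i‖ ^ 2 := by
    have hint i (hi : i ∈ s) := integrable_conj_smul (he i hi) hf
    refine ⟨(integrable_inner_sum_smul_left c hint).re, ?_⟩
    rw [integral_re (integrable_inner_sum_smul_left c hint),
      integral_inner_sum_smul_left c hint, map_sum]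
    exact Finset.sum_congr rfl fun i hi => by rw [hfc i hi, inner_self_eq_norm_sq]
  obtain ⟨hgW, hgW'⟩ := h_inner hg fun i _ => rfl
  obtain ⟨hWW, hWW'⟩ := h_inner hW fun i hi => integral_conj_smul_sum_smul c he horth hi
  have hgg : Integrable (fun ω => ‖g ω‖ ^ 2) μ := (memLp_two_iff_integrable_sq_norm hg.1).1 hg
  have h_nonneg : 0 ≤ ∫ ω, ‖W ω - g ω‖ ^ 2 ∂μ := integral_nonneg fun ω => by positivity
  have h_expand : ∫ ω, ‖W ω - g ω‖ ^ 2 ∂μ = ∑ i ∈ s, ‖c i‖ ^ 2 - 2 * ∑ i ∈ s, ‖c i‖ ^ 2 +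
      ∫ ω, ‖g ω‖ ^ 2 ∂μ := by
    simp only [@norm_sub_sq ℂ, ← inner_self_eq_norm_sq (𝕜 := ℂ) (W _)]
    rw [integral_add ?_ hgg, integral_sub hWW (hgW.const_mul 2), integral_const_mul, hgW', hWW']
    exact hWW.sub (hgW.const_mul 2)
  linarith

end Bessel

section AngularIntegrals

/-- The uniform distribution of the angle on `(0, 2π]`. -/
noncomputable def angleMeasure : Measure ℝ := volume[|Set.Ioc 0 (2 * Real.pi)]

instance : IsProbabilityMeasure angleMeasure :=
  cond_isProbabilityMeasure_of_finite (by simp [Real.pi_pos]) (by simp [ENNReal.mul_eq_top])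

theorem integral_angleMeasure {E : Type*} [NormedAddCommGroup E] [NormedSpace ℝ E] (f : ℝ → E) :
    ∫ θ, f θ ∂angleMeasure = (2 * Real.pi)⁻¹ • ∫ θ in 0..2 * Real.pi, f θ := by
  have hpi := Real.two_pi_pos.le
  rw [angleMeasure, ProbabilityTheory.cond, integral_smul_measure,
    intervalIntegral.integral_of_le hpi, Real.volume_Ioc, sub_zero, ENNReal.toReal_inv,
    ENNReal.toReal_ofReal hpi]

theorem integral_circleMap_int_mul (m : ℤ) :
    ∫ θ, circleMap 0 1 (m * θ) ∂angleMeasure = if m = 0 then 1 else 0 := by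
  split_ifs with hm
  · simp [hm, circleMap]
  · have hc : (m * Complex.I : ℂ) ≠ 0 := mul_ne_zero (Int.cast_ne_zero.2 hm) Complex.I_ne_zero
    have hexp : Complex.exp (m * Complex.I * (2 * Real.pi : ℝ)) = 1 :=
      Complex.exp_eq_one_iff.2 ⟨m, by push_cast; ring⟩
    have hprim := integral_exp_mul_complex (a := 0) (b := 2 * Real.pi) hc
    rw [hexp, Complex.ofReal_zero, mul_zero, Complex.exp_zero, sub_self, zero_div] at hprim
    rw [integral_angleMeasure, smul_eq_zero_of_right]
    simpa [circleMap, mul_right_comm] using hprim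

theorem circleMap_one_mul_neg (a : ℕ) (θ : ℝ) :
    circleMap 0 1 (-(a * θ)) = (circleMap 0 1 θ ^ a)⁻¹ := by
  simp [circleMap_zero_pow, circleMap_zero_inv]

variable {X : Type*} [NormedAddCommGroup X] [NormedSpace ℂ X] [CompleteSpace X]

/-- The Taylor coefficients of a holomorphic function are its Fourier coefficients on a circle. -/
theorem integral_circleMap_smul_circleMap {g : ℂ → X} {c : ℂ} {R : ℝ} (hR : 0 < R)
    (hg : DiffContOnCl ℂ g (Metric.ball c R)) (a : ℕ) :
    ∫ θ, circleMap 0 1 (-(a * θ)) • g (circleMap c R θ) ∂angleMeasure =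
      (R ^ a / a.factorial : ℝ) • iteratedDeriv a g c := by
  have hR' : (R : ℂ) ≠ 0 := Complex.ofReal_ne_zero.2 hR.ne'
  have h_integrand (θ : ℝ) : circleMap 0 1 (-(a * θ)) • g (circleMap c R θ) =
      (R ^ a / Complex.I) • deriv (circleMap c R) θ •
        (1 / (circleMap c R θ - c) ^ (a + 1)) • g (circleMap c R θ) := by
    have hθ : circleMap 0 1 θ ≠ 0 := circleMap_ne_center one_ne_zero
    rw [deriv_circleMap, circleMap_sub_center, smul_smul, smul_smul, circleMap_one_mul_neg,
      show circleMap 0 R θ = R * circleMap 0 1 θ by simp [circleMap]]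
    congr 1
    field_simp
    ring
  have h_cauchy := hg.circleIntegral_one_div_sub_center_pow_smul hR a
  rw [circleIntegral] at h_cauchy
  simp only [integral_angleMeasure, h_integrand]
  rw [intervalIntegral.integral_smul, h_cauchy, ← Complex.coe_smul, ← Complex.coe_smul,
    smul_smul, smul_smul]
  congr 1
  push_cast
  field_simp

end AngularIntegrals

local notation "σ₁" => Measure.prod (gaussianReal 0 1) angleMeasure

section StripDominated

variable {X : Type*} [NormedAddCommGroup X] [NormedSpace ℂ X]

/-- `g` is holomorphic on the strip `|Im z| < r`, and on the disc of radius `r` about a real `t` its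
norm is at most `ψ t`, for a function `ψ ∈ L²(γ₁)`. -/
structure StripDominated (r : ℝ) (g : ℂ → X) (ψ : ℝ → ℝ) : Prop where
  differentiableOn : DifferentiableOn ℂ g {z | |z.im| < r}
  memLp : MemLp ψ 2 γ₁
  norm_le : ∀ (t : ℝ) (z : ℂ), ‖z‖ < r → ‖g (t + z)‖ ≤ ψ t

theorem memLp_hermiteFun (m : ℕ) : MemLp (hermiteFun m) 2 γ₁ := by
  rw [memLp_two_iff_integrable_sq (continuous_hermiteFun m).aestronglyMeasurable]
  simpa only [hermiteFun, ← Polynomial.eval_pow] using integrable_eval_gaussianReal (hermiteH m ^ 2)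

namespace StripDominated

variable {r R : ℝ} {g : ℂ → X} {ψ : ℝ → ℝ}

theorem isOpen_strip : IsOpen {z : ℂ | |z.im| < r} :=
  isOpen_lt (by fun_prop) continuous_const

theorem circleMap_mem_strip (hR : 0 ≤ R) (hRr : R < r) (t θ : ℝ) :
    circleMap t R θ ∈ {z : ℂ | |z.im| < r} := by
  have : (circleMap t R θ).im = R * Real.sin θ := by
    rw [← circleMap_zero_im, ← circleMap_sub_center (t : ℂ), Complex.sub_im, Complex.ofReal_im,
      sub_zero]
  rw [Set.mem_ofPred_eq, this, abs_mul, abs_of_nonneg hR]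
  exact (mul_le_of_le_one_right hR (Real.abs_sin_le_one θ)).trans_lt hRr

theorem closedBall_subset_strip (hRr : R < r) (t : ℝ) :
    Metric.closedBall (t : ℂ) R ⊆ {z : ℂ | |z.im| < r} := fun z hz => by
  have : z.im = (z - t).im := by simp
  rw [Set.mem_ofPred_eq, this]
  exact (Complex.abs_im_le_norm _).trans_lt ((mem_closedBall_iff_norm.1 hz).trans_lt hRr)

theorem diffContOnCl (h : StripDominated r g ψ) (hRr : R < r) (t : ℝ) :
    DiffContOnCl ℂ g (Metric.ball (t : ℂ) R) :=
  (h.differentiableOn.mono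
    (Metric.closure_ball_subset_closedBall.trans (closedBall_subset_strip hRr t))).diffContOnCl

theorem continuous_comp_circleMap (h : StripDominated r g ψ) (hR : 0 ≤ R) (hRr : R < r) :
    Continuous fun p : ℝ × ℝ => g (circleMap p.1 R p.2) :=
  h.differentiableOn.continuousOn.comp_continuous (by unfold circleMap; fun_prop)
    fun p => circleMap_mem_strip hR hRr p.1 p.2

theorem norm_comp_circleMap_le (h : StripDominated r g ψ) (hR : 0 ≤ R) (hRr : R < r) (t θ : ℝ) :
    ‖g (circleMap t R θ)‖ ≤ ψ t := by
  simpa [circleMap] using h.norm_le t (circleMap 0 R θ) (by simpa [abs_of_nonneg hR] using hRr)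

variable [CompleteSpace X]

theorem hasDerivAt_iteratedDeriv (h : StripDominated r g ψ) (hr : 0 < r) (k : ℕ) (t : ℝ) :
    HasDerivAt (fun t : ℝ => iteratedDeriv k g t) (iteratedDeriv (k + 1) g t) t := by
  have hmem : (t : ℂ) ∈ {z : ℂ | |z.im| < r} := by simpa using hr
  have h_analytic := h.differentiableOn.analyticAt (isOpen_strip.mem_nhds hmem)
  have h_deriv : HasDerivAt (iteratedDeriv k g) (iteratedDeriv (k + 1) g t) t := by
    rw [iteratedDeriv_succ, iteratedDeriv_eq_iterate]
    exact (h_analytic.iterated_deriv k).differentiableAt.hasDerivAt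
  simpa [Function.comp_def] using h_deriv.scomp t Complex.ofRealCLM.hasDerivAt

theorem norm_iteratedDeriv_le (h : StripDominated r g ψ) (hr : 0 < r) (k : ℕ) (t : ℝ) :
    ‖iteratedDeriv k g t‖ ≤ k.factorial * ψ t / (r / 2) ^ k := by
  refine Complex.norm_iteratedDeriv_le_of_forall_mem_sphere_norm_le k (half_pos hr)
    (h.diffContOnCl (half_lt_self hr) t) fun z hz => ?_
  have := h.norm_le t (z - t) (by rw [mem_sphere_iff_norm.1 hz]; exact half_lt_self hr)
  rwa [add_sub_cancel] at this

theorem integrable_hermiteFun_smul_iteratedDeriv (h : StripDominated r g ψ) (hr : 0 < r)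
    (m k : ℕ) : Integrable (fun t : ℝ => hermiteFun m t • iteratedDeriv k g t) γ₁ := by
  have h_dom := ((memLp_hermiteFun m).norm.integrable_mul h.memLp).mul_const
    (k.factorial / (r / 2) ^ k)
  have h_cont : Continuous fun t : ℝ => iteratedDeriv k g t :=
    continuous_iff_continuousAt.2 fun t => (h.hasDerivAt_iteratedDeriv hr k t).continuousAt
  refine h_dom.mono' ((continuous_hermiteFun m).smul h_cont).aestronglyMeasurable
    (ae_of_all _ fun t => ?_)
  calc ‖hermiteFun m t • iteratedDeriv k g t‖
      ≤ ‖hermiteFun m t‖ * (k.factorial * ψ t / (r / 2) ^ k) := by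
        rw [norm_smul]
        gcongr
        exact h.norm_iteratedDeriv_le hr k t
    _ = _ := by simp only [Pi.mul_apply]; ring

theorem integral_hermiteFun_smul_iteratedDeriv (h : StripDominated r g ψ) (hr : 0 < r)
    (m k : ℕ) : ∫ t : ℝ, hermiteFun m t • iteratedDeriv k g t ∂γ₁ =
      √((m + k).factorial / m.factorial) • ∫ t : ℝ, hermiteFun (m + k) t • g t ∂γ₁ := by
  induction k generalizing m with
  | zero => simp [div_self (Nat.cast_ne_zero.2 m.factorial_ne_zero : (m.factorial : ℝ) ≠ 0)]
  | succ k ih =>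
    rw [integral_hermiteFun_smul_deriv m (h.hasDerivAt_iteratedDeriv hr k)
      (fun n => h.integrable_hermiteFun_smul_iteratedDeriv hr n k)
      (h.integrable_hermiteFun_smul_iteratedDeriv hr m (k + 1)), ih, smul_smul,
      ← Real.sqrt_mul (by positivity), Nat.factorial_succ m, add_right_comm m 1 k, add_assoc m k 1]
    congr 2
    push_cast
    field_simp

end StripDominated

end StripDominated

section TaylorHermite

/-- The orthonormal functions `(x, θ) ↦ H_m(x) e^{iaθ}` in `L²(γ₁ ⊗ dθ/2π)`. Integrating
`(x, θ) ↦ g(x + R e^{iθ})` against them gives the `m`-th Hermite coefficient of the `a`-th Taylor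
coefficient of `g`. -/
noncomputable def taylorHermite (m a : ℕ) (p : ℝ × ℝ) : ℂ :=
  hermiteFun m p.1 * circleMap 0 1 (a * p.2)

@[fun_prop]
theorem continuous_taylorHermite (m a : ℕ) : Continuous (taylorHermite m a) := by
  unfold taylorHermite circleMap
  fun_prop

theorem norm_taylorHermite (m a : ℕ) (p : ℝ × ℝ) : ‖taylorHermite m a p‖ = |hermiteFun m p.1| := by
  simp [taylorHermite]

theorem conj_taylorHermite (m a : ℕ) (p : ℝ × ℝ) :
    conj (taylorHermite m a p) = hermiteFun m p.1 * circleMap 0 1 (-(a * p.2)) := by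
  simp [taylorHermite, circleMap, ← Complex.exp_conj]

theorem taylorHermite_zero_right (m : ℕ) (p : ℝ × ℝ) :
    taylorHermite m 0 p = (hermiteFun m p.1 : ℂ) := by
  simp [taylorHermite, circleMap]

theorem memLp_taylorHermite (m a : ℕ) : MemLp (taylorHermite m a) 2 σ₁ :=
  ((memLp_hermiteFun m).comp_fst angleMeasure).congr_norm
    (continuous_taylorHermite m a).aestronglyMeasurable
    (ae_of_all _ fun p => (norm_taylorHermite m a p).symm)

theorem integral_conj_taylorHermite_mul (m a n b : ℕ) :
    ∫ p, conj (taylorHermite m a p) * taylorHermite n b p ∂σ₁ =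
      if m = n ∧ a = b then 1 else 0 := by
  have h_split (p : ℝ × ℝ) : conj (taylorHermite m a p) * taylorHermite n b p =
      ((hermiteFun m p.1 * hermiteFun n p.1 : ℝ) : ℂ) *
        circleMap 0 1 (((b - a : ℤ) : ℝ) * p.2) := by
    rw [conj_taylorHermite, taylorHermite, mul_mul_mul_comm, circleMap_zero_mul]
    push_cast
    ring_nf
  simp only [h_split]
  rw [integral_prod_mul (fun x : ℝ => ((hermiteFun m x * hermiteFun n x : ℝ) : ℂ))
    (fun θ => circleMap 0 1 (((b - a : ℤ) : ℝ) * θ)), integral_circleMap_int_mul,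
    integral_complex_ofReal, integral_hermiteFun_mul]
  simp only [sub_eq_zero, Nat.cast_inj, eq_comm (a := b)]
  split_ifs <;> simp_all

variable {X : Type*} [NormedAddCommGroup X] [NormedSpace ℂ X]
  {r R : ℝ} {g : ℂ → X} {ψ : ℝ → ℝ}

theorem StripDominated.integrable_conj_taylorHermite_smul (h : StripDominated r g ψ) (hR : 0 ≤ R)
    (hRr : R < r) (m a : ℕ) :
    Integrable (fun p => conj (taylorHermite m a p) • g (circleMap p.1 R p.2)) σ₁ := by
  refine (((memLp_hermiteFun m).norm.integrable_mul h.memLp).comp_fst angleMeasure).mono'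
    (((continuous_taylorHermite m a).star.smul
      (h.continuous_comp_circleMap hR hRr)).aestronglyMeasurable) (ae_of_all _ fun p => ?_)
  rw [norm_smul, RCLike.norm_conj, norm_taylorHermite]
  exact mul_le_mul_of_nonneg_left (h.norm_comp_circleMap_le hR hRr p.1 p.2) (abs_nonneg _)

variable [CompleteSpace X]

theorem StripDominated.integral_conj_taylorHermite_smul (h : StripDominated r g ψ) (hR : 0 < R)
    (hRr : R < r) (m a : ℕ) :
    ∫ p, conj (taylorHermite m a p) • g (circleMap p.1 R p.2) ∂σ₁ =
      (R ^ a / a.factorial * √((m + a).factorial / m.factorial)) •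
        ∫ t : ℝ, hermiteFun (m + a) t • g t ∂γ₁ := by
  rw [integral_prod _ (h.integrable_conj_taylorHermite_smul hR.le hRr m a), mul_smul,
    ← h.integral_hermiteFun_smul_iteratedDeriv (hR.trans hRr), ← integral_smul]
  congr with t
  simp only [conj_taylorHermite, mul_smul]
  rw [integral_smul, integral_circleMap_smul_circleMap hR (h.diffContOnCl hRr t), Complex.coe_smul,
    smul_comm]

theorem StripDominated.integral_conj_taylorHermite_zero_smul (h : StripDominated r g ψ)
    (hr : 0 < r) (m : ℕ) :
    ∫ p, conj (taylorHermite m 0 p) • g (circleMap p.1 0 p.2) ∂σ₁ =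
      ∫ t : ℝ, hermiteFun m t • g t ∂γ₁ := by
  rw [integral_prod _ (h.integrable_conj_taylorHermite_smul le_rfl hr m 0)]
  simp [taylorHermite_zero_right, Complex.coe_smul]

end TaylorHermite

section ProductMeasures

variable {ι : Type*} [Fintype ι] {Ω : ι → Type*} [∀ i, MeasurableSpace (Ω i)]
  {μ : ∀ i, Measure (Ω i)}

theorem memLp_two_fintype_prod {𝕜 : Type*} [RCLike 𝕜] [∀ i, SigmaFinite (μ i)] {f : ∀ i, Ω i → 𝕜}
    (hf : ∀ i, MemLp (f i) 2 (μ i)) :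
    MemLp (fun x => ∏ i, f i (x i)) 2 (Measure.pi μ) := by
  have h_meas : AEStronglyMeasurable (fun x => ∏ i, f i (x i)) (Measure.pi μ) := by
    refine Finset.aestronglyMeasurable_fun_prod _ fun i _ => ?_
    exact (hf i).1.comp_quasiMeasurePreserving (Measure.quasiMeasurePreserving_eval μ i)
  rw [memLp_two_iff_integrable_sq_norm h_meas]
  simp only [norm_prod, ← Finset.prod_pow]
  exact Integrable.fintype_prod_dep fun i => (memLp_two_iff_integrable_sq_norm (hf i).1).1 (hf i)

variable [DecidableEq ι]

theorem measurePreserving_update [∀ i, IsProbabilityMeasure (μ i)] (i : ι) :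
    MeasurePreserving (fun p : (∀ j, Ω j) × Ω i => Function.update p.1 i p.2)
      ((Measure.pi μ).prod (μ i)) (Measure.pi μ) := by
  have h_meas : Measurable fun p : (∀ j, Ω j) × Ω i => Function.update p.1 i p.2 := by fun_prop
  refine ⟨h_meas, (Measure.pi_eq fun s hs => ?_).symm⟩
  have h_preimage : (fun p : (∀ j, Ω j) × Ω i => Function.update p.1 i p.2) ⁻¹' Set.univ.pi s =
      Set.univ.pi (Function.update s i Set.univ) ×ˢ s i := by
    ext p
    simp only [Set.mem_preimage, Set.mem_univ_pi, Set.mem_prod]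
    constructor
    · refine fun h => ⟨fun j => ?_, by simpa using h i⟩
      by_cases hj : j = i
      · subst hj; simp
      · simpa [hj] using h j
    · rintro ⟨h, hi⟩ j
      by_cases hj : j = i
      · subst hj; simpa using hi
      · simpa [hj] using h j
  rw [Measure.map_apply h_meas (.univ_pi hs), h_preimage, Measure.prod_prod, Measure.pi_pi,
    ← Finset.mul_prod_erase _ _ (Finset.mem_univ i), Function.update_self, measure_univ, one_mul,
    ← Finset.prod_erase_mul _ _ (Finset.mem_univ i)]
  congr 1
  exact Finset.prod_congr rfl fun j hj => by rw [Function.update_of_ne (Finset.ne_of_mem_erase hj)]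

theorem integral_eq_integral_integral_update [∀ i, IsProbabilityMeasure (μ i)] {E : Type*}
    [NormedAddCommGroup E] [NormedSpace ℝ E] {f : (∀ i, Ω i) → E}
    (hf : Integrable f (Measure.pi μ)) (i : ι) :
    ∫ x, f x ∂Measure.pi μ = ∫ x, ∫ t, f (Function.update x i t) ∂μ i ∂Measure.pi μ := by
  have h := measurePreserving_update (μ := μ) i
  calc ∫ x, f x ∂Measure.pi μ
      = ∫ p, f (Function.update p.1 i p.2) ∂(Measure.pi μ).prod (μ i) := by
        conv_lhs => rw [← h.map_eq]
        exact integral_map h.aemeasurable (h.map_eq.symm ▸ hf.1)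
    _ = ∫ x, ∫ t, f (Function.update x i t) ∂μ i ∂Measure.pi μ :=
        integral_prod _ (h.integrable_comp_of_integrable hf)

theorem ae_memLp_two_update [∀ i, IsProbabilityMeasure (μ i)] {f : (∀ i, Ω i) → ℝ}
    (hf : MemLp f 2 (Measure.pi μ)) (i : ι) :
    ∀ᵐ x ∂Measure.pi μ, MemLp (fun t => f (Function.update x i t)) 2 (μ i) := by
  have h := hf.comp_measurePreserving (measurePreserving_update (μ := μ) i)
  filter_upwards [h.1.prodMk_left, ((memLp_two_iff_integrable_sq h.1).1 h).prod_right_ae]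
    with x hx hx'
  exact (memLp_two_iff_integrable_sq hx).2 hx'

end ProductMeasures


section PolystripDominated

variable {N : ℕ}

/-- Tensor products of `taylorHermite`. -/
noncomputable def taylorHermiteProd (m a : Fin N → ℕ) (ω : Fin N → ℝ × ℝ) : ℂ :=
  ∏ j, taylorHermite (m j) (a j) (ω j)

/-- The point of the polycircle of polyradius `R` with the center and the angles given by `ω`. -/
noncomputable def polyCircle (R : Fin N → ℝ) (ω : Fin N → ℝ × ℝ) (j : Fin N) : ℂ :=
  circleMap (ω j).1 (R j) (ω j).2

/-- Tensor products of the normalized Hermite polynomials in `N` variables. -/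
noncomputable def hermiteProd (ν : Fin N → ℕ) (y : Fin N → ℝ) : ℝ :=
  ∏ j, hermiteFun (ν j) (y j)

theorem memLp_hermiteProd (ν : Fin N → ℕ) : MemLp (hermiteProd ν) 2 (gaussFin N) :=
  memLp_two_fintype_prod fun j => memLp_hermiteFun (ν j)

theorem continuous_hermiteProd (ν : Fin N → ℕ) : Continuous (hermiteProd ν) :=
  continuous_finsetProd _ fun j _ => (continuous_hermiteFun (ν j)).comp (continuous_apply j)



theorem memLp_taylorHermiteProd (m a : Fin N → ℕ) :
    MemLp (taylorHermiteProd m a) 2 (Measure.pi fun _ : Fin N => σ₁) :=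
  memLp_two_fintype_prod fun j => memLp_taylorHermite (m j) (a j)

theorem integral_conj_taylorHermiteProd_mul (m a n b : Fin N → ℕ) :
    ∫ ω, conj (taylorHermiteProd m a ω) * taylorHermiteProd n b ω ∂Measure.pi (fun _ => σ₁) =
      if m = n ∧ a = b then 1 else 0 := by
  simp only [taylorHermiteProd, map_prod, ← Finset.prod_mul_distrib]
  rw [integral_fintype_prod_eq_prod
    (f := fun j p => conj (taylorHermite (m j) (a j) p) * taylorHermite (n j) (b j) p)]
  simp only [integral_conj_taylorHermite_mul]
  split_ifs with h
  · simp [h.1, h.2]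
  · obtain ⟨j, hj⟩ : ∃ j, ¬(m j = n j ∧ a j = b j) := by
      by_contra! h'
      exact h ⟨funext fun j => (h' j).1, funext fun j => (h' j).2⟩
    exact Finset.prod_eq_zero (Finset.mem_univ j) (if_neg hj)

theorem taylorHermiteProd_update (m a : Fin N → ℕ) (ω : Fin N → ℝ × ℝ) (i : Fin N) (k l : ℕ)
    (p : ℝ × ℝ) :
    taylorHermiteProd (Function.update m i k) (Function.update a i l) (Function.update ω i p) =
      (∏ j ∈ Finset.univ.erase i, taylorHermite (m j) (a j) (ω j)) * taylorHermite k l p := by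
  rw [taylorHermiteProd, ← Finset.prod_erase_mul _ _ (Finset.mem_univ i)]
  simp only [Function.update_self]
  congr 1
  refine Finset.prod_congr rfl fun j hj => ?_
  simp only [Function.update_of_ne (Finset.ne_of_mem_erase hj)]

theorem polyCircle_update (R : Fin N → ℝ) (ω : Fin N → ℝ × ℝ) (i : Fin N) (s : ℝ) (p : ℝ × ℝ) :
    polyCircle (Function.update R i s) (Function.update ω i p) =
      Function.update (polyCircle R ω) i (circleMap p.1 s p.2) := by
  funext j
  by_cases hj : j = i
  · subst hj; simp [polyCircle]
  · simp [polyCircle, hj]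

theorem measurePreserving_fst_pi : MeasurePreserving (fun (ω : Fin N → ℝ × ℝ) j => (ω j).1)
    (Measure.pi fun _ => σ₁) (gaussFin N) :=
  measurePreserving_pi _ _ fun _ => measurePreserving_fst

variable {X : Type*} [NormedAddCommGroup X] [NormedSpace ℂ X]

/-- `F` is holomorphic on a product of strips and its values on the polydisc with polyradius `ρ`
around a real point `y` are bounded by `φ y`, where `φ` is in `L²(γ_N)`. -/
structure PolystripDominated (ρ : Fin N → ℝ) (F : (Fin N → ℂ) → X) (φ : (Fin N → ℝ) → ℝ) :
    Prop where
  differentiableOn : DifferentiableOn ℂ F (strip ρ)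
  memLp : MemLp φ 2 (gaussFin N)
  norm_le : ∀ y, ∀ z ∈ polydisc ρ, ‖F (fun j => y j + z j)‖ ≤ φ y

namespace PolystripDominated

variable {ρ R : Fin N → ℝ} {F : (Fin N → ℂ) → X} {φ : (Fin N → ℝ) → ℝ}

theorem norm_polyCircle_le (h : PolystripDominated ρ F φ) (hR : ∀ j, 0 ≤ R j)
    (hRρ : ∀ j, R j < ρ j) (ω : Fin N → ℝ × ℝ) :
    ‖F (polyCircle R ω)‖ ≤ φ (fun j => (ω j).1) := by
  have h_le := h.norm_le (fun j => (ω j).1) (fun j => circleMap 0 (R j) (ω j).2) fun j => by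
    simpa [abs_of_nonneg (hR j)] using hRρ j
  convert h_le using 2
  congr 1
  funext j
  simp [polyCircle, circleMap]

theorem continuous_comp_polyCircle (h : PolystripDominated ρ F φ) (hR : ∀ j, 0 ≤ R j)
    (hRρ : ∀ j, R j < ρ j) : Continuous fun ω => F (polyCircle R ω) := by
  refine h.differentiableOn.continuousOn.comp_continuous ?_ fun ω j =>
    StripDominated.circleMap_mem_strip (hR j) (hRρ j) _ _
  unfold polyCircle circleMap
  fun_prop

theorem continuous_comp_ofReal (h : PolystripDominated ρ F φ) (hρ : ∀ j, 0 < ρ j) :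
    Continuous fun y : Fin N → ℝ => F (fun j => y j) :=
  h.differentiableOn.continuousOn.comp_continuous (by fun_prop) fun y j => by simpa using hρ j

theorem memLp_comp_ofReal (h : PolystripDominated ρ F φ) (hρ : ∀ j, 0 < ρ j) :
    MemLp (fun y : Fin N → ℝ => F (fun j => y j)) 2 (gaussFin N) :=
  h.memLp.mono' (h.continuous_comp_ofReal hρ).aestronglyMeasurable <| .of_forall fun y => by
    simpa using h.norm_le y 0 fun j => by simpa using hρ j



theorem memLp_comp_polyCircle (h : PolystripDominated ρ F φ) (hR : ∀ j, 0 ≤ R j)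
    (hRρ : ∀ j, R j < ρ j) :
    MemLp (fun ω => F (polyCircle R ω)) 2 (Measure.pi fun _ : Fin N => σ₁) :=
  (h.memLp.comp_measurePreserving measurePreserving_fst_pi).mono'
    (h.continuous_comp_polyCircle hR hRρ).aestronglyMeasurable
    (.of_forall (h.norm_polyCircle_le hR hRρ))

theorem ae_stripDominated_update (h : PolystripDominated ρ F φ) (hR : ∀ j, 0 ≤ R j)
    (hRρ : ∀ j, R j < ρ j) (i : Fin N) :
    ∀ᵐ ω ∂Measure.pi (fun _ : Fin N => σ₁),
      StripDominated (ρ i) (fun ζ => F (Function.update (polyCircle R ω) i ζ))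
        (fun t => φ (Function.update (fun j => (ω j).1) i t)) := by
  filter_upwards [measurePreserving_fst_pi.quasiMeasurePreserving.ae
    (ae_memLp_two_update h.memLp i)] with ω hω
  refine ⟨?_, hω, fun t z hz => ?_⟩
  · refine h.differentiableOn.comp (f := fun ζ => Function.update (polyCircle R ω) i ζ)
      (fun ζ _ => ?_) fun ζ hζ j => ?_
    · exact (hasDerivAt_update _ i ζ).differentiableAt.differentiableWithinAt
    · by_cases hj : j = i
      · subst hj; simpa using hζ
      · simpa [hj, polyCircle] using StripDominated.circleMap_mem_strip (hR j) (hRρ j) _ _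
  · have h_le := h.norm_le (Function.update (fun j => (ω j).1) i t)
      (Function.update (fun j => circleMap 0 (R j) (ω j).2) i z) fun j => by
        by_cases hj : j = i
        · subst hj; simpa using hz
        · simpa [hj, abs_of_nonneg (hR j)] using hRρ j
    convert h_le using 2
    congr 1
    funext j
    by_cases hj : j = i
    · subst hj; simp
    · simp [hj, polyCircle, circleMap]

theorem integrable_conj_taylorHermiteProd_smul (h : PolystripDominated ρ F φ)
    (hR : ∀ j, 0 ≤ R j) (hRρ : ∀ j, R j < ρ j) (m a : Fin N → ℕ) :
    Integrable (fun ω => conj (taylorHermiteProd m a ω) • F (polyCircle R ω))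
      (Measure.pi fun _ => σ₁) :=
  integrable_conj_smul (memLp_taylorHermiteProd m a) (h.memLp_comp_polyCircle hR hRρ)

theorem integral_conj_taylorHermiteProd_smul_eq_integral_integral
    (h : PolystripDominated ρ F φ) (hR : ∀ j, 0 ≤ R j) (hRρ : ∀ j, R j < ρ j) (m a : Fin N → ℕ)
    (i : Fin N) {s : ℝ} (hs : 0 ≤ s) (hsρ : s < ρ i) (k l : ℕ) :
    ∫ ω, conj (taylorHermiteProd (Function.update m i k) (Function.update a i l) ω) •
        F (polyCircle (Function.update R i s) ω) ∂Measure.pi (fun _ => σ₁) =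
      ∫ ω, conj (∏ j ∈ Finset.univ.erase i, taylorHermite (m j) (a j) (ω j)) •
        ∫ p, conj (taylorHermite k l p) •
          F (Function.update (polyCircle R ω) i (circleMap p.1 s p.2)) ∂σ₁
        ∂Measure.pi (fun _ => σ₁) := by
  have h_nonneg : ∀ j, 0 ≤ Function.update R i s j :=
    (Function.forall_update_iff R fun _ x => 0 ≤ x).2 ⟨hs, fun j _ => hR j⟩
  have h_lt : ∀ j, Function.update R i s j < ρ j :=
    (Function.forall_update_iff R fun j x => x < ρ j).2 ⟨hsρ, fun j _ => hRρ j⟩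
  rw [integral_eq_integral_integral_update
    (h.integrable_conj_taylorHermiteProd_smul h_nonneg h_lt _ _) i]
  simp only [taylorHermiteProd_update, polyCircle_update, map_mul, mul_smul, integral_smul]

variable [CompleteSpace X]

/-- The Cauchy integral in the `i`-th variable trades the radius `R i` for `a i` derivatives, which
integration by parts against the Gaussian density then turns into a shift of the Hermite index. -/
theorem integral_conj_taylorHermiteProd_smul_update (h : PolystripDominated ρ F φ)
    (hR : ∀ j, 0 ≤ R j) (hRρ : ∀ j, R j < ρ j) (m a : Fin N → ℕ) {i : Fin N} (hi : 0 < R i) :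
    ∫ ω, conj (taylorHermiteProd m a ω) • F (polyCircle R ω) ∂Measure.pi (fun _ => σ₁) =
      (R i ^ a i / (a i).factorial * √((m i + a i).factorial / (m i).factorial)) •
        ∫ ω, conj (taylorHermiteProd (Function.update m i (m i + a i)) (Function.update a i 0) ω) •
          F (polyCircle (Function.update R i 0) ω) ∂Measure.pi (fun _ => σ₁) := by
  have h_left := h.integral_conj_taylorHermiteProd_smul_eq_integral_integral hR hRρ m a i hi.le
    (hRρ i) (m i) (a i)
  simp only [Function.update_eq_self] at h_left
  rw [h_left, h.integral_conj_taylorHermiteProd_smul_eq_integral_integral hR hRρ m a i le_rfl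
    (hi.trans (hRρ i)), ← integral_smul]
  refine integral_congr_ae ?_
  filter_upwards [h.ae_stripDominated_update hR hRρ i] with ω hω
  rw [hω.integral_conj_taylorHermite_smul hi (hRρ i),
    hω.integral_conj_taylorHermite_zero_smul (hi.trans (hRρ i)), smul_comm]

theorem integral_conj_taylorHermiteProd_smul_piecewise (h : PolystripDominated ρ F φ)
    (hR : ∀ j, 0 < R j) (hRρ : ∀ j, R j < ρ j) (m a : Fin N → ℕ) (s : Finset (Fin N)) :
    ∫ ω, conj (taylorHermiteProd m a ω) • F (polyCircle R ω) ∂Measure.pi (fun _ => σ₁) =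
      (∏ j ∈ s, R j ^ a j / (a j).factorial * √((m j + a j).factorial / (m j).factorial)) •
        ∫ ω, conj (taylorHermiteProd (s.piecewise (m + a) m) (s.piecewise 0 a) ω) •
          F (polyCircle (s.piecewise 0 R) ω) ∂Measure.pi (fun _ => σ₁) := by
  induction s using Finset.induction_on with
  | empty => simp
  | insert i s hi ih =>
    have h_nonneg : ∀ j, 0 ≤ s.piecewise 0 R j := fun j => by
      by_cases hj : j ∈ s <;> simp [hj, (hR j).le]
    have h_lt : ∀ j, s.piecewise 0 R j < ρ j := fun j => by
      by_cases hj : j ∈ s <;> simp [hj, hRρ j, (hR j).trans (hRρ j)]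
    have h_step := h.integral_conj_taylorHermiteProd_smul_update h_nonneg h_lt
      (s.piecewise (m + a) m) (s.piecewise 0 a) (i := i) (by simpa [hi] using hR i)
    simp only [Finset.piecewise_eq_of_notMem _ _ _ hi] at h_step
    rw [ih, h_step, smul_smul, Finset.prod_insert hi, mul_comm (∏ j ∈ s, _)]
    simp only [Finset.piecewise_insert, Pi.add_apply, Pi.zero_apply]

theorem integral_conj_taylorHermiteProd_smul (h : PolystripDominated ρ F φ)
    (hR : ∀ j, 0 < R j) (hRρ : ∀ j, R j < ρ j) (m a : Fin N → ℕ) :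
    ∫ ω, conj (taylorHermiteProd m a ω) • F (polyCircle R ω) ∂Measure.pi (fun _ => σ₁) =
      (∏ j, R j ^ a j / (a j).factorial * √((m j + a j).factorial / (m j).factorial)) •
        ∫ y, hermiteProd (m + a) y • F (fun j => y j) ∂gaussFin N := by
  have h_real := h.continuous_comp_ofReal fun j => (hR j).trans (hRρ j)
  have h_fst := measurePreserving_fst_pi (N := N)
  rw [h.integral_conj_taylorHermiteProd_smul_piecewise hR hRρ m a Finset.univ]
  congr 1
  rw [← h_fst.map_eq, integral_map (f := fun y => hermiteProd (m + a) y • F (fun j => (y j : ℂ)))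
    h_fst.aemeasurable ((continuous_hermiteProd _).smul h_real).aestronglyMeasurable]
  refine integral_congr_ae (.of_forall fun ω => ?_)
  simp only [Finset.piecewise_univ, taylorHermiteProd, Pi.zero_apply, taylorHermite_zero_right,
    Complex.conj_ofReal, ← Complex.ofReal_prod, hermiteProd, Complex.coe_smul]
  congr 2
  funext j
  simp [polyCircle]

end PolystripDominated

end PolystripDominated

section CoefficientDecay

variable {X : Type*} [NormedAddCommGroup X] [InnerProductSpace ℂ X]

/-- Bessel's inequality on the polycircle, which bounds the Hermite coefficients of `F` by the
derivatives of order `α`. -/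
theorem PolystripDominated.sum_mul_norm_sq_integral_hermiteProd_smul_le [CompleteSpace X] {N : ℕ}
    {ρ R : Fin N → ℝ} {F : (Fin N → ℂ) → X} {φ : (Fin N → ℝ) → ℝ}
    (h : PolystripDominated ρ F φ) (hR : ∀ j, 0 < R j) (hRρ : ∀ j, R j < ρ j)
    {α : (Fin N → ℕ) → Fin N → ℕ} (hα : ∀ ν, α ν ≤ ν) (S : Finset (Fin N → ℕ)) :
    ∑ ν ∈ S, (∏ j, (R j ^ α ν j / (α ν j).factorial) ^ 2 *
        ((ν j).factorial / (ν j - α ν j).factorial)) *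
      ‖∫ y, hermiteProd ν y • F (fun j => y j) ∂gaussFin N‖ ^ 2 ≤ ∫ y, φ y ^ 2 ∂gaussFin N := by
  have h_coeff (ν : Fin N → ℕ) : (∏ j, (R j ^ α ν j / (α ν j).factorial) ^ 2 *
      ((ν j).factorial / (ν j - α ν j).factorial)) *
        ‖∫ y, hermiteProd ν y • F (fun j => y j) ∂gaussFin N‖ ^ 2 =
      ‖∫ ω, conj (taylorHermiteProd (ν - α ν) (α ν) ω) • F (polyCircle R ω)
        ∂Measure.pi (fun _ => σ₁)‖ ^ 2 := by
    rw [h.integral_conj_taylorHermiteProd_smul hR hRρ, norm_smul, mul_pow, Real.norm_eq_abs,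
      sq_abs, ← Finset.prod_pow, tsub_add_cancel_of_le (hα ν)]
    congr 1
    refine Finset.prod_congr rfl fun j _ => ?_
    rw [mul_pow, Real.sq_sqrt (by positivity), Pi.sub_apply, tsub_add_cancel_of_le (hα ν j)]
  have h_orth : ∀ ν ∈ S, ∀ ν' ∈ S, ∫ ω, conj (taylorHermiteProd (ν - α ν) (α ν) ω) *
      taylorHermiteProd (ν' - α ν') (α ν') ω ∂Measure.pi (fun _ => σ₁) =
        if ν = ν' then 1 else 0 := fun ν _ ν' _ => by
    rw [integral_conj_taylorHermiteProd_mul]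
    congr 1
    refine propext ⟨fun ⟨h_sub, h_eq⟩ => ?_, by rintro rfl; simp⟩
    rw [← tsub_add_cancel_of_le (hα ν), ← tsub_add_cancel_of_le (hα ν'), h_sub, h_eq]
  have h_fst := measurePreserving_fst_pi (N := N)
  have h_memLp := h.memLp_comp_polyCircle (fun j => (hR j).le) hRρ
  simp only [h_coeff]
  calc _ ≤ ∫ ω, ‖F (polyCircle R ω)‖ ^ 2 ∂Measure.pi (fun _ => σ₁) :=
        sum_norm_sq_integral_conj_smul_le (fun ν _ => memLp_taylorHermiteProd _ _) h_orth h_memLp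
    _ ≤ ∫ ω, φ (fun j => (ω j).1) ^ 2 ∂Measure.pi (fun _ => σ₁) :=
        integral_mono h_memLp.integrable_norm_pow'
          (h.memLp.comp_measurePreserving h_fst).integrable_sq fun ω =>
            pow_le_pow_left₀ (norm_nonneg _) (h.norm_polyCircle_le (fun j => (hR j).le) hRρ ω) 2
    _ = ∫ y, φ y ^ 2 ∂gaussFin N := by
        rw [← h_fst.map_eq, integral_map h_fst.aemeasurable]
        rw [h_fst.map_eq]
        exact h.memLp.1.pow 2

/-- The order of the derivative in one variable that controls a Hermite coefficient of degree
`k`. Degrees below `2` need no decay; the order `2` suffices for the finitely many `k < r`. -/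
def derivOrder (r k : ℕ) : ℕ :=
  if k < 2 then 0 else if k < r then 2 else r

theorem derivOrder_le (r k : ℕ) : derivOrder r k ≤ k := by
  unfold derivOrder
  split_ifs <;> omega

/-- A lower bound for the weight of a squared Hermite coefficient of degree `k` in one variable,
where `M` stands for `max {1, K ϱ_j} ^ 4`. -/
noncomputable def coeffWeight (C M : ℝ) (r k : ℕ) : ℝ :=
  if k < 2 then 1 else C⁻¹ * M * (k : ℝ) ^ r

theorem coeffWeight_pos {C M : ℝ} (hC : 0 < C) (hM : 0 < M) (r k : ℕ) :
    0 < coeffWeight C M r k := by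
  unfold coeffWeight
  split_ifs with h
  · exact one_pos
  · have : (0 : ℝ) < k := by exact_mod_cast (by omega : 0 < k)
    positivity

theorem pow_le_pow_mul_descFactorial {r k : ℕ} (h : r ≤ k) :
    k ^ r ≤ r ^ r * k.descFactorial r := by
  rcases r.eq_zero_or_pos with rfl | hr
  · simp
  have h_base : k ≤ r * (k + 1 - r) := by
    obtain ⟨d, rfl⟩ := Nat.exists_eq_add_of_le h
    rw [show r + d + 1 - r = d + 1 by omega]
    nlinarith
  calc k ^ r ≤ (r * (k + 1 - r)) ^ r := Nat.pow_le_pow_left h_base r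
    _ = r ^ r * (k + 1 - r) ^ r := mul_pow _ _ _
    _ ≤ r ^ r * k.descFactorial r := Nat.mul_le_mul_left _ (Nat.pow_sub_le_descFactorial k r)

theorem mul_pow_le_of_lt {C A M ρ : ℝ} {r k : ℕ} (hA : 0 ≤ A) (hMA : M ≤ A * ρ ^ 4)
    (hC : 4 * A * r ^ r ≤ C) (hkr : k < r) :
    M * k ^ r ≤ C * ((ρ ^ 2 / (2 : ℕ).factorial) ^ 2 * (k.factorial / (k - 2).factorial)) := by
  have h_one_le : (1 : ℝ) ≤ k.factorial / (k - 2).factorial := by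
    rw [one_le_div (by positivity)]
    exact_mod_cast Nat.factorial_le (Nat.sub_le k 2)
  have hC0 : 0 ≤ C := le_trans (by positivity) hC
  have hkr' : (k : ℝ) ≤ r := by exact_mod_cast hkr.le
  calc M * (k : ℝ) ^ r ≤ A * ρ ^ 4 * (r : ℝ) ^ r := by gcongr
    _ = 4 * A * (r : ℝ) ^ r * ((ρ ^ 2 / (2 : ℕ).factorial) ^ 2 * 1) := by
      rw [Nat.factorial_two]; push_cast; ring
    _ ≤ _ := by gcongr

theorem mul_pow_le_of_le {C A M ρ₀ ρ : ℝ} {r k : ℕ} (hr : 2 ≤ r) (hA : 0 ≤ A) (hρ₀ : 0 < ρ₀)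
    (hρ : ρ₀ ≤ ρ) (hMA : M ≤ A * ρ ^ 4)
    (hC : A * r ^ r * (r.factorial : ℝ) ^ 2 / ρ₀ ^ (2 * r - 4) ≤ C) (hrk : r ≤ k) :
    M * k ^ r ≤ C * ((ρ ^ r / r.factorial) ^ 2 * (k.factorial / (k - r).factorial)) := by
  have h_quot : (k.factorial : ℝ) / (k - r).factorial = k.descFactorial r := by
    rw [div_eq_iff (by positivity), mul_comm]
    exact_mod_cast (Nat.factorial_mul_descFactorial hrk).symm
  have h_desc : (k : ℝ) ^ r ≤ r ^ r * k.descFactorial r := by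
    exact_mod_cast pow_le_pow_mul_descFactorial hrk
  have hC0 : 0 ≤ C := le_trans (by positivity) hC
  have hρ' : 0 < ρ := hρ₀.trans_le hρ
  rw [h_quot]
  calc M * (k : ℝ) ^ r ≤ (A * ρ ^ 4) * (r ^ r * k.descFactorial r) := by gcongr
    _ = (A * r ^ r * (r.factorial : ℝ) ^ 2 / ρ₀ ^ (2 * r - 4)) *
        ((ρ ^ 4 * ρ₀ ^ (2 * r - 4) / (r.factorial : ℝ) ^ 2) * k.descFactorial r) := by
      field_simp
    _ ≤ C * ((ρ ^ 4 * ρ ^ (2 * r - 4) / (r.factorial : ℝ) ^ 2) * k.descFactorial r) := by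
      gcongr
    _ = C * ((ρ ^ r / r.factorial) ^ 2 * k.descFactorial r) := by
      rw [← pow_add, show 4 + (2 * r - 4) = r * 2 by omega, div_pow, ← pow_mul]

theorem exists_coeffWeight_le {r : ℕ} (hr : 2 ≤ r) {ρ₀ A : ℝ} (hρ₀ : 0 < ρ₀) (hA : 0 ≤ A) :
    ∃ C : ℝ, 1 ≤ C ∧ ∀ ρ M : ℝ, ρ₀ ≤ ρ → M ≤ A * ρ ^ 4 → ∀ k : ℕ,
      coeffWeight C M r k ≤ (ρ ^ derivOrder r k / (derivOrder r k).factorial) ^ 2 *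
        (k.factorial / (k - derivOrder r k).factorial) := by
  have h_low : 0 ≤ 4 * A * (r : ℝ) ^ r := by positivity
  have h_high : 0 ≤ A * r ^ r * (r.factorial : ℝ) ^ 2 / ρ₀ ^ (2 * r - 4) := by positivity
  refine ⟨1 + 4 * A * r ^ r + A * r ^ r * (r.factorial : ℝ) ^ 2 / ρ₀ ^ (2 * r - 4),
    by linarith, fun ρ M hρ hMA k => ?_⟩
  unfold coeffWeight derivOrder
  split_ifs with hk2 hkr
  · simp [(Nat.cast_ne_zero (R := ℝ)).2 k.factorial_ne_zero]
  · rw [mul_assoc, inv_mul_le_iff₀ (by linarith)]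
    exact mul_pow_le_of_lt hA hMA (by linarith) hkr
  · rw [mul_assoc, inv_mul_le_iff₀ (by linarith)]
    exact mul_pow_le_of_le hr hA hρ₀ hρ hMA (by linarith) (not_lt.1 hkr)

theorem integral_sq_le_of_eLpNorm_le {Ω : Type*} [MeasurableSpace Ω] {μ : Measure Ω} {φ : Ω → ℝ}
    {δ : ℝ} (hδ : 0 ≤ δ) (hφ : MemLp φ 2 μ) (h : eLpNorm φ 2 μ ≤ ENNReal.ofReal δ) :
    ∫ y, φ y ^ 2 ∂μ ≤ δ ^ 2 := by
  rw [hφ.eLpNorm_eq_integral_rpow_norm (by norm_num) (by norm_num),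
    ENNReal.ofReal_le_ofReal_iff hδ, ENNReal.toReal_ofNat, ← one_div, ← Real.sqrt_eq_rpow,
    Real.sqrt_le_left hδ] at h
  simpa using h

theorem HolomorphicWith.exists_polystripDominated {b : ℕ → ℝ} {ξ δ : ℝ} (hδ : 0 ≤ δ)
    {u : (ℕ → ℝ) → X} {v : (N : ℕ) → (Fin N → ℝ) → X} (hu : HolomorphicWith b ξ δ u v) {N : ℕ}
    (hN : 1 ≤ N) {ρ : Fin N → ℝ} (hρ : Admissible b ξ ρ) :
    ∃ (V : (Fin N → ℂ) → X) (φ : (Fin N → ℝ) → ℝ), PolystripDominated ρ V φ ∧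
      (v N = fun y => V (fun j => y j)) ∧ ∫ y, φ y ^ 2 ∂gaussFin N ≤ δ ^ 2 := by
  obtain ⟨φ, -, hφ, hφδ, h_ext⟩ := hu.extension N hN
  obtain ⟨V, hV, hVv, hVφ⟩ := h_ext ρ hρ
  exact ⟨V, φ, ⟨hV, hφ, hVφ⟩, funext fun y => (hVv y).symm,
    integral_sq_le_of_eLpNorm_le hδ hφ hφδ⟩

section Radii

variable {b : ℕ → ℝ} {p : ℝ}

theorem tsum_rpow_pos (hb : ∀ j, 0 < b j) (hbp : Summable fun j => b j ^ p) :
    0 < ∑' j, b j ^ p :=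
  hbp.tsum_pos (fun j => (Real.rpow_pos_of_pos (hb j) p).le) 0 (Real.rpow_pos_of_pos (hb 0) p)

theorem lpNorm_rpow_le (hb : ∀ j, 0 < b j) (hp0 : 0 < p) (hp1 : p ≤ 1)
    (hbp : Summable fun j => b j ^ p) (j : ℕ) :
    ((∑' i, b i ^ p) ^ p⁻¹) ^ (p - 1) ≤ b j ^ (p - 1) := by
  refine Real.rpow_le_rpow_of_nonpos (hb j) ?_ (by linarith)
  rw [Real.le_rpow_inv_iff_of_pos (hb j).le (tsum_rpow_pos hb hbp).le hp0]
  exact hbp.le_tsum j fun i _ => (Real.rpow_pos_of_pos (hb i) p).le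

theorem admissible_rpow (hb : ∀ j, 0 < b j) {ξ : ℝ} (hξ : 0 < ξ)
    (hbp : Summable fun j => b j ^ p) (N : ℕ) :
    Admissible b ξ fun j : Fin N => ξ / (∑' i, b i ^ p) * b j ^ (p - 1) := by
  have hB := tsum_rpow_pos hb hbp
  refine ⟨fun j => by have := Real.rpow_pos_of_pos (hb j) (p - 1); positivity, ?_⟩
  calc ∑ j : Fin N, b j * (ξ / (∑' i, b i ^ p) * b j ^ (p - 1))
      = ξ / (∑' i, b i ^ p) * ∑ j ∈ Finset.range N, b j ^ p := by
        rw [Finset.mul_sum, ← Fin.sum_univ_eq_sum_range fun j => ξ / (∑' i, b i ^ p) * b j ^ p]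
        refine Finset.sum_congr rfl fun j _ => ?_
        rw [Real.rpow_sub_one (hb j).ne']
        field_simp [(hb j).ne']
    _ ≤ ξ / (∑' i, b i ^ p) * ∑' i, b i ^ p := by
        gcongr
        exact hbp.sum_le_tsum _ fun j _ => (Real.rpow_pos_of_pos (hb j) p).le
    _ = ξ := div_mul_cancel₀ ξ hB.ne'

theorem exists_coeffWeight_rpow_le (hb : ∀ j, 0 < b j) (hp0 : 0 < p) (hp1 : p ≤ 1)
    (hbp : Summable fun j => b j ^ p) {r : ℕ} (hr : 2 ≤ r) {η : ℝ} (hη : 0 < η) (κ : ℝ) :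
    ∃ C : ℝ, 1 ≤ C ∧ ∀ j k, coeffWeight C (max 1 (κ * b j ^ (p - 1)) ^ 4) r k ≤
      ((η * b j ^ (p - 1)) ^ derivOrder r k / (derivOrder r k).factorial) ^ 2 *
        (k.factorial / (k - derivOrder r k).factorial) := by
  have hB := tsum_rpow_pos hb hbp
  set ρ₀ := η * ((∑' i, b i ^ p) ^ p⁻¹) ^ (p - 1)
  have hρ₀ : 0 < ρ₀ := by positivity
  have hρ (j : ℕ) : ρ₀ ≤ η * b j ^ (p - 1) :=
    mul_le_mul_of_nonneg_left (lpNorm_rpow_le hb hp0 hp1 hbp j) hη.le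
  set A := max ρ₀⁻¹ (κ / η)
  have hA : 0 < A := lt_max_of_lt_left (by positivity)
  obtain ⟨C, hC1, hC⟩ := exists_coeffWeight_le hr hρ₀ (pow_nonneg hA.le 4)
  refine ⟨C, hC1, fun j k => hC _ _ (hρ j) ?_ k⟩
  rw [← mul_pow]
  refine pow_le_pow_left₀ (by positivity) (max_le ?_ ?_) 4
  · calc (1 : ℝ) = ρ₀⁻¹ * ρ₀ := (inv_mul_cancel₀ hρ₀.ne').symm
      _ ≤ A * (η * b j ^ (p - 1)) := mul_le_mul (le_max_left _ _) (hρ j) hρ₀.le hA.le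
  · calc κ * b j ^ (p - 1) = κ / η * (η * b j ^ (p - 1)) := by field_simp
      _ ≤ A * (η * b j ^ (p - 1)) :=
        mul_le_mul_of_nonneg_right (le_max_right _ _) (hρ₀.le.trans (hρ j))

end Radii

theorem HolomorphicWith.exists_coeff_bound [CompleteSpace X] {b : ℕ → ℝ} (hb : ∀ j, 0 < b j)
    {ξ δ : ℝ} (hξ : 0 < ξ) (hδ : 0 ≤ δ) {p : ℝ} (hp0 : 0 < p) (hp1 : p ≤ 1)
    (hbp : Summable fun j => b j ^ p) {u : (ℕ → ℝ) → X} {v : (N : ℕ) → (Fin N → ℝ) → X}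
    (hu : HolomorphicWith b ξ δ u v) {r : ℕ} (hr : 2 ≤ r) (κ : ℝ) :
    ∃ C : ℝ, 1 ≤ C ∧ ∀ N : ℕ, 1 ≤ N → Continuous (v N) ∧ MemLp (v N) 2 (gaussFin N) ∧
      ∀ S : Finset (Fin N → ℕ),
        ∑ ν ∈ S, (∏ j : Fin N, coeffWeight C (max 1 (κ * b j ^ (p - 1)) ^ 4) r (ν j)) *
          ‖∫ y, hermiteProd ν y • v N y ∂gaussFin N‖ ^ 2 ≤ δ ^ 2 := by
  have hη : 0 < ξ / (∑' j, b j ^ p) := div_pos hξ (tsum_rpow_pos hb hbp)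
  obtain ⟨C, hC1, hC⟩ := exists_coeffWeight_rpow_le hb hp0 hp1 hbp hr (half_pos hη) κ
  refine ⟨C, hC1, fun N hN => ?_⟩
  have h_adm := admissible_rpow hb hξ hbp N
  obtain ⟨V, φ, h_dom, hv, hφ⟩ := hu.exists_polystripDominated hδ hN h_adm
  rw [hv]
  refine ⟨h_dom.continuous_comp_ofReal h_adm.1, h_dom.memLp_comp_ofReal h_adm.1, fun S => ?_⟩
  have h_rpow (j : Fin N) : 0 < b j ^ (p - 1) := Real.rpow_pos_of_pos (hb j) _
  refine le_trans (Finset.sum_le_sum fun ν _ => ?_)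
    ((h_dom.sum_mul_norm_sq_integral_hermiteProd_smul_le
      (fun j => mul_pos (half_pos hη) (h_rpow j))
      (fun j => mul_lt_mul_of_pos_right (half_lt_self hη) (h_rpow j))
      (α := fun ν j => derivOrder r (ν j)) (fun ν j => derivOrder_le r (ν j)) S).trans hφ)
  gcongr with j
  · exact fun j _ => (coeffWeight_pos (by linarith) (by positivity) _ _).le
  · exact hC j (ν j)

end CoefficientDecay

section Completeness

variable {N : ℕ}

instance : IsProbabilityMeasure (gaussFin N) := by unfold gaussFin; infer_instance

instance : (gaussFin N).IsOpenPosMeasure :=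
  have : (γ₁).IsOpenPosMeasure :=
    (gaussianReal_absolutelyContinuous' 0 one_ne_zero).isOpenPosMeasure
  inferInstanceAs (Measure.pi fun _ : Fin N => γ₁).IsOpenPosMeasure

theorem mul_hermiteFun (m : ℕ) (x : ℝ) :
    x * hermiteFun m x = √(m + 1) * hermiteFun (m + 1) x + √m * hermiteFun (m - 1) x := by
  cases m with
  | zero => simp
  | succ k =>
    have h_rec := hermiteFun_add_two k x
    push_cast
    rw [add_assoc (k : ℝ) 1 1, one_add_one_eq_two, h_rec]
    simp

theorem hermiteProd_update (ν : Fin N → ℕ) (j : Fin N) (m : ℕ) (y : Fin N → ℝ) :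
    hermiteProd (Function.update ν j m) y =
      hermiteFun m (y j) * ∏ i ∈ Finset.univ.erase j, hermiteFun (ν i) (y i) := by
  rw [hermiteProd, ← Finset.mul_prod_erase _ _ (Finset.mem_univ j), Function.update_self]
  congr 1
  refine Finset.prod_congr rfl fun i hi => ?_
  rw [Function.update_of_ne (Finset.ne_of_mem_erase hi)]

theorem mul_hermiteProd (ν : Fin N → ℕ) (j : Fin N) (y : Fin N → ℝ) :
    y j * hermiteProd ν y = √(ν j + 1) * hermiteProd (Function.update ν j (ν j + 1)) y +
      √(ν j) * hermiteProd (Function.update ν j (ν j - 1)) y := by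
  have h_self := hermiteProd_update ν j (ν j) y
  rw [Function.update_eq_self] at h_self
  rw [h_self, hermiteProd_update, hermiteProd_update, ← mul_assoc, mul_hermiteFun]
  ring

@[simp] theorem hermiteProd_zero : hermiteProd (0 : Fin N → ℕ) = 1 := by
  funext y
  simp [hermiteProd]

theorem sum_mul_mem_span_hermiteProd (t : Fin N → ℝ) {g : (Fin N → ℝ) → ℝ}
    (hg : g ∈ Submodule.span ℝ (Set.range (hermiteProd (N := N)))) :
    (fun y => (∑ j, t j * y j) * g y) ∈ Submodule.span ℝ (Set.range (hermiteProd (N := N))) := by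
  induction hg using Submodule.span_induction with
  | mem g hg =>
    obtain ⟨ν, rfl⟩ := hg
    have h_eq : (fun y : Fin N → ℝ => (∑ j, t j * y j) * hermiteProd ν y) =
        ∑ j, t j • (√(ν j + 1) • hermiteProd (Function.update ν j (ν j + 1)) +
          √(ν j) • hermiteProd (Function.update ν j (ν j - 1))) := by
      funext y
      simp [Finset.sum_mul, mul_assoc, mul_hermiteProd, mul_add]
    rw [h_eq]
    refine Submodule.sum_mem _ fun j _ => Submodule.smul_mem _ _ (Submodule.add_mem _ ?_ ?_) <;>
      exact Submodule.smul_mem _ _ (Submodule.subset_span (Set.mem_range_self _))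
  | zero =>
    simp only [Pi.zero_apply, mul_zero]
    exact Submodule.zero_mem _
  | add g h _ _ hg hh =>
    simp only [Pi.add_apply, mul_add]
    exact Submodule.add_mem _ hg hh
  | smul a g _ hg =>
    simp only [Pi.smul_apply, smul_eq_mul, mul_left_comm _ a]
    exact Submodule.smul_mem _ a hg

theorem pow_mem_span_hermiteProd (t : Fin N → ℝ) (k : ℕ) :
    (fun y => (∑ j, t j * y j) ^ k) ∈ Submodule.span ℝ (Set.range (hermiteProd (N := N))) := by
  induction k with
  | zero => exact Submodule.subset_span ⟨0, by funext y; simp⟩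
  | succ k ih => simpa only [pow_succ'] using sum_mul_mem_span_hermiteProd t ih

theorem integral_pow_mul_eq_zero {f : (Fin N → ℝ) → ℝ} (hf : MemLp f 2 (gaussFin N))
    (h0 : ∀ ν, ∫ y, hermiteProd ν y * f y ∂gaussFin N = 0) (t : Fin N → ℝ) (k : ℕ) :
    ∫ y, (∑ j, t j * y j) ^ k * f y ∂gaussFin N = 0 := by
  suffices h_span : ∀ g ∈ Submodule.span ℝ (Set.range (hermiteProd (N := N))),
      Integrable (fun y => g y * f y) (gaussFin N) ∧ ∫ y, g y * f y ∂gaussFin N = 0 from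
    (h_span _ (pow_mem_span_hermiteProd t k)).2
  intro g hg
  induction hg using Submodule.span_induction with
  | mem g hg =>
    obtain ⟨ν, rfl⟩ := hg
    exact ⟨(memLp_hermiteProd ν).integrable_mul hf, h0 ν⟩
  | zero => simp
  | add g h _ _ hg hh =>
    simp only [Pi.add_apply, add_mul]
    exact ⟨hg.1.add hh.1, by rw [integral_add hg.1 hh.1, hg.2, hh.2, add_zero]⟩
  | smul a g _ hg =>
    simp only [Pi.smul_apply, smul_eq_mul, mul_assoc]
    exact ⟨hg.1.const_mul a, by rw [integral_const_mul, hg.2, mul_zero]⟩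

theorem memLp_exp_sum_mul (t : Fin N → ℝ) :
    MemLp (fun y => Real.exp (∑ j, t j * y j)) 2 (gaussFin N) := by
  simp only [Real.exp_sum]
  refine memLp_two_fintype_prod (f := fun j x => Real.exp (t j * x)) fun j => ?_
  rw [memLp_two_iff_integrable_sq (by fun_prop)]
  refine (integrable_exp_mul_gaussianReal (2 * t j)).congr (.of_forall fun x => ?_)
  simp only [← Real.exp_nat_mul, Nat.cast_ofNat, mul_assoc]

theorem integrable_exp_abs_mul {f : (Fin N → ℝ) → ℝ} (hf : MemLp f 2 (gaussFin N))
    (t : Fin N → ℝ) :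
    Integrable (fun y => Real.exp |∑ j, t j * y j| * |f y|) (gaussFin N) := by
  have h_exp_neg : MemLp (fun y => Real.exp (-∑ j, t j * y j)) 2 (gaussFin N) := by
    simpa using memLp_exp_sum_mul (-t)
  have h_exp_abs : MemLp (fun y => Real.exp |∑ j, t j * y j|) 2 (gaussFin N) := by
    refine ((memLp_exp_sum_mul t).add h_exp_neg).of_le
      (Continuous.aestronglyMeasurable (by fun_prop)) (.of_forall fun y => ?_)
    simpa [abs_of_pos, add_pos, Real.exp_pos] using Real.exp_abs_le (∑ j, t j * y j)
  exact h_exp_abs.integrable_mul hf.abs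

theorem integral_cexp_mul_eq_zero {f : (Fin N → ℝ) → ℝ} (hf : MemLp f 2 (gaussFin N))
    (h0 : ∀ ν, ∫ y, hermiteProd ν y * f y ∂gaussFin N = 0) (t : Fin N → ℝ) :
    ∫ y, Complex.exp ((∑ j, t j * y j : ℝ) * Complex.I) * f y ∂gaussFin N = 0 := by
  have h_real (x : ℝ) : HasSum (fun k : ℕ => x ^ k / k.factorial) (Real.exp x) := by
    rw [Real.exp_eq_exp_ℝ]
    exact NormedSpace.expSeries_div_hasSum_exp x
  have h_complex (z : ℂ) : HasSum (fun k : ℕ => z ^ k / k.factorial) (Complex.exp z) := by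
    rw [Complex.exp_eq_exp_ℂ]
    exact NormedSpace.expSeries_div_hasSum_exp z
  have h_bound : Integrable (fun y => ∑' k : ℕ, |∑ j, t j * y j| ^ k / k.factorial * |f y|)
      (gaussFin N) := by
    simpa only [tsum_mul_right, (h_real _).tsum_eq] using integrable_exp_abs_mul hf t
  have h_series := hasSum_integral_of_dominated_convergence (μ := gaussFin N)
    (F := fun (k : ℕ) y => ((∑ j, t j * y j : ℝ) * Complex.I) ^ k / (k.factorial : ℂ) * f y)
    (f := fun y => Complex.exp ((∑ j, t j * y j : ℝ) * Complex.I) * f y)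
    (fun k y => |∑ j, t j * y j| ^ k / k.factorial * |f y|)
    (fun k => (Continuous.aestronglyMeasurable (by fun_prop)).mul
      (Complex.continuous_ofReal.comp_aestronglyMeasurable hf.1))
    (fun k => .of_forall fun y => by
      rw [norm_mul, norm_div, norm_pow, norm_mul, Complex.norm_I, mul_one, Complex.norm_real,
        Complex.norm_real, Complex.norm_natCast, Real.norm_eq_abs, Real.norm_eq_abs])
    (.of_forall fun y => (h_real _).summable.mul_right _)
    h_bound
    (.of_forall fun y => (h_complex _).mul_right _)
  have h_term (k : ℕ) : ∫ y, ((∑ j, t j * y j : ℝ) * Complex.I) ^ k / (k.factorial : ℂ) * f y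
      ∂gaussFin N = 0 := by
    have h_eq (y : Fin N → ℝ) :
        ((∑ j, t j * y j : ℝ) * Complex.I) ^ k / (k.factorial : ℂ) * f y =
          Complex.I ^ k / (k.factorial : ℂ) * ((∑ j, t j * y j) ^ k * f y : ℝ) := by
      push_cast
      ring
    simp only [h_eq]
    rw [integral_const_mul, integral_complex_ofReal, integral_pow_mul_eq_zero hf h0,
      Complex.ofReal_zero, mul_zero]
  simp only [h_term] at h_series
  exact h_series.unique hasSum_zero

/-- The finite measures with densities `f⁺` and `f⁻` have the same characteristic function. -/
theorem ae_eq_zero_of_integral_cexp_mul_eq_zero {E : Type*} [NormedAddCommGroup E]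
    [NormedSpace ℝ E] [CompleteSpace E] [SecondCountableTopology E] [MeasurableSpace E]
    [BorelSpace E] {μ : Measure E} {f : E → ℝ} (hf : Integrable f μ)
    (h0 : ∀ L : StrongDual ℝ E, ∫ x, Complex.exp (L x * Complex.I) * f x ∂μ = 0) :
    f =ᵐ[μ] 0 := by
  have h_pos_meas := hf.1.aemeasurable.ennreal_ofReal
  have h_neg_meas := hf.neg.1.aemeasurable.ennreal_ofReal
  have := isFiniteMeasure_withDensity_ofReal hf.2
  have := isFiniteMeasure_withDensity_ofReal hf.neg.2
  have h_int (L : StrongDual ℝ E) {g : E → ℝ} (hg : Integrable g μ) :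
      Integrable (fun x => (ENNReal.ofReal (g x)).toReal • Complex.exp (L x * Complex.I)) μ := by
    refine hg.pos_part.smul_bdd 1 (Continuous.aestronglyMeasurable (by fun_prop)) ?_
    exact .of_forall fun x => by rw [Complex.norm_exp_ofReal_mul_I]
  have h_sub (x : E) : (ENNReal.ofReal (f x)).toReal - (ENNReal.ofReal (-f x)).toReal = f x := by
    simp only [ENNReal.toReal_ofReal', max_zero_sub_max_neg_zero_eq_self]
  have h_measure : μ.withDensity (fun x => ENNReal.ofReal (f x)) =
      μ.withDensity fun x => ENNReal.ofReal ((-f) x) := by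
    refine Measure.ext_of_charFunDual (funext fun L => ?_)
    rw [charFunDual_apply, charFunDual_apply,
      integral_withDensity_eq_integral_toReal_smul₀ h_pos_meas (.of_forall fun _ => by simp),
      integral_withDensity_eq_integral_toReal_smul₀ h_neg_meas (.of_forall fun _ => by simp),
      ← sub_eq_zero, ← integral_sub (h_int L hf) (h_int L hf.neg), ← h0 L]
    refine integral_congr_ae (.of_forall fun x => ?_)
    simp only [Pi.neg_apply]
    rw [← sub_smul, h_sub, Complex.real_smul, mul_comm]
  have h_ae := (withDensity_eq_iff h_pos_meas h_neg_meas hf.lintegral_lt_top.ne).1 h_measure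
  filter_upwards [h_ae] with x hx
  rw [← h_sub x, hx]
  exact sub_self _

theorem eq_zero_of_integral_hermiteProd_smul_eq_zero {X : Type*} [NormedAddCommGroup X]
    [NormedSpace ℝ X] [CompleteSpace X] {f : (Fin N → ℝ) → X} (hf_cont : Continuous f)
    (hf : MemLp f 2 (gaussFin N)) (h0 : ∀ ν, ∫ y, hermiteProd ν y • f y ∂gaussFin N = 0) :
    f = 0 := by
  funext y
  refine SeparatingDual.eq_zero_of_forall_dual_eq_zero (R := ℝ) fun L => ?_
  have hLf : MemLp (fun y => L (f y)) 2 (gaussFin N) := L.comp_memLp' hf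
  have h_coeff (ν : Fin N → ℕ) : ∫ y, hermiteProd ν y * L (f y) ∂gaussFin N = 0 := by
    have h_int : Integrable (fun y => hermiteProd ν y • f y) (gaussFin N) :=
      memLp_one_iff_integrable.1 (hf.smul (memLp_hermiteProd ν))
    simpa [h0 ν] using L.integral_comp_comm h_int
  have h_ae := ae_eq_zero_of_integral_cexp_mul_eq_zero (hLf.integrable one_le_two) fun M => by
    have h_lin (y : Fin N → ℝ) : M y = ∑ j, M (Pi.single j 1) * y j := by
      conv_lhs => rw [← Finset.univ_sum_single y, map_sum]
      refine Finset.sum_congr rfl fun j _ => ?_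
      have h_single : Pi.single j (y j) = y j • (Pi.single j 1 : Fin N → ℝ) := by
        rw [← Pi.single_smul, smul_eq_mul, mul_one]
      rw [h_single, map_smul, smul_eq_mul, mul_comm]
    rw [← integral_cexp_mul_eq_zero hLf h_coeff fun j => M (Pi.single j 1)]
    simp only [← h_lin]
  exact congrFun ((Continuous.ae_eq_iff_eq _ (by fun_prop) continuous_zero).1 h_ae) y

end Completeness

section Expansion

theorem memLp_tsum {α ι X : Type*} [MeasurableSpace α] {μ : Measure α} [Countable ι]
    [NormedAddCommGroup X] [CompleteSpace X] {p : ENNReal} [Fact (1 ≤ p)] {f : ι → α → X}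
    (hf : ∀ i, MemLp (f i) p μ) (hs : ∑' i, eLpNorm (f i) p μ ≠ ⊤) :
    MemLp (fun x => ∑' i, f i x) p μ := by
  have h_enorm : ∑' i, ‖(hf i).toLp (f i)‖ₑ ≠ ⊤ := by simpa only [Lp.enorm_toLp] using hs
  have h_coe : ∀ᵐ x ∂μ, ∀ i, (hf i).toLp (f i) x = f i x := ae_all_iff.2 fun i => (hf i).coeFn_toLp
  refine (Lp.memLp (∑' i, (hf i).toLp (f i))).ae_eq ?_
  filter_upwards [Lp.hasSum_coeFn_tsum h_enorm, h_coe] with x hx h_eq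
  simp only [← hx.tsum_eq, h_eq]

variable {E ι X : Type*} [SeminormedAddCommGroup E] [NormedAddCommGroup X] [NormedSpace ℝ X]
  [CompleteSpace X] {c : ι → X} {h : ι → E → ℝ}

theorem summable_smul_of_locally_bounded (hc : Summable fun i => ‖c i‖)
    (hb : ∀ R, ∃ C, ∀ i y, ‖y‖ ≤ R → |h i y| ≤ C) (y : E) : Summable fun i => h i y • c i := by
  obtain ⟨C, hC⟩ := hb ‖y‖
  refine .of_norm_bounded (hc.mul_left C) fun i => ?_
  rw [norm_smul, Real.norm_eq_abs]
  exact mul_le_mul_of_nonneg_right (hC i y le_rfl) (norm_nonneg _)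

theorem continuous_tsum_smul_of_locally_bounded (hc : Summable fun i => ‖c i‖)
    (hh : ∀ i, Continuous (h i)) (hb : ∀ R, ∃ C, ∀ i y, ‖y‖ ≤ R → |h i y| ≤ C) :
    Continuous fun y => ∑' i, h i y • c i := by
  refine continuous_iff_continuousAt.2 fun y₀ => ?_
  obtain ⟨C, hC⟩ := hb (‖y₀‖ + 1)
  have h_ball : ContinuousOn (fun y => ∑' i, h i y • c i) (Metric.ball 0 (‖y₀‖ + 1)) := by
    refine continuousOn_tsum (u := fun i => C * ‖c i‖)
      (fun i => ((hh i).smul continuous_const).continuousOn) (hc.mul_left C) fun i y hy => ?_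
    rw [norm_smul, Real.norm_eq_abs]
    exact mul_le_mul_of_nonneg_right (hC i y (mem_ball_zero_iff.1 hy).le) (norm_nonneg _)
  exact h_ball.continuousAt (Metric.isOpen_ball.mem_nhds (by simp))

end Expansion

section HermiteSeries

variable {N : ℕ} {X : Type*} [NormedAddCommGroup X] [NormedSpace ℝ X]

theorem exists_forall_abs_hermiteProd_le (R : ℝ) :
    ∃ C, ∀ (ν : Fin N → ℕ) (y : Fin N → ℝ), ‖y‖ ≤ R → |hermiteProd ν y| ≤ C := by
  obtain ⟨C, -, hC⟩ := exists_forall_abs_hermiteFun_le R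
  refine ⟨C ^ N, fun ν y hy => ?_⟩
  rw [hermiteProd, Finset.abs_prod]
  calc ∏ j, |hermiteFun (ν j) (y j)| ≤ ∏ _j : Fin N, C :=
        Finset.prod_le_prod (fun _ _ => abs_nonneg _) fun j _ =>
          hC _ _ ((norm_le_pi_norm y j).trans hy)
    _ = C ^ N := by simp

theorem integral_hermiteProd_mul (μ ν : Fin N → ℕ) :
    ∫ y, hermiteProd μ y * hermiteProd ν y ∂gaussFin N = if μ = ν then 1 else 0 := by
  simp only [hermiteProd, ← Finset.prod_mul_distrib]
  rw [gaussFin, integral_fintype_prod_eq_prod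
    (f := fun j x => hermiteFun (μ j) x * hermiteFun (ν j) x)]
  simp only [integral_hermiteFun_mul]
  rw [Finset.prod_ite_zero]
  simp [funext_iff]

theorem integrable_hermiteProd_mul (μ ν : Fin N → ℕ) :
    Integrable (fun y => hermiteProd μ y * hermiteProd ν y) (gaussFin N) :=
  (memLp_hermiteProd μ).integrable_mul (memLp_hermiteProd ν)

theorem integral_abs_hermiteProd_mul_le (μ ν : Fin N → ℕ) :
    ∫ y, |hermiteProd μ y * hermiteProd ν y| ∂gaussFin N ≤ 1 := by
  have h_sq (κ : Fin N → ℕ) : Integrable (fun y => hermiteProd κ y * hermiteProd κ y / 2)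
      (gaussFin N) := (integrable_hermiteProd_mul κ κ).div_const 2
  calc ∫ y, |hermiteProd μ y * hermiteProd ν y| ∂gaussFin N
      ≤ ∫ y, hermiteProd μ y * hermiteProd μ y / 2 + hermiteProd ν y * hermiteProd ν y / 2
          ∂gaussFin N := by
        refine integral_mono (integrable_hermiteProd_mul μ ν).abs ((h_sq μ).add (h_sq ν))
          fun y => ?_
        rw [abs_mul]
        nlinarith [sq_nonneg (|hermiteProd μ y| - |hermiteProd ν y|),
          abs_mul_abs_self (hermiteProd μ y), abs_mul_abs_self (hermiteProd ν y)]
    _ = 1 := by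
        rw [integral_add (h_sq μ) (h_sq ν), integral_div, integral_div, integral_hermiteProd_mul,
          integral_hermiteProd_mul, if_pos rfl, if_pos rfl, add_halves]

theorem eLpNorm_hermiteProd (ν : Fin N → ℕ) : eLpNorm (hermiteProd ν) 2 (gaussFin N) = 1 := by
  rw [(memLp_hermiteProd ν).eLpNorm_eq_integral_rpow_norm two_ne_zero ENNReal.ofNat_ne_top]
  have h_sq : ∫ y, ‖hermiteProd ν y‖ ^ (2 : ℝ) ∂gaussFin N = 1 := by
    simp only [Real.rpow_two, Real.norm_eq_abs, sq, abs_mul_abs_self, integral_hermiteProd_mul,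
      if_pos]
  rw [ENNReal.toReal_ofNat, h_sq, Real.one_rpow, ENNReal.ofReal_one]

variable [CompleteSpace X] {c : (Fin N → ℕ) → X}

theorem memLp_tsum_hermiteProd_smul (hc : Summable fun ν => ‖c ν‖) :
    MemLp (fun y => ∑' ν, hermiteProd ν y • c ν) 2 (gaussFin N) := by
  have h_norm (ν : Fin N → ℕ) :
      eLpNorm (fun y => hermiteProd ν y • c ν) 2 (gaussFin N) = ‖c ν‖ₑ := by
    have h_congr : eLpNorm (fun y => hermiteProd ν y • c ν) 2 (gaussFin N) =
        eLpNorm (‖c ν‖ • hermiteProd ν) 2 (gaussFin N) :=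
      eLpNorm_congr_norm_ae (.of_forall fun y => by simp [norm_smul, mul_comm])
    rw [h_congr, eLpNorm_const_smul, eLpNorm_hermiteProd, mul_one, enorm_norm]
  refine memLp_tsum (fun ν => ⟨?_, (h_norm ν).trans_lt enorm_lt_top⟩) ?_
  · exact (memLp_hermiteProd ν).1.smul_const _
  · simpa only [h_norm] using tsum_enorm_ne_top_iff_summable_norm.2 hc

theorem integral_hermiteProd_smul_tsum (hc : Summable fun ν => ‖c ν‖) (μ : Fin N → ℕ) :
    ∫ y, hermiteProd μ y • ∑' ν, hermiteProd ν y • c ν ∂gaussFin N = c μ := by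
  have h_norm (ν : Fin N → ℕ) :
      ∫ y, ‖(hermiteProd μ y * hermiteProd ν y) • c ν‖ ∂gaussFin N ≤ ‖c ν‖ := by
    simp only [norm_smul, Real.norm_eq_abs]
    rw [integral_mul_const]
    exact mul_le_of_le_one_left (norm_nonneg _) (integral_abs_hermiteProd_mul_le μ ν)
  have h_sum := hasSum_integral_of_summable_integral_norm
    (fun ν => (integrable_hermiteProd_mul μ ν).smul_const (c ν))
    (.of_nonneg_of_le (fun ν => integral_nonneg fun y => norm_nonneg _) h_norm hc)
  simp only [integral_smul_const, integral_hermiteProd_mul, ite_smul, one_smul, zero_smul] at h_sum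
  have h_single : HasSum (fun ν => if μ = ν then c ν else 0) (c μ) := by
    simpa using hasSum_single μ fun ν hν => if_neg hν.symm
  rw [← h_sum.unique h_single]
  refine integral_congr_ae (.of_forall fun y => ?_)
  simp only [mul_smul]
  exact ((summable_smul_of_locally_bounded hc exists_forall_abs_hermiteProd_le y).tsum_const_smul
    _).symm

/-- Both sides are continuous and have the same Hermite coefficients. -/
theorem hasSum_hermiteProd_smul {f : (Fin N → ℝ) → X} (hf_cont : Continuous f)
    (hf : MemLp f 2 (gaussFin N))
    (hs : Summable fun ν => ‖∫ y, hermiteProd ν y • f y ∂gaussFin N‖) (y : Fin N → ℝ) :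
    HasSum (fun ν => hermiteProd ν y • ∫ x, hermiteProd ν x • f x ∂gaussFin N) (f y) := by
  have h_bdd := exists_forall_abs_hermiteProd_le (N := N)
  have h_cont := continuous_tsum_smul_of_locally_bounded hs continuous_hermiteProd h_bdd
  have h_memLp := memLp_tsum_hermiteProd_smul hs
  have h_int {g : (Fin N → ℝ) → X} (hg : MemLp g 2 (gaussFin N)) (μ : Fin N → ℕ) :
      Integrable (fun y => hermiteProd μ y • g y) (gaussFin N) :=
    memLp_one_iff_integrable.1 (hg.smul (memLp_hermiteProd μ))
  have h_sub := eq_zero_of_integral_hermiteProd_smul_eq_zero (hf_cont.sub h_cont)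
    (hf.sub h_memLp) fun μ => by
      simp only [Pi.sub_apply, smul_sub]
      rw [integral_sub (h_int hf μ) (h_int h_memLp μ), integral_hermiteProd_smul_tsum hs, sub_self]
  rw [congrFun (sub_eq_zero.1 h_sub) y]
  exact (summable_smul_of_locally_bounded hs h_bdd y).hasSum

end HermiteSeries

section Combination

variable {Λ : Finset (ℕ →₀ ℕ)}

theorem degree_eq_card_support {ν : ℕ →₀ ℕ} (hν : ∀ j, ν j ≤ 1) :
    ν.degree = ν.support.card := by
  rw [Finsupp.degree_apply, Finset.card_eq_sum_ones]
  refine Finset.sum_congr rfl fun j hj => ?_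
  exact (hν j).antisymm (Nat.one_le_iff_ne_zero.2 (Finsupp.mem_support_iff.1 hj))

theorem indicator_support_of_le_one {ν : ℕ →₀ ℕ} (hν : ∀ j, ν j ≤ 1) :
    Finsupp.indicator ν.support (fun _ _ => 1) = ν := by
  ext j
  have := hν j
  simp only [Finsupp.indicator_apply, Finsupp.mem_support_iff]
  grind

open Classical in
theorem sum_neg_one_pow_degree_eq_sum_powerset (hΛ : IsLowerSet (Λ : Set (ℕ →₀ ℕ)))
    {k l : ℕ →₀ ℕ} (hl : l ∈ Λ) (hkl : k ≤ l) :
    ∑ ν ∈ Λ with k ≤ ν ∧ ν ≤ l ∧ ∀ j, l j ≤ ν j + 1, (-1 : ℝ) ^ (l - ν).degree =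
      ∑ t ∈ (l - k).support.powerset, (-1 : ℝ) ^ t.card := by
  have hle_one {ν : ℕ →₀ ℕ} (hν : ∀ j, l j ≤ ν j + 1) (j) : (l - ν) j ≤ 1 := by
    simpa [add_comm] using hν j
  -- `ν = l - 1_t` with `t ⊆ {j | k j < l j}`
  refine Finset.sum_nbij' (fun ν => (l - ν).support)
    (fun t => l - Finsupp.indicator t fun _ _ => 1) ?_ ?_ ?_ ?_ ?_
  · intro ν hν
    exact Finset.mem_powerset.2
      (Finsupp.support_mono (tsub_le_tsub_left (Finset.mem_filter.1 hν).2.1 l))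
  · intro t ht
    rw [Finset.mem_filter]
    refine ⟨hΛ tsub_le_self hl, fun j => ?_, tsub_le_self, fun j => ?_⟩
    · have hj := @Finset.mem_powerset.1 ht j
      have := hkl j
      simp only [Finsupp.mem_support_iff, Finsupp.tsub_apply, Finsupp.indicator_apply] at *
      grind
    · simp only [Finsupp.tsub_apply, Finsupp.indicator_apply]
      grind
  · intro ν hν
    obtain ⟨-, -, hνl, hlν⟩ := Finset.mem_filter.1 hν
    rw [indicator_support_of_le_one (hle_one hlν), tsub_tsub_cancel_of_le hνl]
  · intro t ht
    ext j
    have hj := @Finset.mem_powerset.1 ht j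
    simp only [Finsupp.mem_support_iff, Finsupp.tsub_apply, Finsupp.indicator_apply] at *
    grind
  · intro ν hν
    rw [degree_eq_card_support (hle_one (Finset.mem_filter.1 hν).2.2.2)]

open Classical in
theorem sum_neg_one_pow_degree (hΛ : IsLowerSet (Λ : Set (ℕ →₀ ℕ))) {k l : ℕ →₀ ℕ}
    (hl : l ∈ Λ) (hkl : k ≤ l) :
    ∑ ν ∈ Λ with k ≤ ν ∧ ν ≤ l ∧ ∀ j, l j ≤ ν j + 1, (-1 : ℝ) ^ (l - ν).degree =
      if k = l then 1 else 0 := by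
  have h_powerset := congrArg (Int.cast : ℤ → ℝ)
    (Finset.sum_powerset_neg_one_pow_card (x := (l - k).support))
  push_cast at h_powerset
  rw [sum_neg_one_pow_degree_eq_sum_powerset hΛ hl hkl]
  simp only [h_powerset, Finsupp.support_eq_empty, tsub_eq_zero_iff_le, ← hkl.ge_iff_eq]

open Classical in
theorem sum_combCoeff_mul (hΛ : IsLowerSet (Λ : Set (ℕ →₀ ℕ))) (D : (ℕ →₀ ℕ) → ℝ) :
    ∑ ν ∈ Λ, combCoeff Λ ν * ∑ k ∈ Finset.Icc 0 ν, D k = ∑ k ∈ Λ, D k := by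
  have h_term (ν) (hν : ν ∈ Λ) : combCoeff Λ ν * ∑ k ∈ Finset.Icc 0 ν, D k =
      ∑ k ∈ Λ, ∑ l ∈ Λ, if k ≤ ν ∧ ν ≤ l ∧ (∀ j, l j ≤ ν j + 1) then
        D k * (-1) ^ (l - ν).degree else 0 := by
    have h_Icc : Finset.Icc 0 ν = Λ.filter (· ≤ ν) := by
      ext k
      simpa using fun hk => hΛ hk hν
    rw [h_Icc, Finset.sum_filter, combCoeff, Finset.sum_filter, Finset.sum_mul_sum,
      Finset.sum_comm]
    refine Finset.sum_congr rfl fun k _ => Finset.sum_congr rfl fun l _ => ?_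
    rw [mul_comm, ite_zero_mul_ite_zero]
  have h_alternating (k l) (hl : l ∈ Λ) :
      (∑ ν ∈ Λ, if k ≤ ν ∧ ν ≤ l ∧ (∀ j, l j ≤ ν j + 1) then D k * (-1) ^ (l - ν).degree else 0) =
        if k = l then D k else 0 := by
    rw [← Finset.sum_filter, ← Finset.mul_sum]
    by_cases hkl : k ≤ l
    · rw [sum_neg_one_pow_degree hΛ hl hkl, mul_ite, mul_one, mul_zero]
    · rw [Finset.filter_false_of_mem fun ν _ h => hkl (h.1.trans h.2.1), Finset.sum_empty, mul_zero,
        if_neg fun h => hkl h.le]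
  rw [Finset.sum_congr rfl h_term, Finset.sum_comm]
  refine Finset.sum_congr rfl fun k hk => ?_
  rw [Finset.sum_comm, Finset.sum_congr rfl (h_alternating k), Finset.sum_ite_eq, if_pos hk]

end Combination

section SmolyakOfHermite

variable {N : ℕ}

/-- A multi-index in `ℕ^N`, extended by zero to a finitely supported sequence. -/
noncomputable def extendIndex (m : Fin N → ℕ) : ℕ →₀ ℕ :=
  Finsupp.embDomain Fin.valEmbedding (Finsupp.equivFunOnFinite.symm m)

@[simp] theorem extendIndex_apply (m : Fin N → ℕ) (j : Fin N) : extendIndex m j = m j :=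
  Finsupp.embDomain_apply_self Fin.valEmbedding (Finsupp.equivFunOnFinite.symm m) j

theorem extendIndex_of_le (m : Fin N → ℕ) {j : ℕ} (hj : N ≤ j) : extendIndex m j = 0 :=
  Finsupp.embDomain_of_notMem_range _ _ _ (by rintro ⟨i, rfl⟩; exact hj.not_gt i.2)

theorem le_extendIndex_iff {ν : ℕ →₀ ℕ} (hν : ∀ j, N ≤ j → ν j = 0) {m : Fin N → ℕ} :
    ν ≤ extendIndex m ↔ ∀ j : Fin N, ν j ≤ m j := by
  refine ⟨fun h j => (h j).trans_eq (extendIndex_apply m j), fun h j => ?_⟩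
  rcases lt_or_ge j N with hj | hj
  · exact (h ⟨j, hj⟩).trans_eq (extendIndex_apply m ⟨j, hj⟩).symm
  · simp [hν j hj]

theorem extendIndex_restrict {ν : ℕ →₀ ℕ} (hν : ∀ j, N ≤ j → ν j = 0) :
    extendIndex (fun j : Fin N => ν j) = ν := by
  ext j
  rcases lt_or_ge j N with hj | hj
  · exact extendIndex_apply _ ⟨j, hj⟩
  · rw [extendIndex_of_le _ hj, hν j hj]

theorem extendIndex_zero : extendIndex (0 : Fin N → ℕ) = 0 :=
  extendIndex_restrict (ν := 0) fun _ _ => rfl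

theorem sum_Icc_prod (m : Fin N → ℕ) (g : Fin N → ℕ → ℝ) :
    ∑ μ ∈ Finset.Icc 0 (extendIndex m), ∏ j : Fin N, g j (μ j) =
      ∏ j : Fin N, ∑ k ∈ Finset.range (m j + 1), g j k := by
  rw [Finset.prod_univ_sum]
  have hμ0 {μ : ℕ →₀ ℕ} (hμ : μ ∈ Finset.Icc 0 (extendIndex m)) (j) (hj : N ≤ j) : μ j = 0 :=
    Nat.le_zero.1 (((Finset.mem_Icc.1 hμ).2 j).trans_eq (extendIndex_of_le m hj))
  refine Finset.sum_nbij' (fun μ j => μ j) extendIndex ?_ ?_ ?_ ?_ fun _ _ => rfl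
  · intro μ hμ
    simpa [Nat.lt_succ_iff] using (le_extendIndex_iff (hμ0 hμ)).1 (Finset.mem_Icc.1 hμ).2
  · intro k hk
    refine Finset.mem_Icc.2 ⟨zero_le, (le_extendIndex_iff fun j hj => extendIndex_of_le k hj).2 ?_⟩
    simpa [Nat.lt_succ_iff] using hk
  · exact fun μ hμ => extendIndex_restrict (hμ0 hμ)
  · exact fun k _ => funext (extendIndex_apply k)

/-- The Smolyak quadrature with index set `Λ`, applied to the Hermite polynomial with
multi-index `m`. -/
noncomputable def smolyakHermite (Λ : Finset (ℕ →₀ ℕ)) (m : Fin N → ℕ) : ℝ :=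
  ∑ l ∈ Λ, ∏ j : Fin N, quadDiff (l j) (m j)

variable {Λ : Finset (ℕ →₀ ℕ)}

theorem smolyakHermite_eq_zero_of_eq_one {m : Fin N → ℕ} {j : Fin N} (hj : m j = 1) :
    smolyakHermite Λ m = 0 :=
  Finset.sum_eq_zero fun l _ => Finset.prod_eq_zero (Finset.mem_univ j) <| by
    rw [hj, quadDiff_one_right]

theorem prod_quadDiff_eq_zero {l : ℕ →₀ ℕ} (hl : ∀ j, N ≤ j → l j = 0) {m : Fin N → ℕ}
    (h : ¬ l ≤ extendIndex m) : ∏ j : Fin N, quadDiff (l j) (m j) = 0 := by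
  rw [le_extendIndex_iff hl] at h
  push Not at h
  obtain ⟨j, hj⟩ := h
  exact Finset.prod_eq_zero (Finset.mem_univ j) (quadDiff_eq_zero_of_lt hj)

variable (hN : ∀ l ∈ Λ, ∀ j, N ≤ j → l j = 0)

include hN

theorem smolyakHermite_of_mem (hΛ : IsLowerSet (Λ : Set (ℕ →₀ ℕ))) {m : Fin N → ℕ}
    (hm : extendIndex m ∈ Λ) : smolyakHermite Λ m = if m = 0 then 1 else 0 := by
  have h_sub : Finset.Icc 0 (extendIndex m) ⊆ Λ := fun l hl => hΛ (Finset.mem_Icc.1 hl).2 hm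
  rw [smolyakHermite, ← Finset.sum_subset h_sub fun l hl hl' => prod_quadDiff_eq_zero (hN l hl)
    fun h => hl' (Finset.mem_Icc.2 ⟨zero_le, h⟩), sum_Icc_prod m fun j k => quadDiff k (m j)]
  simp only [sum_quadDiff_self, Finset.prod_ite_zero, Finset.prod_const_one, Finset.mem_univ,
    true_imp_iff, funext_iff, Pi.zero_apply]

theorem abs_smolyakHermite_le (m : Fin N → ℕ) :
    |smolyakHermite Λ m| ≤ ∏ j : Fin N, ∑ k ∈ Finset.range (m j + 1), |quadDiff k (m j)| := by
  calc |smolyakHermite Λ m| ≤ ∑ l ∈ Λ, |∏ j : Fin N, quadDiff (l j) (m j)| :=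
        Finset.abs_sum_le_sum_abs _ _
    _ = ∑ l ∈ Λ with l ≤ extendIndex m, |∏ j : Fin N, quadDiff (l j) (m j)| := by
        refine (Finset.sum_filter_of_ne fun l hl hne => ?_).symm
        by_contra hlm
        exact hne (abs_eq_zero.2 (prod_quadDiff_eq_zero (hN l hl) hlm))
    _ ≤ ∑ l ∈ Finset.Icc 0 (extendIndex m), |∏ j : Fin N, quadDiff (l j) (m j)| :=
        Finset.sum_le_sum_of_subset_of_nonneg
          (fun l hl => Finset.mem_Icc.2 ⟨zero_le, (Finset.mem_filter.1 hl).2⟩)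
          fun _ _ _ => abs_nonneg _
    _ = ∏ j : Fin N, ∑ k ∈ Finset.range (m j + 1), |quadDiff k (m j)| := by
        simp only [Finset.abs_prod, sum_Icc_prod m fun j k => |quadDiff k (m j)|]

omit hN in
theorem exists_abs_smolyakHermite_le : ∃ C : ℝ, 1 ≤ C ∧ ∀ (N : ℕ) (Λ : Finset (ℕ →₀ ℕ)),
    (∀ l ∈ Λ, ∀ j, N ≤ j → l j = 0) → ∀ m : Fin N → ℕ,
      |smolyakHermite Λ m| ≤ ∏ j, if m j = 0 then 1 else C * (m j : ℝ) ^ 2 := by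
  obtain ⟨C, hC1, hC⟩ := exists_sum_abs_quadDiff_le
  refine ⟨C, hC1, fun N Λ hN m => (abs_smolyakHermite_le hN m).trans ?_⟩
  refine Finset.prod_le_prod (fun j _ => Finset.sum_nonneg fun _ _ => abs_nonneg _) fun j _ => ?_
  split_ifs with h
  · simp [h, quadDiff_zero_zero]
  · exact hC _ (Nat.one_le_iff_ne_zero.2 h)

end SmolyakOfHermite

section HermiteExpansion

variable {X : Type*} [NormedAddCommGroup X] [InnerProductSpace ℂ X] {b : ℕ → ℝ} {ξ δ : ℝ}
  {u : (ℕ → ℝ) → X} {v : (N : ℕ) → (Fin N → ℝ) → X} {N : ℕ} {c : (Fin N → ℕ) → X}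

theorem tensorQuad_eq_sum (hu : HolomorphicWith b ξ δ u v) (hN1 : 1 ≤ N) {ν : ℕ →₀ ℕ}
    (hν : ∀ j, N ≤ j → ν j = 0) :
    tensorQuad v ν = ∑ μ ∈ Finset.Icc 0 ν,
      (∏ j : Fin N, weight (ν j) (μ j)) • v N fun i => gridPoint ν μ i := by
  refine Finset.sum_congr rfl fun μ hμ => ?_
  have hμ0 (j) (hj : ν j = 0) : μ j = 0 := Nat.le_zero.1 (hj ▸ (Finset.mem_Icc.1 hμ).2 j)
  rw [hu.pointEval_eq hN1 fun j hj => by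
    rw [gridPoint, hν j hj, hμ0 j (hν j hj), node_zero_zero],
    Fin.prod_univ_eq_prod_range (fun j => weight (ν j) (μ j))]
  congr 1
  refine Finset.prod_subset (fun j hj => ?_) fun j _ hj => ?_
  · by_contra hjN
    exact Finsupp.mem_support_iff.1 hj (hν j (by simpa using hjN))
  · have hνj := Finsupp.notMem_support_iff.1 hj
    rw [hνj, hμ0 j hνj, weight_zero_zero]

variable (hu : HolomorphicWith b ξ δ u v) (hN1 : 1 ≤ N)
  (hc : ∀ y, HasSum (fun m => hermiteProd m y • c m) (v N y))

include hu hN1 hc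

theorem hasSum_tensorQuad {ν : ℕ →₀ ℕ} (hν : ∀ j, N ≤ j → ν j = 0) :
    HasSum (fun m : Fin N → ℕ => (∏ j : Fin N, quadHermite (ν j) (m j)) • c m)
      (tensorQuad v ν) := by
  rw [tensorQuad_eq_sum hu hN1 hν]
  refine (hasSum_sum fun μ (_ : μ ∈ Finset.Icc 0 ν) => (hc fun i => gridPoint ν μ i).const_smul
    (∏ j : Fin N, weight (ν j) (μ j))).congr_fun fun m => ?_
  have h_prod := sum_Icc_prod (fun j : Fin N => ν j) fun j k =>
    weight (ν j) k * hermiteFun (m j) (node (ν j) k)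
  rw [extendIndex_restrict hν] at h_prod
  simp only [smul_smul, ← Finset.sum_smul, hermiteProd, ← Finset.prod_mul_distrib, gridPoint,
    h_prod, quadHermite]

theorem hasSum_smolyakQuad {Λ : Finset (ℕ →₀ ℕ)} (hN : ∀ l ∈ Λ, ∀ j, N ≤ j → l j = 0)
    (hΛ : IsLowerSet (Λ : Set (ℕ →₀ ℕ))) :
    HasSum (fun m : Fin N → ℕ => smolyakHermite Λ m • c m) (smolyakQuad Λ v) := by
  refine (hasSum_sum fun ν hν =>
    (hasSum_tensorQuad hu hN1 hc (hN ν hν)).const_smul (combCoeff Λ ν)).congr_fun fun m => ?_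
  simp only [smul_smul, ← Finset.sum_smul]
  rw [smolyakHermite, ← sum_combCoeff_mul hΛ]
  congr 1
  refine Finset.sum_congr rfl fun ν hν => ?_
  have h_prod := sum_Icc_prod (fun j : Fin N => ν j) fun j k => quadDiff k (m j)
  rw [extendIndex_restrict (hN ν hν)] at h_prod
  simp only [h_prod, sum_quadDiff]

end HermiteExpansion

section ProductSums

variable {N : ℕ}

theorem sum_prod_le_prod_tsum {g : Fin N → ℕ → ℝ} (hg0 : ∀ j k, 0 ≤ g j k)
    (hg : ∀ j, Summable (g j)) (S : Finset (Fin N → ℕ)) :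
    ∑ ν ∈ S, ∏ j, g j (ν j) ≤ ∏ j, ∑' k, g j k := by
  classical
  have hS : S ⊆ Fintype.piFinset fun j => S.image fun ν => ν j := fun ν hν =>
    Fintype.mem_piFinset.2 fun j => Finset.mem_image_of_mem _ hν
  calc ∑ ν ∈ S, ∏ j, g j (ν j)
      ≤ ∑ ν ∈ Fintype.piFinset fun j => S.image fun ν => ν j, ∏ j, g j (ν j) :=
        Finset.sum_le_sum_of_subset_of_nonneg hS fun ν _ _ => Finset.prod_nonneg fun j _ => hg0 _ _
    _ = ∏ j, ∑ k ∈ S.image fun ν => ν j, g j k := (Finset.prod_univ_sum _ _).symm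
    _ ≤ ∏ j, ∑' k, g j k := Finset.prod_le_prod (fun j _ => Finset.sum_nonneg fun k _ => hg0 j k)
        fun j _ => (hg j).sum_le_tsum _ fun k _ => hg0 j k

theorem summable_prod_of_nonneg {g : Fin N → ℕ → ℝ} (hg0 : ∀ j k, 0 ≤ g j k)
    (hg : ∀ j, Summable (g j)) : Summable fun ν : Fin N → ℕ => ∏ j, g j (ν j) :=
  summable_of_sum_le (fun _ => Finset.prod_nonneg fun j _ => hg0 j _) (sum_prod_le_prod_tsum hg0 hg)

theorem summable_inv_coeffWeight {C M : ℝ} {r : ℕ} (hr : 2 ≤ r) :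
    Summable fun k => (coeffWeight C M r k)⁻¹ := by
  have h_tail : Summable fun k : ℕ => C * M⁻¹ * ((k : ℝ) ^ r)⁻¹ :=
    (Real.summable_nat_pow_inv.2 (by omega)).mul_left _
  refine (summable_nat_add_iff 2).1 (((summable_nat_add_iff 2).2 h_tail).congr fun k => ?_)
  rw [coeffWeight, if_neg (by omega), mul_inv, mul_inv, inv_inv]

theorem summable_norm_of_sum_mul_sq_le {ι X : Type*} [NormedAddCommGroup X] {c : ι → X}
    {w : ι → ℝ} (hw0 : ∀ i, 0 < w i) (hw : Summable fun i => (w i)⁻¹) {D : ℝ}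
    (h : ∀ S : Finset ι, ∑ i ∈ S, w i * ‖c i‖ ^ 2 ≤ D) : Summable fun i => ‖c i‖ := by
  have h_sq : Summable fun i => w i * ‖c i‖ ^ 2 :=
    summable_of_sum_le (fun i => mul_nonneg (hw0 i).le (sq_nonneg _)) h
  refine (h_sq.add hw).of_nonneg_of_le (fun _ => norm_nonneg _) fun i => ?_
  have h_amgm : 0 ≤ w i * (‖c i‖ - (w i)⁻¹) ^ 2 := mul_nonneg (hw0 i).le (sq_nonneg _)
  have h_expand : w i * (‖c i‖ - (w i)⁻¹) ^ 2 = w i * ‖c i‖ ^ 2 + (w i)⁻¹ - 2 * ‖c i‖ := by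
    have := (hw0 i).ne'
    field_simp
    ring
  linarith [norm_nonneg (c i)]

theorem exists_sum_prod_rpow_le {θ : ℕ → ℝ} (hθ0 : ∀ j, 0 ≤ θ j) (hθ : Summable θ) {e : ℝ}
    (he : e < -1) : ∃ B : ℝ, 0 < B ∧ ∀ (N : ℕ) (S : Finset (Fin N → ℕ)),
      ∑ m ∈ S, ∏ j, (if m j = 0 then 1 else θ j * (m j : ℝ) ^ e) ≤ B := by
  have hZ : Summable fun k : ℕ => ((k + 1 : ℕ) : ℝ) ^ e :=
    (summable_nat_add_iff 1).2 (Real.summable_nat_rpow.2 he)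
  set Z := ∑' k : ℕ, ((k + 1 : ℕ) : ℝ) ^ e with hZ_def
  have hZ0 : 0 ≤ Z := tsum_nonneg fun k => by positivity
  have hg (j : ℕ) : HasSum (fun k : ℕ => if k = 0 then 1 else θ j * (k : ℝ) ^ e) (1 + θ j * Z) := by
    rw [← hasSum_nat_add_iff' 1]
    simpa [hZ_def] using hZ.hasSum.mul_left (θ j)
  have hg0 (j k : ℕ) : 0 ≤ if k = 0 then 1 else θ j * (k : ℝ) ^ e := by
    have := hθ0 j
    split_ifs <;> positivity
  refine ⟨Real.exp (Z * ∑' j, θ j), Real.exp_pos _, fun N S => ?_⟩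
  calc ∑ m ∈ S, ∏ j, (if m j = 0 then 1 else θ j * (m j : ℝ) ^ e)
      ≤ ∏ j : Fin N, ∑' k : ℕ, (if k = 0 then 1 else θ j * (k : ℝ) ^ e) :=
        sum_prod_le_prod_tsum (fun j => hg0 j) (fun j => (hg j).summable) S
    _ = ∏ j : Fin N, (1 + θ j * Z) := Finset.prod_congr rfl fun j _ => (hg j).tsum_eq
    _ ≤ ∏ j : Fin N, Real.exp (θ j * Z) := Finset.prod_le_prod
        (fun j _ => add_nonneg zero_le_one (mul_nonneg (hθ0 j) hZ0))
        fun j _ => (add_comm _ _).trans_le (Real.add_one_le_exp _)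
    _ = Real.exp (Z * ∑ j ∈ Finset.range N, θ j) := by
        rw [← Real.exp_sum, ← Finset.sum_mul, Fin.sum_univ_eq_sum_range, mul_comm]
    _ ≤ Real.exp (Z * ∑' j, θ j) := by
        gcongr
        exact hθ.sum_le_tsum _ fun j _ => hθ0 j

end ProductSums

section FiniteDimension

theorem exists_forall_le_eq_zero (S : Finset (ℕ →₀ ℕ)) (N₀ : ℕ) :
    ∃ N, N₀ ≤ N ∧ ∀ l ∈ S, ∀ j, N ≤ j → l j = 0 := by
  refine ⟨N₀ + S.sup fun l => l.support.sup fun j => j + 1, Nat.le_add_right _ _,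
    fun l hl j hj => ?_⟩
  by_contra hlj
  have h_support := Finset.le_sup (f := fun j => j + 1) (Finsupp.mem_support_iff.2 hlj)
  have h_index := Finset.le_sup (f := fun l : ℕ →₀ ℕ => l.support.sup fun j => j + 1) hl
  omega

theorem prod_support_eq_prod_fin {N : ℕ} {ν : ℕ →₀ ℕ} (hν : ∀ j, N ≤ j → ν j = 0)
    (f : ℕ → ℕ → ℝ) :
    ∏ j ∈ ν.support, f j (ν j) = ∏ j : Fin N, if ν j = 0 then 1 else f j (ν j) := by
  rw [Fin.prod_univ_eq_prod_range fun j => if ν j = 0 then 1 else f j (ν j)]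
  have h_sub : ν.support ⊆ Finset.range N := fun j hj => by
    by_contra hjN
    exact Finsupp.mem_support_iff.1 hj (hν j (by simpa using hjN))
  rw [← Finset.prod_subset h_sub fun j _ hj => if_pos (Finsupp.notMem_support_iff.1 hj)]
  exact Finset.prod_congr rfl fun j hj => (if_neg (Finsupp.mem_support_iff.1 hj)).symm

theorem exists_sum_prod_support_rpow_le {θ : ℕ → ℝ} (hθ0 : ∀ j, 0 ≤ θ j) (hθ : Summable θ) {e : ℝ}
    (he : e < -1) : ∃ B : ℝ, 0 < B ∧ ∀ S : Finset (ℕ →₀ ℕ),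
      ∑ ν ∈ S, ∏ j ∈ ν.support, θ j * (ν j : ℝ) ^ e ≤ B := by
  classical
  obtain ⟨B, hB0, hB⟩ := exists_sum_prod_rpow_le hθ0 hθ he
  refine ⟨B, hB0, fun S => ?_⟩
  obtain ⟨N, -, hN⟩ := exists_forall_le_eq_zero S 0
  refine le_trans (le_of_eq ?_) (hB N (S.image fun ν (j : Fin N) => ν j))
  rw [Finset.sum_image fun ν hν μ hμ h => by
    rw [← extendIndex_restrict (hN ν hν), h, extendIndex_restrict (hN μ hμ)]]
  exact Finset.sum_congr rfl fun ν hν =>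
    prod_support_eq_prod_fin (hN ν hν) fun j k => θ j * (k : ℝ) ^ e

end FiniteDimension

section ProductWeights

/-- The product weight `∏_{j ∈ supp ν} M_j ν_j^α`, of which `cWeight` is the special case
`M_j = max {1, K ϱ_j} ^ (2 k)`. -/
noncomputable def prodWeight (M : ℕ → ℝ) (α : ℝ) (ν : ℕ →₀ ℕ) : ℝ :=
  ∏ j ∈ ν.support, M j * (ν j : ℝ) ^ α

theorem one_le_natCast_of_mem_support {ν : ℕ →₀ ℕ} {j : ℕ} (hj : j ∈ ν.support) :
    (1 : ℝ) ≤ ν j := by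
  exact_mod_cast Nat.one_le_iff_ne_zero.2 (Finsupp.mem_support_iff.1 hj)

theorem card_Icc_le_prod_support (ν : ℕ →₀ ℕ) :
    ((Finset.Icc 0 ν).card : ℝ) ≤ ∏ j ∈ ν.support, 2 * (ν j : ℝ) := by
  simp only [Finsupp.card_Icc, Finsupp.support_zero, Finset.empty_union, Finsupp.coe_zero,
    Pi.zero_apply, Nat.card_Icc, tsub_zero, Nat.cast_prod]
  refine Finset.prod_le_prod (fun j _ => by positivity) fun j hj => ?_
  have := one_le_natCast_of_mem_support hj
  push_cast
  linarith

variable {M : ℕ → ℝ} {α s : ℝ} (hM : ∀ j, 1 ≤ M j)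

include hM

theorem prodWeight_pos (ν : ℕ →₀ ℕ) : 0 < prodWeight M α ν :=
  Finset.prod_pos fun j hj => mul_pos (one_pos.trans_le (hM j))
    (Real.rpow_pos_of_pos (one_pos.trans_le (one_le_natCast_of_mem_support hj)) _)

theorem monotone_prodWeight (hα : 0 ≤ α) : Monotone (prodWeight M α) := by
  intro ν μ h
  obtain ⟨N, -, hN⟩ := exists_forall_le_eq_zero {ν, μ} 0
  unfold prodWeight
  rw [prod_support_eq_prod_fin (hN ν (by simp)) fun j k => M j * (k : ℝ) ^ α,
    prod_support_eq_prod_fin (hN μ (by simp)) fun j k => M j * (k : ℝ) ^ α]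
  have hM0 (j) := one_pos.trans_le (hM j)
  refine Finset.prod_le_prod (fun j _ => ?_) fun j _ => ?_
  · have := hM0 j
    split_ifs <;> positivity
  · have hj := h j
    split_ifs with hνj hμj hμj
    · exact le_rfl
    · refine one_le_mul_of_one_le_of_one_le (hM j) (Real.one_le_rpow ?_ hα)
      exact_mod_cast Nat.one_le_iff_ne_zero.2 hμj
    · omega
    · have := hM0 j
      gcongr

theorem isLowerSet_indexSet_prodWeight (hα : 0 ≤ α) (ε : ℝ) :
    IsLowerSet (indexSet (prodWeight M α) ε) := fun _ _ hνμ hμ =>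
  hμ.trans (inv_anti₀ (prodWeight_pos hM _) (monotone_prodWeight hM hα hνμ))

theorem prodWeight_rpow (e : ℝ) (ν : ℕ →₀ ℕ) :
    prodWeight M α ν ^ e = ∏ j ∈ ν.support, M j ^ e * (ν j : ℝ) ^ (α * e) := by
  have hM0 (j) := one_pos.trans_le (hM j)
  unfold prodWeight
  rw [← Real.finsetProd_rpow _ _ fun j _ => mul_nonneg (hM0 j).le (by positivity)]
  refine Finset.prod_congr rfl fun j _ => ?_
  rw [Real.mul_rpow (hM0 j).le (by positivity), ← Real.rpow_mul (by positivity)]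

theorem one_le_rpow_mul_prodWeight_rpow (hs : 0 ≤ s) {ε : ℝ} (hε : 0 < ε) {ν : ℕ →₀ ℕ}
    (hν : ν ∈ indexSet (prodWeight M α) ε) : 1 ≤ ε ^ (-s) * prodWeight M α ν ^ (-s) := by
  have hc := prodWeight_pos (α := α) hM ν
  rw [← Real.mul_rpow hε.le hc.le]
  refine Real.one_le_rpow_of_pos_of_le_one_of_nonpos (mul_pos hε hc) ?_ (neg_nonpos.2 hs)
  exact (mul_le_mul_of_nonneg_right hν hc.le).trans_eq (inv_mul_cancel₀ hc.ne')

theorem card_Icc_le_rpow_mul_prod (hs : 0 ≤ s) {ε : ℝ} (hε : 0 < ε) {ν : ℕ →₀ ℕ}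
    (hν : ν ∈ indexSet (prodWeight M α) ε) :
    ((Finset.Icc 0 ν).card : ℝ) ≤
      ε ^ (-s) * ∏ j ∈ ν.support, 2 * M j ^ (-s) * (ν j : ℝ) ^ (1 - α * s) := by
  calc ((Finset.Icc 0 ν).card : ℝ)
      ≤ (ε ^ (-s) * prodWeight M α ν ^ (-s)) * ∏ j ∈ ν.support, 2 * (ν j : ℝ) :=
        (card_Icc_le_prod_support ν).trans <|
          le_mul_of_one_le_left (Finset.prod_nonneg fun _ _ => by positivity)
            (one_le_rpow_mul_prodWeight_rpow hM hs hε hν)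
    _ = ε ^ (-s) * ∏ j ∈ ν.support, 2 * M j ^ (-s) * (ν j : ℝ) ^ (1 - α * s) := by
        rw [prodWeight_rpow hM, mul_assoc, ← Finset.prod_mul_distrib]
        congr 1
        refine Finset.prod_congr rfl fun j hj => ?_
        rw [sub_eq_add_neg, Real.rpow_add (one_pos.trans_le (one_le_natCast_of_mem_support hj)),
          Real.rpow_one]
        ring_nf

theorem exists_sum_card_Icc_le (hs : 0 ≤ s) (hMs : Summable fun j => M j ^ (-s)) (hα : 2 < α * s) :
    ∃ B : ℝ, 0 < B ∧ ∀ ε : ℝ, 0 < ε → ∀ S : Finset (ℕ →₀ ℕ),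
      ↑S ⊆ indexSet (prodWeight M α) ε →
        ((∑ ν ∈ S, (Finset.Icc 0 ν).card : ℕ) : ℝ) ≤ B * ε ^ (-s) := by
  have hM0 (j) := one_pos.trans_le (hM j)
  obtain ⟨B, hB0, hB⟩ := exists_sum_prod_support_rpow_le (θ := fun j => 2 * M j ^ (-s))
    (e := 1 - α * s) (fun j => by have := hM0 j; positivity) (hMs.mul_left 2) (by linarith)
  refine ⟨B, hB0, fun ε hε S hS => ?_⟩
  push_cast
  calc ∑ ν ∈ S, ((Finset.Icc 0 ν).card : ℝ)
      ≤ ∑ ν ∈ S, ε ^ (-s) * ∏ j ∈ ν.support, 2 * M j ^ (-s) * (ν j : ℝ) ^ (1 - α * s) :=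
        Finset.sum_le_sum fun ν hν => card_Icc_le_rpow_mul_prod hM hs hε (hS hν)
    _ = (∑ ν ∈ S, ∏ j ∈ ν.support, 2 * M j ^ (-s) * (ν j : ℝ) ^ (1 - α * s)) * ε ^ (-s) := by
        rw [← Finset.mul_sum, mul_comm]
    _ ≤ B * ε ^ (-s) := by gcongr; exact hB S

end ProductWeights

section Cardinality

theorem finite_of_sum_card_Icc_le {Λ : Set (ℕ →₀ ℕ)} {D : ℝ}
    (h : ∀ S : Finset (ℕ →₀ ℕ), ↑S ⊆ Λ → ((∑ ν ∈ S, (Finset.Icc 0 ν).card : ℕ) : ℝ) ≤ D) :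
    Λ.Finite := by
  by_contra h_inf
  obtain ⟨S, hS, h_card⟩ := Set.Infinite.exists_subset_card_eq h_inf (⌊D⌋₊ + 1)
  have h_le : S.card ≤ ∑ ν ∈ S, (Finset.Icc 0 ν).card := by
    rw [Finset.card_eq_sum_ones]
    exact Finset.sum_le_sum fun ν _ => Finset.card_pos.2 ⟨0, Finset.mem_Icc.2 ⟨le_rfl, zero_le⟩⟩
  have hD : (S.card : ℝ) ≤ D := le_trans (by exact_mod_cast h_le) (h S hS)
  rw [h_card, Nat.cast_add_one] at hD
  linarith [Nat.lt_floor_add_one D]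

theorem encard_pts_le (Λ : Finset (ℕ →₀ ℕ)) :
    (pts (Λ : Set (ℕ →₀ ℕ))).encard ≤ (∑ ν ∈ Λ, (Finset.Icc 0 ν).card : ℕ) := by
  classical
  have h_sub : pts (Λ : Set (ℕ →₀ ℕ)) ⊆
      ((Λ.sigma fun ν => Finset.Icc 0 ν).image fun q => gridPoint q.1 q.2 : Finset (ℕ → ℝ)) := by
    rintro y ⟨ν, hν, μ, hμ, rfl⟩
    rw [Finset.coe_image]
    exact ⟨⟨ν, μ⟩, by simpa using ⟨hν, hμ⟩, rfl⟩
  refine (Set.encard_le_encard h_sub).trans ?_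
  rw [Set.encard_coe_eq_coe_finsetCard, ← Finset.card_sigma]
  exact Nat.cast_le.2 Finset.card_image_le

end Cardinality

section DimensionLimit

instance : IsProbabilityMeasure gaussInf := by unfold gaussInf; infer_instance

theorem map_restrict_gaussInf (N : ℕ) :
    gaussInf.map (fun y (i : Fin N) => y i) = gaussFin N := by
  refine (Measure.pi_eq fun s hs => ?_).symm
  have h_preimage : (fun (y : ℕ → ℝ) (i : Fin N) => y i) ⁻¹' Set.univ.pi s =
      Set.pi (Finset.range N) fun j => if h : j < N then s ⟨j, h⟩ else Set.univ := by
    ext y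
    simp only [Set.mem_preimage, Set.mem_pi, Set.mem_univ, true_imp_iff, Finset.coe_range,
      Set.mem_Iio]
    exact ⟨fun h j hj => by simpa [hj] using h ⟨j, hj⟩, fun h i => by simpa using h i i.2⟩
  rw [Measure.map_apply (by fun_prop) (MeasurableSet.univ_pi hs), h_preimage, gaussInf,
    Measure.infinitePi_pi _ fun j hj => by simpa [Finset.mem_range.1 hj] using hs _,
    ← Fin.prod_univ_eq_prod_range
      fun j => gaussianReal 0 1 (if h : j < N then s ⟨j, h⟩ else Set.univ)]
  simp

theorem measurePreserving_restrict (N : ℕ) :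
    MeasurePreserving (fun y (i : Fin N) => y i) gaussInf (gaussFin N) :=
  ⟨by fun_prop, map_restrict_gaussInf N⟩

variable {X : Type*} [NormedAddCommGroup X] [InnerProductSpace ℂ X]

theorem HolomorphicWith.tendsto_integral {b : ℕ → ℝ} {ξ δ : ℝ} {u : (ℕ → ℝ) → X}
    {v : (N : ℕ) → (Fin N → ℝ) → X} (hu : HolomorphicWith b ξ δ u v)
    (hv : ∀ N, 1 ≤ N → MemLp (v N) 2 (gaussFin N)) :
    Tendsto (fun N => ∫ y, v N y ∂gaussFin N) atTop (𝓝 (∫ y, u y ∂gaussInf)) := by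
  have h_memLp (N : ℕ) (hN : 1 ≤ N) : MemLp (fun y : ℕ → ℝ => v N fun i => y i) 2 gaussInf :=
    (hv N hN).comp_measurePreserving (measurePreserving_restrict N)
  have h_L1 : Tendsto (fun N => ∫⁻ y : ℕ → ℝ, ‖v N (fun i => y i) - u y‖ₑ ∂gaussInf) atTop
      (𝓝 0) := by
    refine tendsto_of_tendsto_of_tendsto_of_le_of_le' tendsto_const_nhds hu.tendsto
      (Eventually.of_forall fun _ => zero_le) ?_
    filter_upwards [eventually_ge_atTop 1] with N hN
    simp_rw [enorm_sub_rev]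
    rw [← eLpNorm_one_eq_lintegral_enorm]
    exact eLpNorm_le_eLpNorm_of_exponent_le (by norm_num) (hu.memLp.sub (h_memLp N hN)).1
  refine (tendsto_integral_of_L1 u hu.memLp.1 ((eventually_ge_atTop 1).mono fun N hN =>
    (h_memLp N hN).integrable (by norm_num)) h_L1).congr' ?_
  filter_upwards [eventually_ge_atTop 1] with N hN
  rw [← map_restrict_gaussInf, integral_map (measurePreserving_restrict N).aemeasurable]
  rw [map_restrict_gaussInf]
  exact (hv N hN).1

end DimensionLimit

section HermiteError

variable {N : ℕ} {Λ : Finset (ℕ →₀ ℕ)}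

/-- The error of the Smolyak quadrature with index set `Λ` for the tensorized Hermite polynomial
of multidegree `m`, whose Gaussian integral is `1` if `m = 0` and `0` otherwise. -/
noncomputable def hermiteError (Λ : Finset (ℕ →₀ ℕ)) (m : Fin N → ℕ) : ℝ :=
  (if m = 0 then 1 else 0) - smolyakHermite Λ m

theorem hermiteError_of_ne_zero {m : Fin N → ℕ} (hm : m ≠ 0) :
    hermiteError Λ m = -smolyakHermite Λ m := by
  rw [hermiteError, if_neg hm, zero_sub]

theorem hermiteError_eq_zero_of_mem (hN : ∀ l ∈ Λ, ∀ j, N ≤ j → l j = 0)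
    (hΛ : IsLowerSet (Λ : Set (ℕ →₀ ℕ))) {m : Fin N → ℕ} (hm : extendIndex m ∈ Λ) :
    hermiteError Λ m = 0 := by
  rw [hermiteError, smolyakHermite_of_mem hN hΛ hm, sub_self]

theorem hermiteError_eq_zero_of_eq_one {m : Fin N → ℕ} {j : Fin N} (hj : m j = 1) :
    hermiteError Λ m = 0 := by
  have hm : m ≠ 0 := by
    rintro rfl
    exact zero_ne_one hj
  rw [hermiteError_of_ne_zero hm, smolyakHermite_eq_zero_of_eq_one hj, neg_zero]

variable {C₀ C₁ α s ε : ℝ} {r : ℕ}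

theorem abs_hermiteError_le (hN : ∀ l ∈ Λ, ∀ j, N ≤ j → l j = 0)
    (hΛ : IsLowerSet (Λ : Set (ℕ →₀ ℕ))) {m : Fin N → ℕ}
    (hQ : |smolyakHermite Λ m| ≤ ∏ j, if m j = 0 then 1 else C₁ * (m j : ℝ) ^ 2) :
    |hermiteError Λ m| ≤ ∏ j, if m j = 0 then 1 else C₁ * (m j : ℝ) ^ 2 := by
  by_cases hm0 : m = 0
  · subst hm0
    rcases Λ.eq_empty_or_nonempty with rfl | ⟨l, hl⟩
    · simp [hermiteError, smolyakHermite]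
    · have h0 : extendIndex (0 : Fin N → ℕ) ∈ Λ := extendIndex_zero ▸ hΛ zero_le hl
      simp [hermiteError_eq_zero_of_mem hN hΛ h0]
  · rwa [hermiteError_of_ne_zero hm0, abs_neg]

theorem inv_coeffWeight_mul_sq {M : ℝ} (hM : 0 < M) {k : ℕ} (hk : k ≠ 1) :
    (coeffWeight C₀ M r k)⁻¹ * (if k = 0 then 1 else C₁ * (k : ℝ) ^ 2) ^ 2 =
      (if k = 0 then 1 else M ^ (s - 1) * (k : ℝ) ^ (α * (s - 1))) *
        if k = 0 then 1 else C₁ ^ 2 * C₀ * M ^ (-s) * (k : ℝ) ^ (α * (1 - s) + 4 - r) := by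
  by_cases h0 : k = 0
  · simp [h0, coeffWeight]
  have hk0 : (0 : ℝ) < k := by exact_mod_cast Nat.pos_of_ne_zero h0
  have h_base : M ^ (s - 1) * M ^ (-s) = M⁻¹ := by
    rw [← Real.rpow_add hM, ← Real.rpow_neg_one]
    ring_nf
  have h_degree : (k : ℝ) ^ (α * (s - 1)) * (k : ℝ) ^ (α * (1 - s) + 4 - r) =
      ((k : ℝ) ^ r)⁻¹ * (k : ℝ) ^ 4 := by
    rw [← Real.rpow_add hk0, show α * (s - 1) + (α * (1 - s) + 4 - r) = -(r : ℝ) + (4 : ℕ) by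
      push_cast; ring, Real.rpow_add hk0, Real.rpow_neg hk0.le, Real.rpow_natCast,
      Real.rpow_natCast]
  rw [if_neg h0, if_neg h0, if_neg h0, coeffWeight, if_neg (by omega), mul_inv, mul_inv, inv_inv]
  linear_combination (-C₁ ^ 2 * C₀ * (k : ℝ) ^ (α * (s - 1)) *
    (k : ℝ) ^ (α * (1 - s) + 4 - r)) * h_base - (C₀ * M⁻¹ * C₁ ^ 2) * h_degree

variable {M : ℕ → ℝ} (hM : ∀ j, 1 ≤ M j)

include hM

theorem prodWeight_extendIndex_rpow (e : ℝ) (m : Fin N → ℕ) :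
    prodWeight M α (extendIndex m) ^ e =
      ∏ j : Fin N, if m j = 0 then 1 else M j ^ e * (m j : ℝ) ^ (α * e) := by
  rw [prodWeight_rpow hM, prod_support_eq_prod_fin (fun j => extendIndex_of_le m)
    fun j k => M j ^ e * (k : ℝ) ^ (α * e)]
  simp only [extendIndex_apply]

theorem prod_inv_coeffWeight_mul_sq {m : Fin N → ℕ} (hm : ∀ j, m j ≠ 1) :
    (∏ j : Fin N, coeffWeight C₀ (M j) r (m j))⁻¹ *
        (∏ j, if m j = 0 then 1 else C₁ * (m j : ℝ) ^ 2) ^ 2 =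
      prodWeight M α (extendIndex m) ^ (s - 1) * ∏ j : Fin N, if m j = 0 then 1 else
        C₁ ^ 2 * C₀ * M j ^ (-s) * (m j : ℝ) ^ (α * (1 - s) + 4 - r) := by
  rw [prodWeight_extendIndex_rpow hM, ← Finset.prod_inv_distrib, ← Finset.prod_pow,
    ← Finset.prod_mul_distrib, ← Finset.prod_mul_distrib]
  exact Finset.prod_congr rfl fun j _ =>
    inv_coeffWeight_mul_sq (one_pos.trans_le (hM j)) (hm j)

theorem prodWeight_rpow_le_of_notMem {ν : ℕ →₀ ℕ} (hs : s ≤ 1)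
    (hν : ν ∉ indexSet (prodWeight M α) ε) : prodWeight M α ν ^ (s - 1) ≤ ε ^ (1 - s) := by
  have h_pos := prodWeight_pos (α := α) hM ν
  rw [← neg_sub, Real.rpow_neg h_pos.le, ← Real.inv_rpow h_pos.le]
  exact Real.rpow_le_rpow (inv_pos.2 h_pos).le (not_le.1 hν).le (sub_nonneg.2 hs)

variable (hC₀ : 0 ≤ C₀) (hs : s ≤ 1) (hα : 0 ≤ α) (hε : 0 ≤ ε)
  (hΛ : (Λ : Set (ℕ →₀ ℕ)) = indexSet (prodWeight M α) ε)
  (hN : ∀ l ∈ Λ, ∀ j, N ≤ j → l j = 0)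

include hC₀ hs hα hε hΛ hN

/-- Where the error does not vanish, the multidegree has no entry `1` and lies outside the index
set, so the full strength `1` of the weight can be split into `s` and `1 - s`. -/
theorem inv_prod_coeffWeight_mul_hermiteError_sq_le {m : Fin N → ℕ}
    (hQ : |smolyakHermite Λ m| ≤ ∏ j, if m j = 0 then 1 else C₁ * (m j : ℝ) ^ 2) :
    (∏ j : Fin N, coeffWeight C₀ (M j) r (m j))⁻¹ * hermiteError Λ m ^ 2 ≤
      ε ^ (1 - s) * ∏ j : Fin N, if m j = 0 then 1 else
        C₁ ^ 2 * C₀ * M j ^ (-s) * (m j : ℝ) ^ (α * (1 - s) + 4 - r) := by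
  have hM0 (j) := one_pos.trans_le (hM j)
  have h_factor : 0 ≤ ∏ j : Fin N, if m j = 0 then 1 else
      C₁ ^ 2 * C₀ * M j ^ (-s) * (m j : ℝ) ^ (α * (1 - s) + 4 - r) :=
    Finset.prod_nonneg fun j _ => by have := hM0 j; split_ifs <;> positivity
  have h_weight : 0 ≤ ∏ j : Fin N, coeffWeight C₀ (M j) r (m j) :=
    Finset.prod_nonneg fun j _ => by have := hM0 j; unfold coeffWeight; split_ifs <;> positivity
  by_cases h_zero : hermiteError Λ m = 0
  · rw [h_zero, zero_pow two_ne_zero, mul_zero]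
    positivity
  have hΛ_lower : IsLowerSet (Λ : Set (ℕ →₀ ℕ)) := hΛ ▸ isLowerSet_indexSet_prodWeight hM hα ε
  have h_notMem : extendIndex m ∉ indexSet (prodWeight M α) ε := fun h =>
    h_zero (hermiteError_eq_zero_of_mem hN hΛ_lower (by rwa [← Finset.mem_coe, hΛ]))
  have h_sq : hermiteError Λ m ^ 2 ≤ (∏ j, if m j = 0 then 1 else C₁ * (m j : ℝ) ^ 2) ^ 2 := by
    rw [← sq_abs]
    exact pow_le_pow_left₀ (abs_nonneg _) (abs_hermiteError_le hN hΛ_lower hQ) 2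
  calc (∏ j : Fin N, coeffWeight C₀ (M j) r (m j))⁻¹ * hermiteError Λ m ^ 2
      ≤ (∏ j : Fin N, coeffWeight C₀ (M j) r (m j))⁻¹ *
          (∏ j, if m j = 0 then 1 else C₁ * (m j : ℝ) ^ 2) ^ 2 :=
        mul_le_mul_of_nonneg_left h_sq (inv_nonneg.2 h_weight)
    _ = prodWeight M α (extendIndex m) ^ (s - 1) * _ :=
        prod_inv_coeffWeight_mul_sq hM fun j hj => h_zero (hermiteError_eq_zero_of_eq_one hj)
    _ ≤ _ := mul_le_mul_of_nonneg_right (prodWeight_rpow_le_of_notMem hM hs h_notMem) h_factor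

end HermiteError

section ErrorBound

theorem norm_le_mul_sqrt_of_hasSum_smul {ι X : Type*} [NormedAddCommGroup X] [NormedSpace ℝ X]
    {e w : ι → ℝ} {c : ι → X} {x : X} (hx : HasSum (fun i => e i • c i) x) (hw : ∀ i, 0 < w i)
    {D E : ℝ} (hD : 0 ≤ D) (hc : ∀ S : Finset ι, ∑ i ∈ S, w i * ‖c i‖ ^ 2 ≤ D ^ 2)
    (he : ∀ S : Finset ι, ∑ i ∈ S, (w i)⁻¹ * e i ^ 2 ≤ E) : ‖x‖ ≤ D * √E := by
  have hE : 0 ≤ E := by simpa using he ∅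
  have h_nonneg (i) : 0 ≤ (w i)⁻¹ * e i ^ 2 := mul_nonneg (inv_pos.2 (hw i)).le (sq_nonneg _)
  refine le_of_tendsto hx.norm (Eventually.of_forall fun S => ?_)
  refine (norm_sum_le _ _).trans (abs_le_of_sq_le_sq' ?_ (by positivity)).2
  calc (∑ i ∈ S, ‖e i • c i‖) ^ 2
      ≤ (∑ i ∈ S, w i * ‖c i‖ ^ 2) * ∑ i ∈ S, (w i)⁻¹ * e i ^ 2 := by
        refine Finset.sum_sq_le_sum_mul_sum_of_sq_le_mul S
          (fun i _ => mul_nonneg (hw i).le (sq_nonneg _)) (fun i _ => h_nonneg i) fun i _ => ?_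
        rw [norm_smul, mul_pow, Real.norm_eq_abs, sq_abs]
        field_simp [(hw i).ne']
        exact le_rfl
    _ ≤ D ^ 2 * E := mul_le_mul (hc S) (he S) (Finset.sum_nonneg fun i _ => h_nonneg i)
        (sq_nonneg D)
    _ = (D * √E) ^ 2 := by rw [mul_pow, Real.sq_sqrt hE]

variable {X : Type*} [NormedAddCommGroup X] [InnerProductSpace ℂ X] [CompleteSpace X]
  {b : ℕ → ℝ} {ξ δ : ℝ} {u : (ℕ → ℝ) → X} {v : (N : ℕ) → (Fin N → ℝ) → X}
  (hu : HolomorphicWith b ξ δ u v)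

include hu

theorem hasSum_integral_sub_smolyakQuad {N : ℕ} (hN1 : 1 ≤ N) (hv_cont : Continuous (v N))
    (hv : MemLp (v N) 2 (gaussFin N))
    (hs : Summable fun m => ‖∫ y, hermiteProd m y • v N y ∂gaussFin N‖) {Λ : Finset (ℕ →₀ ℕ)}
    (hN : ∀ l ∈ Λ, ∀ j, N ≤ j → l j = 0) (hΛ : IsLowerSet (Λ : Set (ℕ →₀ ℕ))) :
    HasSum (fun m => hermiteError Λ m • ∫ y, hermiteProd m y • v N y ∂gaussFin N)
      ((∫ y, v N y ∂gaussFin N) - smolyakQuad Λ v) := by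
  have h_integral : HasSum (fun m : Fin N → ℕ => (if m = 0 then (1 : ℝ) else 0) •
      ∫ y, hermiteProd m y • v N y ∂gaussFin N) (∫ y, v N y ∂gaussFin N) := by
    refine (hasSum_ite_eq (0 : Fin N → ℕ) (∫ y, v N y ∂gaussFin N)).congr_fun fun m => ?_
    split_ifs with hm <;> simp [hm]
  simpa only [hermiteError, sub_smul] using h_integral.sub
    (hasSum_smolyakQuad hu hN1 (hasSum_hermiteProd_smul hv_cont hv hs) hN hΛ)

theorem norm_integral_sub_smolyakQuad_le (hδ : 0 ≤ δ) {M : ℕ → ℝ} (hM : ∀ j, 1 ≤ M j)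
    {C₀ C₁ α s ε B : ℝ} {r : ℕ} (hr : 2 ≤ r) (hC₀ : 0 < C₀) {N : ℕ} (hN1 : 1 ≤ N)
    (hv_cont : Continuous (v N)) (hv : MemLp (v N) 2 (gaussFin N))
    (h_coeff : ∀ S : Finset (Fin N → ℕ), ∑ ν ∈ S, (∏ j : Fin N, coeffWeight C₀ (M j) r (ν j)) *
      ‖∫ y, hermiteProd ν y • v N y ∂gaussFin N‖ ^ 2 ≤ δ ^ 2)
    (hα : 0 ≤ α) (hs : s ≤ 1) (hε : 0 ≤ ε) {Λ : Finset (ℕ →₀ ℕ)}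
    (hΛ : (Λ : Set (ℕ →₀ ℕ)) = indexSet (prodWeight M α) ε)
    (hN : ∀ l ∈ Λ, ∀ j, N ≤ j → l j = 0)
    (hQ : ∀ m : Fin N → ℕ, |smolyakHermite Λ m| ≤ ∏ j, if m j = 0 then 1 else C₁ * (m j : ℝ) ^ 2)
    (hB : ∀ S : Finset (Fin N → ℕ), ∑ m ∈ S, ∏ j : Fin N, (if m j = 0 then 1 else
      C₁ ^ 2 * C₀ * M j ^ (-s) * (m j : ℝ) ^ (α * (1 - s) + 4 - r)) ≤ B) :
    ‖(∫ y, v N y ∂gaussFin N) - smolyakQuad Λ v‖ ≤ δ * √(ε ^ (1 - s) * B) := by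
  have h_weight (m : Fin N → ℕ) : 0 < ∏ j : Fin N, coeffWeight C₀ (M j) r (m j) :=
    Finset.prod_pos fun j _ => coeffWeight_pos hC₀ (one_pos.trans_le (hM j)) r (m j)
  have h_inv_weight : Summable fun m : Fin N → ℕ =>
      (∏ j : Fin N, coeffWeight C₀ (M j) r (m j))⁻¹ := by
    simp only [← Finset.prod_inv_distrib]
    exact summable_prod_of_nonneg (g := fun j k => (coeffWeight C₀ (M j) r k)⁻¹)
      (fun j k => (inv_pos.2 (coeffWeight_pos hC₀ (one_pos.trans_le (hM j)) r k)).le)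
      fun j => summable_inv_coeffWeight hr
  have hΛ_lower : IsLowerSet (Λ : Set (ℕ →₀ ℕ)) := hΛ ▸ isLowerSet_indexSet_prodWeight hM hα ε
  refine norm_le_mul_sqrt_of_hasSum_smul (hasSum_integral_sub_smolyakQuad hu hN1 hv_cont hv
    (summable_norm_of_sum_mul_sq_le h_weight h_inv_weight h_coeff) hN
    hΛ_lower) h_weight hδ h_coeff fun S => ?_
  refine (Finset.sum_le_sum fun m _ => inv_prod_coeffWeight_mul_hermiteError_sq_le hM hC₀.le hs hα
    hε hΛ hN (hQ m)).trans ?_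
  rw [← Finset.mul_sum]
  exact mul_le_mul_of_nonneg_left (hB S) (by positivity)

theorem HolomorphicWith.exists_error_bound (hδ : 0 ≤ δ) {M : ℕ → ℝ} (hM : ∀ j, 1 ≤ M j)
    {C₀ α s : ℝ} {r : ℕ} (hC₀ : 0 < C₀)
    (h_coeff : ∀ N : ℕ, 1 ≤ N → Continuous (v N) ∧ MemLp (v N) 2 (gaussFin N) ∧
      ∀ S : Finset (Fin N → ℕ), ∑ ν ∈ S, (∏ j : Fin N, coeffWeight C₀ (M j) r (ν j)) *
        ‖∫ y, hermiteProd ν y • v N y ∂gaussFin N‖ ^ 2 ≤ δ ^ 2)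
    (hα : 0 ≤ α) (hs : s ≤ 1) (hMs : Summable fun j => M j ^ (-s)) (hαr : 5 + α * (1 - s) < r) :
    ∃ B : ℝ, 0 < B ∧ ∀ ε : ℝ, 0 ≤ ε → ∀ Λ : Finset (ℕ →₀ ℕ),
      (Λ : Set (ℕ →₀ ℕ)) = indexSet (prodWeight M α) ε →
        ‖(∫ y, u y ∂gaussInf) - smolyakQuad Λ v‖ ≤ δ * √(ε ^ (1 - s) * B) := by
  have hr : 2 ≤ r := by
    have : (2 : ℝ) ≤ r := by linarith [mul_nonneg hα (sub_nonneg.2 hs)]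
    exact_mod_cast this
  obtain ⟨C₁, -, hQ⟩ := exists_abs_smolyakHermite_le
  have hM0 (j) := one_pos.trans_le (hM j)
  obtain ⟨B, hB0, hB⟩ := exists_sum_prod_rpow_le (θ := fun j => C₁ ^ 2 * C₀ * M j ^ (-s))
    (e := α * (1 - s) + 4 - r) (fun j => by have := hM0 j; positivity) (hMs.mul_left _)
    (by linarith)
  refine ⟨B, hB0, fun ε hε Λ hΛ => ?_⟩
  obtain ⟨N₀, hN₀1, hN₀⟩ := exists_forall_le_eq_zero Λ 1
  refine le_of_tendsto ((hu.tendsto_integral fun N hN => (h_coeff N hN).2.1).sub_const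
    (smolyakQuad Λ v)).norm ?_
  filter_upwards [eventually_ge_atTop N₀] with N hN
  have hNΛ : ∀ l ∈ Λ, ∀ j, N ≤ j → l j = 0 := fun l hl j hj => hN₀ l hl j (hN.trans hj)
  obtain ⟨hv_cont, hv, h_sum⟩ := h_coeff N (hN₀1.trans hN)
  exact norm_integral_sub_smolyakQuad_le hu hδ hM hr hC₀ (hN₀1.trans hN) hv_cont hv h_sum hα hs hε
    hΛ hNΛ (hQ N Λ hNΛ) (hB N)

end ErrorBound

section Rate

theorem cWeight_two_eq_prodWeight (b : ℕ → ℝ) (p ξ K τ : ℝ) (r : ℕ) :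
    cWeight 2 K (rhoSeq b p ξ r) r τ = prodWeight (fun j => max 1 (K * (ξ /
      (4 * √(r.factorial : ℝ) * (∑' i, b i ^ p) ^ (1 / p))) * b j ^ (p - 1)) ^ 4) (r - τ) := by
  funext ν
  refine Finset.prod_congr rfl fun j _ => ?_
  rw [rhoSeq, mul_comm (b j ^ (p - 1)), ← mul_assoc]

theorem summable_max_pow_rpow_neg {b : ℕ → ℝ} (hb : ∀ j, 0 < b j) {p κ s : ℝ}
    (hbp : Summable fun j => b j ^ p) (hκ : 0 < κ) (hs : 0 ≤ s) (hsp : 4 * s * (1 - p) = p) :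
    Summable fun j => (max 1 (κ * b j ^ (p - 1)) ^ 4) ^ (-s) := by
  refine Summable.of_nonneg_of_le (fun j => by positivity) (fun j => ?_)
    (hbp.mul_left ((κ ^ 4) ^ (-s)))
  have hbj := hb j
  calc (max 1 (κ * b j ^ (p - 1)) ^ 4) ^ (-s)
      ≤ ((κ * b j ^ (p - 1)) ^ 4) ^ (-s) :=
        Real.rpow_le_rpow_of_nonpos (by positivity)
          (pow_le_pow_left₀ (by positivity) (le_max_right _ _) 4) (neg_nonpos.2 hs)
    _ = (κ ^ 4) ^ (-s) * b j ^ ((p - 1) * 4 * -s) := by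
        rw [mul_pow, Real.mul_rpow (by positivity) (by positivity), Real.rpow_mul hbj.le,
          Real.rpow_mul hbj.le, Real.rpow_ofNat]
    _ = (κ ^ 4) ^ (-s) * b j ^ p := by
        congr 2
        linarith

theorem exists_smolyakQuad_rate_of_error_bound {X : Type*} [NormedAddCommGroup X] [NormedSpace ℝ X]
    {v : (N : ℕ) → (Fin N → ℝ) → X} {x : X} {c : (ℕ →₀ ℕ) → ℝ} {δ s B₁ B₂ : ℝ} (hδ : 0 ≤ δ)
    (hs : 0 < s) (hB₁ : 0 < B₁) (hB₂ : 0 ≤ B₂)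
    (h_card : ∀ ε : ℝ, 0 < ε → ∀ S : Finset (ℕ →₀ ℕ), ↑S ⊆ indexSet c ε →
      ((∑ ν ∈ S, (Finset.Icc 0 ν).card : ℕ) : ℝ) ≤ B₁ * ε ^ (-s))
    (h_err : ∀ ε : ℝ, 0 ≤ ε → ∀ Λ : Finset (ℕ →₀ ℕ), (Λ : Set (ℕ →₀ ℕ)) = indexSet c ε →
      ‖x - smolyakQuad Λ v‖ ≤ δ * √(ε ^ (1 - s) * B₂)) :
    ∃ C : ℝ, 0 < C ∧ ∀ n : ℕ, 1 ≤ n → ∃ ε : ℝ, 0 < ε ∧ ∃ hfin : (indexSet c ε).Finite,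
      (pts (indexSet c ε)).encard ≤ (n : ℕ∞) ∧
        ‖x - smolyakQuad hfin.toFinset v‖ ≤ C * (n : ℝ) ^ (-((1 - s) / (2 * s))) := by
  set E := (1 - s) / (2 * s) with hE
  refine ⟨δ * √B₂ * B₁ ^ E + 1, by positivity, fun n hn => ?_⟩
  have hn0 : (0 : ℝ) < n := by exact_mod_cast hn
  have h_base : 0 < (n : ℝ) / B₁ := by positivity
  -- chosen so that the bound `B₁ ε⁻ˢ` on the number of points equals `n`
  set ε := ((n : ℝ) / B₁) ^ (-(1 / s)) with hε
  have hε0 : 0 < ε := by positivity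
  have h_card_le (S : Finset (ℕ →₀ ℕ)) (hS : ↑S ⊆ indexSet c ε) :
      ((∑ ν ∈ S, (Finset.Icc 0 ν).card : ℕ) : ℝ) ≤ n := by
    refine (h_card ε hε0 S hS).trans_eq ?_
    rw [hε, ← Real.rpow_mul h_base.le, show -(1 / s) * -s = 1 by field_simp, Real.rpow_one,
      mul_div_cancel₀ _ hB₁.ne']
  have hfin := finite_of_sum_card_Icc_le h_card_le
  have h_pts : (pts (indexSet c ε)).encard ≤ (n : ℕ∞) := by
    have h_encard := encard_pts_le hfin.toFinset
    rw [hfin.coe_toFinset] at h_encard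
    exact h_encard.trans (Nat.cast_le.2 (by exact_mod_cast h_card_le hfin.toFinset (by simp)))
  have h_sqrt : √(ε ^ (1 - s) * B₂) = √B₂ * (B₁ ^ E * (n : ℝ) ^ (-E)) := by
    rw [mul_comm, Real.sqrt_mul hB₂, Real.sqrt_eq_rpow (_ ^ (1 - s)), hε, ← Real.rpow_mul h_base.le,
      ← Real.rpow_mul h_base.le, show -(1 / s) * (1 - s) * (1 / 2) = -E by rw [hE]; field_simp,
      Real.div_rpow hn0.le hB₁.le, Real.rpow_neg hB₁.le, div_inv_eq_mul, mul_comm (B₁ ^ E)]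
  refine ⟨ε, hε0, hfin, h_pts, ?_⟩
  calc ‖x - smolyakQuad hfin.toFinset v‖ ≤ δ * √(ε ^ (1 - s) * B₂) :=
        h_err ε hε0.le hfin.toFinset hfin.coe_toFinset
    _ = δ * √B₂ * B₁ ^ E * (n : ℝ) ^ (-E) := by rw [h_sqrt]; ring
    _ ≤ (δ * √B₂ * B₁ ^ E + 1) * (n : ℝ) ^ (-E) := by gcongr; linarith

variable {X : Type*} [NormedAddCommGroup X] [InnerProductSpace ℂ X] [CompleteSpace X]

theorem HolomorphicWith.exists_smolyakQuad_rate {b : ℕ → ℝ} {ξ δ : ℝ} {u : (ℕ → ℝ) → X}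
    {v : (N : ℕ) → (Fin N → ℝ) → X} (hu : HolomorphicWith b ξ δ u v) (hb : ∀ j, 0 < b j)
    (hξ : 0 < ξ) (hδ : 0 ≤ δ) {p s : ℝ} (hp0 : 0 < p) (hp1 : p ≤ 1)
    (hbp : Summable fun j => b j ^ p) (hs0 : 0 < s) (hs1 : s ≤ 1) (hsp : 4 * s * (1 - p) = p)
    {κ α : ℝ} {r : ℕ} (hκ : 0 < κ) (hα : 2 < α * s) (hαr : 5 + α * (1 - s) < r) :
    ∃ C : ℝ, 0 < C ∧ ∀ n : ℕ, 1 ≤ n → ∃ ε : ℝ, 0 < ε ∧ ∃ hfin : (indexSet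
        (prodWeight (fun j => max 1 (κ * b j ^ (p - 1)) ^ 4) α) ε).Finite,
      (pts (indexSet (prodWeight (fun j => max 1 (κ * b j ^ (p - 1)) ^ 4) α) ε)).encard ≤
        (n : ℕ∞) ∧ ‖(∫ y, u y ∂gaussInf) - smolyakQuad hfin.toFinset v‖ ≤
          C * (n : ℝ) ^ (-((1 - s) / (2 * s))) := by
  have hα0 : 0 ≤ α := (pos_of_mul_pos_left (two_pos.trans hα) hs0.le).le
  have hr : 2 ≤ r := by
    have : (2 : ℝ) ≤ r := by linarith [mul_nonneg hα0 (sub_nonneg.2 hs1)]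
    exact_mod_cast this
  have hM (j : ℕ) : 1 ≤ max 1 (κ * b j ^ (p - 1)) ^ 4 := one_le_pow₀ (le_max_left _ _)
  have hMs := summable_max_pow_rpow_neg hb hbp hκ hs0.le hsp
  obtain ⟨C₀, hC₀, h_coeff⟩ := hu.exists_coeff_bound hb hξ hδ hp0 hp1 hbp hr κ
  obtain ⟨B₁, hB₁, h_card⟩ := exists_sum_card_Icc_le hM hs0.le hMs hα
  obtain ⟨B₂, hB₂, h_err⟩ :=
    hu.exists_error_bound hδ hM (one_pos.trans_le hC₀) h_coeff hα0 hs1 hMs hαr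
  exact exists_smolyakQuad_rate_of_error_bound hδ hs0 hB₁ hB₂.le h_card h_err

end Rate

end SparseGrid

theorem theorem6p15_general {X : Type*} [NormedAddCommGroup X] [InnerProductSpace ℂ X]
    [CompleteSpace X] (b : ℕ → ℝ) (hb : ∀ j, 0 < b j) (ξ δ : ℝ) (hξ : 0 < ξ) (hδ : 0 ≤ δ)
    (p : ℝ) (hp0 : 0 < p) (hp1 : p ≤ 4 / 5) (hbp : Summable fun j => b j ^ p)
    (u : (ℕ → ℝ) → X) (v : (N : ℕ) → (Fin N → ℝ) → X)
    (hu : SparseGrid.HolomorphicWith b ξ δ u v)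
    (r : ℕ) (τ K : ℝ) (hr : max 2 (5 - τ) < ((r : ℝ) - τ) * (p / (1 - p)) / 4) (hK : 0 < K) :
    ∃ C : ℝ, 0 < C ∧ ∀ n : ℕ, 1 ≤ n → ∃ ε : ℝ, 0 < ε ∧
      ∃ hfin : (SparseGrid.indexSet
          (SparseGrid.cWeight 2 K (SparseGrid.rhoSeq b p ξ r) r τ) ε).Finite,
        (SparseGrid.pts (SparseGrid.indexSet
          (SparseGrid.cWeight 2 K (SparseGrid.rhoSeq b p ξ r) r τ) ε)).encard ≤ (n : ℕ∞) ∧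
        ‖(∫ y, u y ∂SparseGrid.gaussInf) - SparseGrid.smolyakQuad hfin.toFinset v‖ ≤
          C * (n : ℝ) ^ (-2 / p + 5 / 2) := by
  have h1p : 0 < 1 - p := by linarith
  set s := p / (4 * (1 - p)) with hs
  have hs0 : 0 < s := by positivity
  have hs1 : s ≤ 1 := by
    rw [hs, div_le_one (by positivity)]
    linarith
  have hsp : 4 * s * (1 - p) = p := by
    rw [hs]
    field_simp
  have h_exponent : -2 / p + 5 / 2 = -((1 - s) / (2 * s)) := by
    rw [hs]
    field_simp
    ring
  rw [show ((r : ℝ) - τ) * (p / (1 - p)) / 4 = (r - τ) * s by rw [hs]; field_simp,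
    max_lt_iff] at hr
  have hκ : 0 < K * (ξ / (4 * √(r.factorial : ℝ) * (∑' i, b i ^ p) ^ (1 / p))) := by
    have := SparseGrid.tsum_rpow_pos hb hbp
    positivity
  rw [SparseGrid.cWeight_two_eq_prodWeight, h_exponent]
  exact hu.exists_smolyakQuad_rate hb hξ hδ hp0 (by linarith) hbp hs0 hs1 hsp hκ hr.1
    (by linarith [hr.2])

theorem theorem6p15 {X : Type*} [NormedAddCommGroup X] [InnerProductSpace ℂ X] [CompleteSpace X]
    [TopologicalSpace.SeparableSpace X]
    (b : ℕ → ℝ) (hb : ∀ j, 0 < b j) (ξ δ : ℝ) (hξ : 0 < ξ) (hδ : 0 < δ)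
    (p : ℝ) (hp0 : 0 < p) (hp1 : p < 4 / 5) (hbp : Summable fun j => b j ^ p)
    (u : (ℕ → ℝ) → X) (v : (N : ℕ) → (Fin N → ℝ) → X)
    (hu : SparseGrid.HolomorphicWith b ξ δ u v)
    (r : ℕ) (τ K : ℝ) (hτ : 0 < τ)
    (hr : max 2 (5 - τ) < ((r : ℝ) - τ) * (p / (1 - p)) / 4) (hK : 0 < K) :
    ∃ C : ℝ, 0 < C ∧ ∀ n : ℕ, 1 ≤ n → ∃ ε : ℝ, 0 < ε ∧
      ∃ hfin : (SparseGrid.indexSet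
          (SparseGrid.cWeight 2 K (SparseGrid.rhoSeq b p ξ r) r τ) ε).Finite,
        (SparseGrid.pts (SparseGrid.indexSet
          (SparseGrid.cWeight 2 K (SparseGrid.rhoSeq b p ξ r) r τ) ε)).encard ≤ (n : ℕ∞) ∧
        ‖(∫ y, u y ∂SparseGrid.gaussInf) - SparseGrid.smolyakQuad hfin.toFinset v‖ ≤
          C * (n : ℝ) ^ (-2 / p + 5 / 2) :=
  theorem6p15_general b hb ξ δ hξ hδ.le p hp0 hp1.le hbp u v hu r τ K hr hK
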